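/- **Setting.** Let $\mu,\alpha>0$. Let $(\ell,g,h,L,G,H)$ be the hyperbolic Delaunay variables, on the domain $D$: $\ell,g,h\in\mathbb R$, $L<0$, $G>0$, $|H|<G$. Put $\eta=-G/L$, $e=\sqrt{1+\eta^2}$, $p=G^2/\mu$, $s=\sin I$ with $I=\arccos(H/G)$. Let $u$ be the solution of $\ell=e\sinh u-u$, and let $f$ be the true anomaly, $\sqrt{e+1}\tanh\frac u2=\sqrt{e-1}\tan\frac f2$, on the branch $f=2\pi+2\arctan\big(\sqrt{\tfrac{e+1}{e-1}}\tanh\tfrac u2\big)$; thus $f=2\pi$ at the periapsis and $f\to\pi+\arctan\eta$ at the incoming asymptote $\ell\to-\infty$. The polar variables are $$r=\frac{p}{1+e\cos f},\quad \theta=f+g,\quad \nu=h,\quad R=\frac Gp\,e\sin f,\quad \Theta=G,\quad N=H,$$ and $\{\cdot,\cdot\}$ is the Poisson bracket, $\{A,B\}=\sum (A_{q}B_{P}-A_{P}B_{q})$ over the conjugate pairs $(q,P)=(\ell,L),(g,G),(h,H)$. The main problem Hamiltonian is $\mathcal M=\mathcal M_{0,0}+J_2\mathcal M_{1,0}$ with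 $$\mathcal M_{0,0}=\frac12\Big(R^2+\frac{\Theta^2}{r^2}\Big)-\frac\mu r,\qquad \mathcal M_{1,0}=-\frac14\frac\mu r\frac{\alpha^2}{r^2}\,(2-3s^2+3s^2\cos2\theta),\qquad \mathcal M_{n,0}=0\ (n\ge2).$$ For functions $F_{n,0}$ $(n\ge0)$ and generating functions $\mathcal U_1,\mathcal U_2,\dots$ the Lie transform is given by the triangle $$F_{n,j+1}=F_{n+1,j}+\sum_{k=0}^{n}\binom nk\{F_{n-k,j},\mathcal U_{k+1}\},$$ the transformed function being $\sum_n\frac{J_2^n}{n!}F_{0,n}$. In particular a polar variable $\xi$ has the corrections $\xi_{0,1}=\{\xi,\mathcal U_1\}$ and $\xi_{0,2}=\{\xi_{0,1},\mathcal U_1\}+\{\xi,\mathcal U_2\}$. "At infinity" means the limit $\ell\to-\infty$ with $g,h,L,G,H$ fixed. The first-order generating function is $$\mathcal U_1=-\frac G8\frac{\alpha^2}{p^2}\Big\{s^2[3e\sin(f+2g)+3\sin(2f+2g)+e\sin(3f+2g)]-(6s^2-4)e\sin f\Big\}+\mathcal C_0,$$ $$\mathcal C_0=\frac G4\frac{\alpha^2}{p^2}\Big\{(3s^2-2)\eta-\frac{s^2}{e^2}\Big[\eta^3\cos2g+\tfrac12(3e^2-2)\sin2g\Big]\Big\}.$$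 Define, with $\psi=\pi-f+\arctan\eta$, $j_0=-2(k\bmod2)-1$, $j_1=6-2(k\bmod2)$, $$\mathcal U_2=G\frac{\alpha^4}{p^4}\,\Psi\,\psi+G\frac{\alpha^4}{p^4}\frac1{256e^3\eta}\sum_{k=0}^2s^{2k}\bigg\{\sum_{j=j_0}^{5}\sum_{i=0}^3q_{k,i,j}\,e^{2i+1-(j\bmod2)}\cos(jf+2kg)+\eta\sum_{j=j_0}^{j_1}\sum_{i=0}^2p_{k,i,j}\,e^{2i+1-(j\bmod2)}\sin(jf+2kg)\bigg\},$$ $$\Psi=\frac{3}{64e^2}\Big\{\big[2e^4(15s^2-14)+8(3e^2-2)(5s^2-4)\big]s^2\cos2g-16\eta^3(5s^2-4)s^2\sin2g-e^4(5s^4+8s^2-8)\Big\},$$ where the inclination polynomials $q_{k,i,j}$ are $$\begin{array}{r|c|c|c}(i,j)&k=0&k=1&k=2\\ \hline (0,-2)&0&64(3 s^2-2)&0\\ (0,-1)&0&160 (3 s^2-2)&0\\ (0,0)&0&16 (s^2+6)&-48\\ (0,1)&0&0&-48\\ (0,2)&-24 s^2 (15 s^2-4)&0&-120\\ (0,3)&-112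 s^4&0&0\\ (0,4)&-72 s^4&0&0\\ (1,-3)&0&8 (3 s^2-2)&0\\ (1,-2)&0&-80 (3 s^2-2)&0\\ (1,-1)&-12 s^2 (13 s^2-4)&-8 (45 s^2-26)&-12\\ (1,0)&2 (255 s^4-576 s^2+272)&8 (149 s^2-142)&42\\ (1,1)&-12 s^2 (13 s^2-4)&96 (2 s^2-1)&-36\\ (1,2)&12 s^2 (45 s^2-16)&-96 (6 s^2-5)&60\\ (1,3)&4 s^2 (7 s^2+8)&0&-120\\ (1,4)&90 s^4&0&-54\\ (1,5)&-12 s^4&0&0\\ (2,-3)&0&-10 (3 s^2-2)&0\\ (2,-2)&0&16 (3 s^2-2)&0\\ (2,-1)&8 (75 s^4-72 s^2+20)&-2 (153 s^2-134)&15\\ (2,0)&6 (11 s^4+64 s^2-48)&-4 (329 s^2-278)&6\\ (2,1)&8 (75 s^4-72 s^2+20)&-6 (127 s^2-90)&81\\ (2,2)&4 (27 s^4-72 s^2+32)&24 (9 s^2-10)&60\\ (2,3)&s^2 (145 s^2-64)&-2 (195 s^2-146)&105\\ (2,4)&-18 s^4&-36 (3 s^2-2)&54\\ (2,5)&15 s^4&0&-9\\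 (3,-3)&0&2 (3 s^2-2)&0\\ (3,-1)&-6 (5 s^4+4 s^2-4)&24 (7 s^2-6)&-3\\ (3,1)&-6 (5 s^4+4 s^2-4)&12 (25 s^2-22)&3\\ (3,3)&-25 s^4-16 s^2+16&8 (15 s^2-14)&15\\ (3,5)&-3 s^4&-6 (3 s^2-2)&9\\ \end{array}$$ the inclination polynomials $p_{k,i,j}$ are $$\begin{array}{r|c|c|c}(i,j)&k=0&k=1&k=2\\ \hline (0,-2)&0&-64 (3 s^2-2)&0\\ (0,-1)&0&-160 (3 s^2-2)&0\\ (0,0)&0&-16 (s^2+6)&48\\ (0,1)&0&0&48\\ (0,2)&-24 s^2 (15 s^2-4)&0&120\\ (0,3)&-112 s^4&0&0\\ (0,4)&-72 s^4&0&0\\ (1,-3)&0&-8 (3 s^2-2)&0\\ (1,-2)&0&48 (3 s^2-2)&0\\ (1,-1)&12 s^2 (13 s^2-4)&24 (5 s^2-2)&12\\ (1,0)&0&-16 (75 s^2-68)&-18\\ (1,1)&-12 s^2 (13 s^2-4)&-96 (2 s^2-1)&60\\ (1,2)&72 s^2 (5 s^2-2)&-32 (15 s^2-13)&0\\ (1,3)&4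 s^2 (8-7 s^2)&0&120\\ (1,4)&54 s^4&0&66\\ (1,5)&-12 s^4&0&0\\ (2,-3)&0&6 (3 s^2-2)&0\\ (2,-1)&-2 (27 s^4+180 s^2-128)&18 (17 s^2-14)&-9\\ (2,0)&0&-6 (17 s^2-18)&-9\\ (2,1)&2 (27 s^4+180 s^2-128)&-2 (825 s^2-742)&-45\\ (2,2)&6 (5 s^4+8 s^2-8)&-24 (s^2-2)&-15\\ (2,3)&3 s^2 (39 s^2-16)&2 (55 s^2-34)&-15\\ (2,4)&0&6 (13 s^2-10)&-3\\ (2,5)&9 s^4&0&21\\ (2,6)&0&0&3\\ \end{array}$$ and all the entries that are not listed are $0$. Let $\mathcal U_2^{*}$ be the expression of $\mathcal U_2$ with $\psi$ replaced by $-f$ and with the terms $j=0$ of both sums omitted. Let $$A_0=G\frac{\alpha^4}{p^4}\frac{1}{256e^2}\Big\{-2s^2\big[3e^4(17s^2-18)+8e^2(75s^2-68)+8(s^2+6)+96\eta^3(5s^2-4)(\pi+\arctan\eta)\big]\sin2g-3(3e^4+6e^2-16)s^4\sin4g$$ $$\quad+\frac{4s^2}{\eta^2}\Big\{6\eta^2\big[e^4(15s^2-14)+4(3e^2-2)(5s^2-4)\big](\pi+\arctan\eta)+\eta\big[e^4(278-329s^2)+e^2(298s^2-284)+4(s^2+6)\big]\Big\}\cos2g+6\eta(e^2+8)s^4\cos4g\Big\},$$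 $$A_1=G\frac{\alpha^4}{p^4}\frac{3}{128\eta}(1-s^2)\big[2e^2\eta(5s^2+13)(\pi+\arctan\eta)-e^2(11s^2+75)-85s^2+107\big],$$ $$A_2=G\frac{\alpha^4}{p^4}\frac1{128\eta}\big[81e^2-30e^2\eta(\pi+\arctan\eta)-49\big].$$ **Claim.** (a) The polar variables, $\mathcal U_1$ and $\mathcal U_2$ are smooth functions of the Delaunay variables on $D$. (b) The Lie transformation with generating functions $\mathcal U_1,\mathcal U_2$ yields, through second order, the quasi-Keplerian Hamiltonian: on $D$, $$\mathcal M_{0,1}=-\frac12\frac{\Theta^2}{r^2}\frac12\frac{\alpha^2}{p^2}(2-3s^2),\qquad \mathcal M_{0,2}=-\frac{\Theta^2}{r^2}\frac{\alpha^4}{p^4}\frac1{16}(21s^4-42s^2+20).$$ (c) The second-order corrections $r_{0,2},\theta_{0,2},\nu_{0,2},R_{0,2},\Theta_{0,2},N_{0,2}$ all vanish at infinity. (d) $\mathcal U_2=\mathcal U_2^{*}+A_0+A_1+A_2$ on $D$. (e) The integration constants are determined by the boundary conditions. Let $V$ be differentiable on $D$, and use $\mathcal U_1,V$ as generating functions.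 Then $\mathcal M_{0,2}$ is the function in (b) if and only if $V=\mathcal U_2^{*}+Q_0(g,h,L,G,H)$ for some function $Q_0$. In this case $R_{0,2}$ vanishes at infinity, and - $\Theta_{0,2}$ and $N_{0,2}$ vanish at infinity if and only if $Q_0=A_0+Q_1(L,G,H)$ for some function $Q_1$; - $\Theta_{0,2},N_{0,2},\nu_{0,2}$ vanish at infinity if and only if moreover $Q_1=A_1+Q_2(L,G)$ for some function $Q_2$; - $\Theta_{0,2},N_{0,2},\nu_{0,2},\theta_{0,2}$ vanish at infinity if and only if moreover $Q_2=A_2+Q_3(L)$ for some function $Q_3$, that is, $V=\mathcal U_2+Q_3(L)$; - all six second-order corrections vanish at infinity if and only if $V-\mathcal U_2$ is constant on $D$. -/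

import Mathlib

open Filter Topology
open scoped ContDiff

noncomputable section

namespace HypJ2

/-! Phase space of the hyperbolic Delaunay variables.  A point is `x = (ℓ, g, h, L, G, H)`, with
`x 0 = ℓ`, `x 1 = g`, `x 2 = h`, `x 3 = L`, `x 4 = G`, `x 5 = H`. -/

abbrev Phase : Type := Fin 6 → ℝ

/-- Hyperbolic, non-rectilinear, non-equatorial orbits. -/
def domain : Set Phase := {x | x 3 < 0 ∧ 0 < x 4 ∧ |x 5| < x 4}

/-- Partial derivative with respect to the `i`-th hyperbolic Delaunay variable. -/
def pd (i : Fin 6) (F : Phase → ℝ) (x : Phase) : ℝ :=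
  deriv (fun t : ℝ => F (Function.update x i t)) (x i)

/-- Poisson bracket `{A, B}`; the conjugate pairs are `(ℓ, L)`, `(g, G)`, `(h, H)`. -/
def poisson (A B : Phase → ℝ) (x : Phase) : ℝ :=
  (pd 0 A x * pd 3 B x - pd 3 A x * pd 0 B x)
    + (pd 1 A x * pd 4 B x - pd 4 A x * pd 1 B x)
    + (pd 2 A x * pd 5 B x - pd 5 A x * pd 2 B x)

/-! Orbital functions. -/

def eta (x : Phase) : ℝ := -(x 4 / x 3)

def ecc (x : Phase) : ℝ := Real.sqrt (1 + eta x ^ 2)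

/-- The parameter of the conic as a function of the angular momentum. -/
def parameter (μ Θ : ℝ) : ℝ := Θ ^ 2 / μ

/-- Sine of the inclination `I = arccos (N / Θ)`. -/
def sinInc (Θ N : ℝ) : ℝ := Real.sin (Real.arccos (N / Θ))

/-- The hyperbolic anomaly: the solution `u` of `ℓ = e sinh u - u`. -/
def hypAnomaly (e l : ℝ) : ℝ := Function.invFun (fun u : ℝ => e * Real.sinh u - u) l

theorem strictMono_kepler {e : ℝ} (he : 1 ≤ e) :
    StrictMono (fun u : ℝ => e * Real.sinh u - u) := by
  intro a b hab
  have h1 : Real.sinh a - a < Real.sinh b - b := Real.sinh_sub_id_strictMono hab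
  have h2 : Real.sinh a < Real.sinh b := Real.sinh_lt_sinh.2 hab
  show e * Real.sinh a - a < e * Real.sinh b - b
  nlinarith

theorem kepler_hypAnomaly {e : ℝ} (he : 1 < e) (l : ℝ) :
    e * Real.sinh (hypAnomaly e l) - hypAnomaly e l = l := by
  have hc : Continuous (fun u : ℝ => e * Real.sinh u - u) := by fun_prop
  have hs : Function.Surjective (fun u : ℝ => e * Real.sinh u - u) := by
    have h1 : 0 < e - 1 := by linarith
    refine hc.surjective ?_ ?_
    · refine tendsto_atTop_mono' atTop ?_ (tendsto_id.const_mul_atTop h1)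
      filter_upwards [eventually_ge_atTop (0 : ℝ)] with u hu
      have := Real.self_le_sinh_iff.2 hu
      simp only [id]
      nlinarith
    · refine tendsto_atBot_mono' atBot ?_ (tendsto_id.const_mul_atBot h1)
      filter_upwards [eventually_le_atBot (0 : ℝ)] with u hu
      have := Real.sinh_le_self_iff.2 hu
      simp only [id]
      nlinarith
  exact Function.invFun_eq (hs l)

/-- The true anomaly, `√(e + 1) tanh (u / 2) = √(e - 1) tan (f / 2)`, on the branch on which the
periapsis is `f = 2π` and the incoming asymptote (`ℓ → -∞`) is `f = π + arctan η`. -/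
def trueAnomaly (e l : ℝ) : ℝ :=
  2 * Real.pi
    + 2 * Real.arctan (Real.sqrt ((e + 1) / (e - 1)) * Real.tanh (hypAnomaly e l / 2))

theorem trueAnomaly_spec {e : ℝ} (he : 1 < e) (l : ℝ) :
    Real.sqrt (e + 1) * Real.tanh (hypAnomaly e l / 2)
      = Real.sqrt (e - 1) * Real.tan (trueAnomaly e l / 2) := by
  have h : trueAnomaly e l / 2
      = Real.arctan (Real.sqrt ((e + 1) / (e - 1)) * Real.tanh (hypAnomaly e l / 2))
        + Real.pi := by
    unfold trueAnomaly; ring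
  have h1 : Real.sqrt (e - 1) ≠ 0 := (Real.sqrt_pos.2 (by linarith)).ne'
  rw [h, Real.tan_add_pi, Real.tan_arctan, Real.sqrt_div (by linarith)]
  field_simp

def anom (x : Phase) : ℝ := trueAnomaly (ecc x) (x 0)

def semilatus (μ : ℝ) (x : Phase) : ℝ := parameter μ (x 4)

def incl (x : Phase) : ℝ := sinInc (x 4) (x 5)

/-- The polar variables `ξ = (r, θ, ν, R, Θ, N)` as functions of the Delaunay variables. -/
def polar (μ : ℝ) : Fin 6 → Phase → ℝ :=
  ![fun x => semilatus μ x / (1 + ecc x * Real.cos (anom x)),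
    fun x => anom x + x 1,
    fun x => x 2,
    fun x => x 4 / semilatus μ x * (ecc x * Real.sin (anom x)),
    fun x => x 4,
    fun x => x 5]

/-! The Hamiltonians, as functions of the polar variables. -/

def keplerHam (μ r R Θ : ℝ) : ℝ := 1 / 2 * (R ^ 2 + Θ ^ 2 / r ^ 2) - μ / r

def oblateness (μ α r θ Θ N : ℝ) : ℝ :=
  -(1 / 4) * (μ / r) * (α ^ 2 / r ^ 2)
    * (2 - 3 * sinInc Θ N ^ 2 + 3 * sinInc Θ N ^ 2 * Real.cos (2 * θ))

/-- The Hamiltonian of the main problem. -/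
def mainHam (μ α J₂ r θ R Θ N : ℝ) : ℝ :=
  1 / 2 * (R ^ 2 + Θ ^ 2 / r ^ 2) - μ / r
    - 1 / 4 * J₂ * (μ / r) * (α ^ 2 / r ^ 2)
      * (2 - 3 * sinInc Θ N ^ 2 + 3 * sinInc Θ N ^ 2 * Real.cos (2 * θ))

theorem mainHam_eq (μ α J₂ r θ R Θ N : ℝ) :
    mainHam μ α J₂ r θ R Θ N = keplerHam μ r R Θ + J₂ * oblateness μ α r θ Θ N := by
  unfold mainHam keplerHam oblateness; ring

/-- `M_{n,0}`: the coefficients of `J₂ ^ n / n!` in the main problem Hamiltonian. -/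
def mainCoeff (μ α : ℝ) : ℕ → Phase → ℝ
  | 0 => fun x => keplerHam μ (polar μ 0 x) (polar μ 3 x) (polar μ 4 x)
  | 1 => fun x => oblateness μ α (polar μ 0 x) (polar μ 1 x) (polar μ 4 x) (polar μ 5 x)
  | _ => fun _ => 0

/-- `M_{0,1}`: the first-order term of the quasi-Keplerian Hamiltonian. -/
def quasiOne (μ α : ℝ) (x : Phase) : ℝ :=
  -(1 / 2) * (polar μ 4 x ^ 2 / polar μ 0 x ^ 2) * (1 / 2)
    * (α ^ 2 / parameter μ (polar μ 4 x) ^ 2)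
    * (2 - 3 * sinInc (polar μ 4 x) (polar μ 5 x) ^ 2)

/-- `M_{0,2}`: the second-order term of the quasi-Keplerian Hamiltonian. -/
def quasiTwo (μ α : ℝ) (x : Phase) : ℝ :=
  -(polar μ 4 x ^ 2 / polar μ 0 x ^ 2) * (α ^ 4 / parameter μ (polar μ 4 x) ^ 4) * (1 / 16)
    * (21 * sinInc (polar μ 4 x) (polar μ 5 x) ^ 4
        - 42 * sinInc (polar μ 4 x) (polar μ 5 x) ^ 2 + 20)

/-! Lie transforms. -/

/-- The triangle of the method of Lie transforms, for a function `∑ Fₙ εⁿ / n!` and a generating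
function `∑ W_{n+1} εⁿ / n!`:
`F_{n,0} = Fₙ`, `F_{n,j+1} = F_{n+1,j} + ∑_{k ≤ n} (n choose k) {F_{n-k,j}, W_{k+1}}`.
The transformed function is `∑ F_{0,n} εⁿ / n!`. -/
def lieTriangle (F W : ℕ → Phase → ℝ) : ℕ → ℕ → Phase → ℝ
  | n, 0 => F n
  | n, j + 1 => fun x =>
      lieTriangle F W (n + 1) j x
        + ∑ k ∈ Finset.range (n + 1),
            (n.choose k : ℝ) * poisson (lieTriangle F W (n - k) j) (W (k + 1)) x

/-- The terms `U₁`, `U₂` of a generating function. -/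
def genSeq (U₁ U₂ : Phase → ℝ) : ℕ → Phase → ℝ
  | 1 => U₁
  | 2 => U₂
  | _ => fun _ => 0

/-- A function that does not depend on the small parameter. -/
def constSeq (F : Phase → ℝ) : ℕ → Phase → ℝ
  | 0 => F
  | _ => fun _ => 0

theorem poisson_zero_left (B : Phase → ℝ) (x : Phase) : poisson (fun _ => 0) B x = 0 := by
  simp [poisson, pd]

/-- For a function free of the small parameter, `ξ_{0,2} = {ξ_{0,1}, U₁} + {ξ, U₂}` with
`ξ_{0,1} = {ξ, U₁}`. -/
theorem lieTriangle_constSeq_two (F U₁ U₂ : Phase → ℝ) (x : Phase) :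
    lieTriangle (constSeq F) (genSeq U₁ U₂) 0 2 x
      = poisson (poisson F U₁) U₁ x + poisson F U₂ x := by
  have h1 : lieTriangle (constSeq F) (genSeq U₁ U₂) 0 1 = poisson F U₁ := by
    funext y
    simp [lieTriangle, constSeq, genSeq]
  have h2 : lieTriangle (constSeq F) (genSeq U₁ U₂) 1 1 x = poisson F U₂ x := by
    simp [lieTriangle, constSeq, genSeq, Finset.sum_range_succ, poisson_zero_left]
  have h3 : lieTriangle (constSeq F) (genSeq U₁ U₂) 0 2 x
      = lieTriangle (constSeq F) (genSeq U₁ U₂) 1 1 x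
        + poisson (lieTriangle (constSeq F) (genSeq U₁ U₂) 0 1) U₁ x := by
    rw [lieTriangle]
    simp [genSeq]
  rw [h3, h1, h2, add_comm]

/-! The generating function. -/

/-- The constant `C₀` of the first-order generating function. -/
def constC (μ α : ℝ) (x : Phase) : ℝ :=
  x 4 * (1 / 4) * (α ^ 2 / semilatus μ x ^ 2)
    * ((3 * incl x ^ 2 - 2) * eta x
        - incl x ^ 2 / ecc x ^ 2
          * (eta x ^ 3 * Real.cos (2 * x 1)
              + 1 / 2 * (3 * ecc x ^ 2 - 2) * Real.sin (2 * x 1)))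

/-- The first-order generating function `U₁`. -/
def genOne (μ α : ℝ) (x : Phase) : ℝ :=
  -(x 4) * (1 / 8) * (α ^ 2 / semilatus μ x ^ 2)
    * (incl x ^ 2
          * (3 * ecc x * Real.sin (anom x + 2 * x 1)
              + 3 * Real.sin (2 * anom x + 2 * x 1)
              + ecc x * Real.sin (3 * anom x + 2 * x 1))
        - (6 * incl x ^ 2 - 4) * ecc x * Real.sin (anom x))
  + constC μ α x

/-- The inclination polynomials `q_{k,i,j}`, as `qTable s i j k`. -/
def qTable (s : ℝ) : ℕ → ℤ → Fin 3 → ℝ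
  | 0, -2 => ![0, 64 * (3 * s ^ 2 - 2), 0]
  | 0, -1 => ![0, 160 * (3 * s ^ 2 - 2), 0]
  | 0, 0 => ![0, 16 * (s ^ 2 + 6), -48]
  | 0, 1 => ![0, 0, -48]
  | 0, 2 => ![-24 * s ^ 2 * (15 * s ^ 2 - 4), 0, -120]
  | 0, 3 => ![-112 * s ^ 4, 0, 0]
  | 0, 4 => ![-72 * s ^ 4, 0, 0]
  | 1, -3 => ![0, 8 * (3 * s ^ 2 - 2), 0]
  | 1, -2 => ![0, -80 * (3 * s ^ 2 - 2), 0]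
  | 1, -1 => ![-12 * s ^ 2 * (13 * s ^ 2 - 4), -8 * (45 * s ^ 2 - 26), -12]
  | 1, 0 => ![2 * (255 * s ^ 4 - 576 * s ^ 2 + 272), 8 * (149 * s ^ 2 - 142), 42]
  | 1, 1 => ![-12 * s ^ 2 * (13 * s ^ 2 - 4), 96 * (2 * s ^ 2 - 1), -36]
  | 1, 2 => ![12 * s ^ 2 * (45 * s ^ 2 - 16), -96 * (6 * s ^ 2 - 5), 60]
  | 1, 3 => ![4 * s ^ 2 * (7 * s ^ 2 + 8), 0, -120]
  | 1, 4 => ![90 * s ^ 4, 0, -54]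
  | 1, 5 => ![-12 * s ^ 4, 0, 0]
  | 2, -3 => ![0, -10 * (3 * s ^ 2 - 2), 0]
  | 2, -2 => ![0, 16 * (3 * s ^ 2 - 2), 0]
  | 2, -1 => ![8 * (75 * s ^ 4 - 72 * s ^ 2 + 20), -2 * (153 * s ^ 2 - 134), 15]
  | 2, 0 => ![6 * (11 * s ^ 4 + 64 * s ^ 2 - 48), -4 * (329 * s ^ 2 - 278), 6]
  | 2, 1 => ![8 * (75 * s ^ 4 - 72 * s ^ 2 + 20), -6 * (127 * s ^ 2 - 90), 81]
  | 2, 2 => ![4 * (27 * s ^ 4 - 72 * s ^ 2 + 32), 24 * (9 * s ^ 2 - 10), 60]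
  | 2, 3 => ![s ^ 2 * (145 * s ^ 2 - 64), -2 * (195 * s ^ 2 - 146), 105]
  | 2, 4 => ![-18 * s ^ 4, -36 * (3 * s ^ 2 - 2), 54]
  | 2, 5 => ![15 * s ^ 4, 0, -9]
  | 3, -3 => ![0, 2 * (3 * s ^ 2 - 2), 0]
  | 3, -1 => ![-6 * (5 * s ^ 4 + 4 * s ^ 2 - 4), 24 * (7 * s ^ 2 - 6), -3]
  | 3, 1 => ![-6 * (5 * s ^ 4 + 4 * s ^ 2 - 4), 12 * (25 * s ^ 2 - 22), 3]
  | 3, 3 => ![-25 * s ^ 4 - 16 * s ^ 2 + 16, 8 * (15 * s ^ 2 - 14), 15]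
  | 3, 5 => ![-3 * s ^ 4, -6 * (3 * s ^ 2 - 2), 9]
  | _, _ => 0

/-- The inclination polynomials `p_{k,i,j}`, as `pTable s i j k`. -/
def pTable (s : ℝ) : ℕ → ℤ → Fin 3 → ℝ
  | 0, -2 => ![0, -64 * (3 * s ^ 2 - 2), 0]
  | 0, -1 => ![0, -160 * (3 * s ^ 2 - 2), 0]
  | 0, 0 => ![0, -16 * (s ^ 2 + 6), 48]
  | 0, 1 => ![0, 0, 48]
  | 0, 2 => ![-24 * s ^ 2 * (15 * s ^ 2 - 4), 0, 120]
  | 0, 3 => ![-112 * s ^ 4, 0, 0]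
  | 0, 4 => ![-72 * s ^ 4, 0, 0]
  | 1, -3 => ![0, -8 * (3 * s ^ 2 - 2), 0]
  | 1, -2 => ![0, 48 * (3 * s ^ 2 - 2), 0]
  | 1, -1 => ![12 * s ^ 2 * (13 * s ^ 2 - 4), 24 * (5 * s ^ 2 - 2), 12]
  | 1, 0 => ![0, -16 * (75 * s ^ 2 - 68), -18]
  | 1, 1 => ![-12 * s ^ 2 * (13 * s ^ 2 - 4), -96 * (2 * s ^ 2 - 1), 60]
  | 1, 2 => ![72 * s ^ 2 * (5 * s ^ 2 - 2), -32 * (15 * s ^ 2 - 13), 0]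
  | 1, 3 => ![4 * s ^ 2 * (8 - 7 * s ^ 2), 0, 120]
  | 1, 4 => ![54 * s ^ 4, 0, 66]
  | 1, 5 => ![-12 * s ^ 4, 0, 0]
  | 2, -3 => ![0, 6 * (3 * s ^ 2 - 2), 0]
  | 2, -1 => ![-2 * (27 * s ^ 4 + 180 * s ^ 2 - 128), 18 * (17 * s ^ 2 - 14), -9]
  | 2, 0 => ![0, -6 * (17 * s ^ 2 - 18), -9]
  | 2, 1 => ![2 * (27 * s ^ 4 + 180 * s ^ 2 - 128), -2 * (825 * s ^ 2 - 742), -45]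
  | 2, 2 => ![6 * (5 * s ^ 4 + 8 * s ^ 2 - 8), -24 * (s ^ 2 - 2), -15]
  | 2, 3 => ![3 * s ^ 2 * (39 * s ^ 2 - 16), 2 * (55 * s ^ 2 - 34), -15]
  | 2, 4 => ![0, 6 * (13 * s ^ 2 - 10), -3]
  | 2, 5 => ![9 * s ^ 4, 0, 21]
  | 2, 6 => ![0, 0, 3]
  | _, _ => 0

/-- The lower and upper summation bounds `j₀ = -2 (k mod 2) - 1` and `j₁ = 6 - 2 (k mod 2)`. -/
def jLow (k : Fin 3) : ℤ := -2 * ((k : ℕ) % 2 : ℤ) - 1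

def jHigh (k : Fin 3) : ℤ := 6 - 2 * ((k : ℕ) % 2 : ℤ)

def cosTerm (k : Fin 3) (j : ℤ) (x : Phase) : ℝ :=
  ∑ i ∈ Finset.range 4,
    qTable (incl x) i j k * ecc x ^ (2 * (i : ℤ) + 1 - j % 2)
      * Real.cos (j * anom x + 2 * (k : ℕ) * x 1)

def sinTerm (k : Fin 3) (j : ℤ) (x : Phase) : ℝ :=
  ∑ i ∈ Finset.range 3,
    pTable (incl x) i j k * ecc x ^ (2 * (i : ℤ) + 1 - j % 2)
      * Real.sin (j * anom x + 2 * (k : ℕ) * x 1)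

/-- `G α⁴ / p⁴`. -/
def amplitude (μ α : ℝ) (x : Phase) : ℝ := x 4 * (α ^ 4 / semilatus μ x ^ 4)

/-- The coefficient of the non-periodic function, up to the factor `amplitude`. -/
def psiCoeff (x : Phase) : ℝ :=
  3 / (64 * ecc x ^ 2)
    * ((2 * ecc x ^ 4 * (15 * incl x ^ 2 - 14)
            + 8 * (3 * ecc x ^ 2 - 2) * (5 * incl x ^ 2 - 4)) * incl x ^ 2 * Real.cos (2 * x 1)
        - 16 * eta x ^ 3 * (5 * incl x ^ 2 - 4) * incl x ^ 2 * Real.sin (2 * x 1)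
        - ecc x ^ 4 * (5 * incl x ^ 4 + 8 * incl x ^ 2 - 8))

def psi (x : Phase) : ℝ := Real.pi - anom x + Real.arctan (eta x)

/-- The second-order generating function `U₂`. -/
def genTwo (μ α : ℝ) (x : Phase) : ℝ :=
  amplitude μ α x * psiCoeff x * psi x
    + amplitude μ α x / (256 * ecc x ^ 3 * eta x)
      * ∑ k : Fin 3, incl x ^ (2 * (k : ℕ))
        * ((∑ j ∈ Finset.Icc (jLow k) 5, cosTerm k j x)
            + eta x * ∑ j ∈ Finset.Icc (jLow k) (jHigh k), sinTerm k j x)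

/-- The part of `U₂` obtained by integration with respect to the true anomaly, without integration
constant: `-f` in the place of `ψ`, and no term with `j = 0`. -/
def genTwoAnomalistic (μ α : ℝ) (x : Phase) : ℝ :=
  -(amplitude μ α x * psiCoeff x * anom x)
    + amplitude μ α x / (256 * ecc x ^ 3 * eta x)
      * ∑ k : Fin 3, incl x ^ (2 * (k : ℕ))
        * ((∑ j ∈ (Finset.Icc (jLow k) 5).erase 0, cosTerm k j x)
            + eta x * ∑ j ∈ (Finset.Icc (jLow k) (jHigh k)).erase 0, sinTerm k j x)

/-- `Q₀ - Q₁`. -/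
def partZero (μ α : ℝ) (x : Phase) : ℝ :=
  amplitude μ α x * (1 / (256 * ecc x ^ 2))
    * (-2 * incl x ^ 2
          * (3 * ecc x ^ 4 * (17 * incl x ^ 2 - 18) + 8 * ecc x ^ 2 * (75 * incl x ^ 2 - 68)
              + 8 * (incl x ^ 2 + 6)
              + 96 * eta x ^ 3 * (5 * incl x ^ 2 - 4) * (Real.pi + Real.arctan (eta x)))
          * Real.sin (2 * x 1)
        - 3 * (3 * ecc x ^ 4 + 6 * ecc x ^ 2 - 16) * incl x ^ 4 * Real.sin (4 * x 1)
        + 4 * incl x ^ 2 / eta x ^ 2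
          * (6 * eta x ^ 2
                * (ecc x ^ 4 * (15 * incl x ^ 2 - 14)
                    + 4 * (3 * ecc x ^ 2 - 2) * (5 * incl x ^ 2 - 4))
                * (Real.pi + Real.arctan (eta x))
              + eta x
                * (ecc x ^ 4 * (278 - 329 * incl x ^ 2) + ecc x ^ 2 * (298 * incl x ^ 2 - 284)
                    + 4 * (incl x ^ 2 + 6)))
          * Real.cos (2 * x 1)
        + 6 * eta x * (ecc x ^ 2 + 8) * incl x ^ 4 * Real.cos (4 * x 1))

/-- `Q₁ - Q₂`. -/
def partOne (μ α : ℝ) (x : Phase) : ℝ :=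
  amplitude μ α x * (3 / (128 * eta x)) * (1 - incl x ^ 2)
    * (2 * ecc x ^ 2 * eta x * (5 * incl x ^ 2 + 13) * (Real.pi + Real.arctan (eta x))
        - ecc x ^ 2 * (11 * incl x ^ 2 + 75) - 85 * incl x ^ 2 + 107)

/-- `Q₂ - Q₃`. -/
def partTwo (μ α : ℝ) (x : Phase) : ℝ :=
  amplitude μ α x * (1 / (128 * eta x))
    * (81 * ecc x ^ 2 - 30 * ecc x ^ 2 * eta x * (Real.pi + Real.arctan (eta x)) - 49)

/-! The Lie transformation with generating function `U₁`, `U₂ = V`. -/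

/-- The second-order term `M_{0,2}` of the transformed Hamiltonian. -/
def transformedTwo (μ α : ℝ) (V : Phase → ℝ) : Phase → ℝ :=
  lieTriangle (mainCoeff μ α) (genSeq (genOne μ α) V) 0 2

/-- The second-order correction `ξ_{0,2}` to the `i`-th polar variable. -/
def corrTwo (μ α : ℝ) (V : Phase → ℝ) (i : Fin 6) : Phase → ℝ :=
  lieTriangle (constSeq (polar μ i)) (genSeq (genOne μ α) V) 0 2

/-- `F` vanishes at infinity along every incoming asymptote (`ℓ → -∞`, the other Delaunay variables
being fixed). -/
def VanishesAtInfinity (F : Phase → ℝ) : Prop :=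
  ∀ x ∈ domain, Tendsto (fun l : ℝ => F (Function.update x 0 l)) atBot (𝓝 0)

end HypJ2

end

/-! Infinity becomes a finite place once the true anomaly f replaces the mean anomaly ℓ as first
coordinate: when ℓ → -∞, f tends to π + arctan η. A function is regular (`IsRegular`) if it is
smooth in (f, g, h, L, G, H), the asymptote included, and null (`IsNull`) if it also vanishes on the
hypersurface f = π + arctan η. In this chart the Delaunay derivatives are smooth vector fields
tangent to that hypersurface (`anomSlope_asymptote`), and ∂/∂ℓ = (1 + e cos f)²/η³ ∂/∂f is zero on
it. So derivatives of null functions are null (`IsNull.pd`), and the bracket of a regular function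
with a null one is null (`IsRegular.poisson`).

The integration constants in U₁ and U₂ are those that make both functions null (`isNull_genOne`,
`isNull_genTwo`). All polar variables but r are regular, so their corrections are null. The radius
has a pole on the asymptote; its derivatives in ℓ and G are nevertheless regular, and the pole of
its L-derivative is absorbed by the factor (1 + e cos f)² of ∂/∂ℓ (`isNull_poisson_radius`). This
gives (c).

For (b), the Kepler Hamiltonian is μ²/(2L²), so its bracket with B is μ²/L³ ∂B/∂ℓ. The second-order
equation thus prescribes ∂U₂/∂f through {M₁₀ + M₀₁, U₁}. In dimensionless form this is a polynomial
identity in e, η, s and the sines and cosines of f and θ = 2f + 2g (`averaging_identity`,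
`bracket_algebra`).

For (e), write V = U₂ + W. Then M₀₂ changes by μ²/L³ ∂W/∂ℓ, and each correction changes by the
single bracket {ξ, W}. When W is free of ℓ, the brackets with Θ, N, ν, θ and r tend to nonzero
multiples of the derivatives of W in g, h, H, G and L, those for θ and r once the derivatives
treated before them are known to vanish, while the bracket with R tends to zero. Since the domain is
convex, a vanishing derivative means independence of the variable (`eq_of_pd_eq_zero`). -/

noncomputable section

namespace HypJ2

/-! ### Partial derivatives on the phase space -/

theorem isOpen_domain : IsOpen domain := by
  have h1 : IsOpen {x : Phase | x 3 < 0} := isOpen_lt (by fun_prop) (by fun_prop)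
  have h2 : IsOpen {x : Phase | 0 < x 4} := isOpen_lt (by fun_prop) (by fun_prop)
  have h3 : IsOpen {x : Phase | |x 5| < x 4} := isOpen_lt (by fun_prop) (by fun_prop)
  exact h1.inter (h2.inter h3)

theorem domain_mem_nhds {x : Phase} (hx : x ∈ domain) : domain ∈ 𝓝 x :=
  isOpen_domain.mem_nhds hx

theorem update_zero_mem_domain {x : Phase} {t : ℝ} :
    Function.update x 0 t ∈ domain ↔ x ∈ domain := by
  simp [domain]

theorem pd_eq_fderiv {F : Phase → ℝ} {x : Phase} (i : Fin 6) (hF : DifferentiableAt ℝ F x) :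
    pd i F x = fderiv ℝ F x (Pi.single i 1) := by
  have h1 : HasFDerivAt F (fderiv ℝ F x) (Function.update x i (x i)) := by
    rw [Function.update_eq_self]; exact hF.hasFDerivAt
  exact (h1.comp_hasDerivAt (x i) (hasDerivAt_update x i (x i))).deriv

theorem eventually_update {x : Phase} {s : Set Phase} (hs : s ∈ 𝓝 x) (i : Fin 6) :
    ∀ᶠ t in 𝓝 (x i), Function.update x i t ∈ s := by
  have hc : Continuous (fun t : ℝ => Function.update x i t) := by fun_prop
  apply hc.continuousAt.eventually_mem
  simpa using hs

theorem pd_congr {F F' : Phase → ℝ} {x : Phase} (h : F =ᶠ[𝓝 x] F') (i : Fin 6) :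
    pd i F x = pd i F' x := by
  have : (fun t : ℝ => F (Function.update x i t)) =ᶠ[𝓝 (x i)]
      fun t : ℝ => F' (Function.update x i t) := eventually_update h i
  exact this.deriv_eq

/-- Openness of the domain makes partial derivatives local, so formulas that hold only on the domain
may be differentiated. -/
theorem pd_congr_domain {F F' : Phase → ℝ} (h : ∀ x ∈ domain, F x = F' x) {x : Phase}
    (hx : x ∈ domain) (i : Fin 6) : pd i F x = pd i F' x :=
  pd_congr (Filter.eventually_of_mem (domain_mem_nhds hx) h) i

theorem poisson_congr_domain {A A' B B' : Phase → ℝ} (hA : ∀ x ∈ domain, A x = A' x)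
    (hB : ∀ x ∈ domain, B x = B' x) {x : Phase} (hx : x ∈ domain) :
    poisson A B x = poisson A' B' x := by
  simp only [poisson, pd_congr_domain hA hx, pd_congr_domain hB hx]

theorem pd_add {F F' : Phase → ℝ} {x : Phase} (hF : DifferentiableAt ℝ F x)
    (hF' : DifferentiableAt ℝ F' x) (i : Fin 6) :
    pd i (fun y => F y + F' y) x = pd i F x + pd i F' x := by
  rw [pd_eq_fderiv i hF, pd_eq_fderiv i hF', pd_eq_fderiv i (hF.fun_add hF'),
    fderiv_fun_add hF hF']
  rfl

theorem poisson_add_left {A A' : Phase → ℝ} (B : Phase → ℝ) {x : Phase}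
    (hA : DifferentiableAt ℝ A x) (hA' : DifferentiableAt ℝ A' x) :
    poisson (fun y => A y + A' y) B x = poisson A B x + poisson A' B x := by
  simp only [poisson, pd_add hA hA']; ring

theorem poisson_add_right (A : Phase → ℝ) {B B' : Phase → ℝ} {x : Phase}
    (hB : DifferentiableAt ℝ B x) (hB' : DifferentiableAt ℝ B' x) :
    poisson A (fun y => B y + B' y) x = poisson A B x + poisson A B' x := by
  simp only [poisson, pd_add hB hB']; ring

theorem contDiffOn_pd {F : Phase → ℝ} (hF : ContDiffOn ℝ ∞ F domain) (i : Fin 6) :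
    ContDiffOn ℝ ∞ (pd i F) domain := by
  have h1 : ContDiffOn ℝ ∞ (fun x => fderiv ℝ F x (Pi.single i 1)) domain :=
    (hF.fderiv_of_isOpen isOpen_domain (by simp)).clm_apply contDiffOn_const
  refine h1.congr fun x hx => pd_eq_fderiv i ?_
  exact (hF.contDiffAt (domain_mem_nhds hx)).differentiableAt (by simp)

theorem differentiableAt_of_contDiffOn {F : Phase → ℝ} (hF : ContDiffOn ℝ ∞ F domain)
    {x : Phase} (hx : x ∈ domain) : DifferentiableAt ℝ F x :=
  (hF.contDiffAt (domain_mem_nhds hx)).differentiableAt (by simp)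

/-- The chain rule for a substitution in the first variable. -/
theorem pd_comp_update {Φ φ : Phase → ℝ} {x : Phase}
    (hΦ : DifferentiableAt ℝ Φ (Function.update x 0 (φ x))) (hφ : DifferentiableAt ℝ φ x)
    (i : Fin 6) :
    pd i (fun y => Φ (Function.update y 0 (φ y))) x
      = (if i = 0 then 0 else pd i Φ (Function.update x 0 (φ x)))
        + pd i φ x * pd 0 Φ (Function.update x 0 (φ x)) := by
  have hcurve : HasDerivAt (fun t : ℝ => φ (Function.update x i t)) (pd i φ x) (x i) := by
    rw [pd_eq_fderiv i hφ]
    have h1 : HasFDerivAt φ (fderiv ℝ φ x) (Function.update x i (x i)) := by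
      rw [Function.update_eq_self]; exact hφ.hasFDerivAt
    exact h1.comp_hasDerivAt (x i) (hasDerivAt_update x i (x i))
  -- Velocity of the substituted point: its own motion along the `i`-th axis plus the motion of slot
  -- 0. For `i = 0` the former disappears, because slot 0 is overwritten.
  have hT : HasDerivAt
      (fun t : ℝ => Function.update (Function.update x i t) 0 (φ (Function.update x i t)))
      ((if i = 0 then 0 else Pi.single i 1) + pd i φ x • Pi.single (0 : Fin 6) (1 : ℝ)) (x i) := by
    rw [hasDerivAt_pi]
    intro j
    by_cases hj : j = 0
    · subst hj
      have : ((if i = 0 then (0 : Phase) else Pi.single i 1)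
          + pd i φ x • Pi.single (0 : Fin 6) (1 : ℝ) : Phase) 0 = pd i φ x := by
        by_cases hi : i = 0
        · simp [hi]
        · simp [hi, Ne.symm hi]
      rw [this]
      simpa using hcurve
    · by_cases hi : i = 0
      · subst hi
        simp [hj, hasDerivAt_const]
      · have h1 := (hasDerivAt_pi.1 (hasDerivAt_update x i (x i))) j
        simpa [hj, hi] using h1
  have h2 : HasFDerivAt Φ (fderiv ℝ Φ (Function.update x 0 (φ x)))
      (Function.update (Function.update x i (x i)) 0 (φ (Function.update x i (x i)))) := by
    rw [Function.update_eq_self]; exact hΦ.hasFDerivAt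
  have h3 := (h2.comp_hasDerivAt (x i) hT).deriv
  have h4 : pd i (fun y => Φ (Function.update y 0 (φ y))) x
      = fderiv ℝ Φ (Function.update x 0 (φ x)) ((if i = 0 then 0 else Pi.single i 1)
        + pd i φ x • Pi.single (0 : Fin 6) (1 : ℝ)) := h3
  rw [h4, map_add, map_smul, pd_eq_fderiv 0 hΦ, pd_eq_fderiv i hΦ]
  split_ifs <;> simp

/-! ### The hyperbolic anomaly -/

theorem eta_pos {x : Phase} (hx : x ∈ domain) : 0 < eta x := by
  obtain ⟨h1, h2, -⟩ := hx
  rw [eta, neg_pos]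
  exact div_neg_of_pos_of_neg h2 h1

theorem ecc_sq (x : Phase) : ecc x ^ 2 = 1 + eta x ^ 2 := Real.sq_sqrt (by positivity)

theorem ecc_pos (x : Phase) : 0 < ecc x := Real.sqrt_pos.2 (by positivity)

theorem one_lt_ecc {x : Phase} (hx : x ∈ domain) : 1 < ecc x := by
  have := eta_pos hx
  have h := ecc_sq x
  nlinarith [ecc_pos x]

theorem one_lt_ecc_mul_cosh {e : ℝ} (he : 1 < e) (u : ℝ) : 0 < e * Real.cosh u - 1 := by
  nlinarith [Real.one_le_cosh u]

theorem hypAnomaly_eq {e : ℝ} (he : 1 < e) (u : ℝ) :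
    hypAnomaly e (e * Real.sinh u - u) = u :=
  (strictMono_kepler he.le).injective (kepler_hypAnomaly he _)

/-- The inverse function theorem for (e, u) ↦ (e, e sinh u - u), whose Jacobian determinant e cosh u
- 1 is positive. Keeping e as a coordinate gives joint smoothness in e and ℓ. -/
theorem contDiffAt_hypAnomaly {e l : ℝ} (he : 1 < e) :
    ContDiffAt ℝ ∞ (fun p : ℝ × ℝ => hypAnomaly p.1 p.2) (e, l) := by
  set u := hypAnomaly e l with hu
  let K : ℝ × ℝ → ℝ × ℝ := fun p => (p.1, p.1 * Real.sinh p.2 - p.2)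
  have hK : ContDiff ℝ ∞ K := by
    refine contDiff_fst.prodMk ((contDiff_fst.mul ?_).sub contDiff_snd)
    exact Real.contDiff_sinh.comp contDiff_snd
  have hd : 0 < e * Real.cosh u - 1 := one_lt_ecc_mul_cosh he u
  set d := e * Real.cosh u - 1 with hdd
  let A : (ℝ × ℝ) ≃L[ℝ] (ℝ × ℝ) := ContinuousLinearEquiv.equivOfInverse
    ((ContinuousLinearMap.fst ℝ ℝ ℝ).prod
      (Real.sinh u • ContinuousLinearMap.fst ℝ ℝ ℝ + d • ContinuousLinearMap.snd ℝ ℝ ℝ))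
    ((ContinuousLinearMap.fst ℝ ℝ ℝ).prod
      (-(Real.sinh u / d) • ContinuousLinearMap.fst ℝ ℝ ℝ
        + (1 / d) • ContinuousLinearMap.snd ℝ ℝ ℝ))
    (fun p => by ext <;> simp; field_simp; ring)
    (fun p => by ext <;> simp; field_simp; ring)
  have hKA : HasFDerivAt K (A : (ℝ × ℝ) →L[ℝ] (ℝ × ℝ)) (e, u) := by
    have h1 : HasFDerivAt (fun p : ℝ × ℝ => p.1) (ContinuousLinearMap.fst ℝ ℝ ℝ) (e, u) :=
      hasFDerivAt_fst
    have h2 : HasFDerivAt (fun p : ℝ × ℝ => p.2) (ContinuousLinearMap.snd ℝ ℝ ℝ) (e, u) :=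
      hasFDerivAt_snd
    have h3 := h1.prodMk ((h1.mul h2.sinh).sub h2)
    refine h3.congr_fderiv ?_
    ext <;> simp [A, d]
  have hloc := hK.contDiffAt.to_localInverse hKA (by simp)
  have hKe : K (e, u) = (e, l) := by
    simp only [K]; rw [hu, kepler_hypAnomaly he]
  rw [hKe] at hloc
  have hst : HasStrictFDerivAt K (A : (ℝ × ℝ) →L[ℝ] (ℝ × ℝ)) (e, u) :=
    hK.contDiffAt.hasStrictFDerivAt' hKA (by simp)
  have hinv := hst.eventually_right_inverse
  rw [hKe] at hinv
  -- The local inverse solves Kepler's equation with the same e. For e > 1 the solution is unique,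
  -- so its second component is the hyperbolic anomaly.
  refine (contDiff_snd.contDiffAt.comp (e, l) hloc).congr_of_eventuallyEq ?_
  have hone : ∀ᶠ p : ℝ × ℝ in 𝓝 (e, l), 1 < p.1 :=
    continuous_fst.continuousAt.eventually (lt_mem_nhds he)
  filter_upwards [hinv, hone] with p hp hp1
  have hp' : K (hst.localInverse K A (e, u) p) = p := hp
  have e1 : (hst.localInverse K A (e, u) p).1 = p.1 :=
    (congrArg Prod.fst hp' : (K (hst.localInverse K A (e, u) p)).1 = p.1)
  have e2 : (K (hst.localInverse K A (e, u) p)).2 = p.2 := congrArg Prod.snd hp'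
  simp only [K] at e2
  rw [e1] at e2
  rw [← e2, hypAnomaly_eq hp1]
  rfl

/-- Half-angle substitution with tan (f/2) = √((e+1)/(e-1)) tanh (u/2). With the companion formula
for the sine, it lets f be differentiated through relations rational in sinh u and cosh u. -/
theorem cos_trueAnomaly {e : ℝ} (he : 1 < e) (l : ℝ) :
    Real.cos (trueAnomaly e l)
      = (e - Real.cosh (hypAnomaly e l)) / (e * Real.cosh (hypAnomaly e l) - 1) := by
  set u := hypAnomaly e l
  have hc : Real.cosh u = 2 * Real.cosh (u / 2) ^ 2 - 1 := by
    have h := Real.cosh_two_mul (u / 2)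
    have h1 := Real.cosh_sq (u / 2)
    rw [show 2 * (u / 2) = u by ring] at h
    linarith
  have hs : Real.sinh (u / 2) ^ 2 = Real.cosh (u / 2) ^ 2 - 1 := Real.sinh_sq _
  have hcp := Real.cosh_pos (u / 2)
  have hd := one_lt_ecc_mul_cosh he u
  have hk : Real.sqrt ((e + 1) / (e - 1)) ^ 2 = (e + 1) / (e - 1) :=
    Real.sq_sqrt (div_nonneg (by linarith) (by linarith))
  have he1 : e - 1 ≠ 0 := by linarith
  rw [trueAnomaly, add_comm, Real.cos_add_two_pi, Real.cos_two_mul, Real.cos_sq_arctan, mul_pow,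
    hk, Real.tanh_eq_sinh_div_cosh, div_pow, hs]
  rw [hc] at hd ⊢
  have hpos : (1 + (e + 1) / (e - 1) * ((Real.cosh (u / 2) ^ 2 - 1) / Real.cosh (u / 2) ^ 2))
      ≠ 0 := by
    have : 1 + (e + 1) / (e - 1) * ((Real.cosh (u / 2) ^ 2 - 1) / Real.cosh (u / 2) ^ 2)
      = (e * (2 * Real.cosh (u / 2) ^ 2 - 1) - 1) / ((e - 1) * Real.cosh (u / 2) ^ 2) := by
      field_simp; ring
    rw [this]
    positivity
  have h2 : e * (2 * Real.cosh (u / 2) ^ 2 - 1) - 1 ≠ 0 := hd.ne'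
  rw [eq_div_iff h2]
  have : (1 + (e + 1) / (e - 1) * ((Real.cosh (u / 2) ^ 2 - 1) / Real.cosh (u / 2) ^ 2))
      = (e * (2 * Real.cosh (u / 2) ^ 2 - 1) - 1) / ((e - 1) * Real.cosh (u / 2) ^ 2) := by
    field_simp; ring
  rw [this]
  field_simp
  ring

theorem sin_trueAnomaly {e : ℝ} (he : 1 < e) (l : ℝ) :
    Real.sin (trueAnomaly e l)
      = Real.sqrt (e ^ 2 - 1) * Real.sinh (hypAnomaly e l)
        / (e * Real.cosh (hypAnomaly e l) - 1) := by
  set u := hypAnomaly e l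
  have hc : Real.cosh u = 2 * Real.cosh (u / 2) ^ 2 - 1 := by
    have h := Real.cosh_two_mul (u / 2)
    have h1 := Real.cosh_sq (u / 2)
    rw [show 2 * (u / 2) = u by ring] at h
    linarith
  have hsu : Real.sinh u = 2 * Real.sinh (u / 2) * Real.cosh (u / 2) := by
    have h := Real.sinh_two_mul (u / 2)
    rwa [show 2 * (u / 2) = u by ring] at h
  have hs : Real.sinh (u / 2) ^ 2 = Real.cosh (u / 2) ^ 2 - 1 := Real.sinh_sq _
  have hcp := Real.cosh_pos (u / 2)
  have hd := one_lt_ecc_mul_cosh he u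
  have he1 : 0 < e - 1 := by linarith
  have hk : Real.sqrt ((e + 1) / (e - 1)) = Real.sqrt (e ^ 2 - 1) / (e - 1) := by
    rw [show (e + 1) / (e - 1) = (e ^ 2 - 1) / (e - 1) ^ 2 by field_simp; ring,
      Real.sqrt_div' _ (by positivity), Real.sqrt_sq he1.le]
  have hq : Real.sqrt (e ^ 2 - 1) ^ 2 = e ^ 2 - 1 := Real.sq_sqrt (by nlinarith)
  rw [trueAnomaly, add_comm, Real.sin_add_two_pi, Real.sin_two_mul]
  rw [← Real.tan_mul_cos (Real.cos_arctan_pos _).ne', Real.tan_arctan]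
  rw [show ∀ a b : ℝ, 2 * (a * b) * b = 2 * a * b ^ 2 by intros; ring, Real.cos_sq_arctan, mul_pow,
    hk, Real.tanh_eq_sinh_div_cosh, div_pow, div_pow, hs, hq]
  rw [hc] at hd ⊢
  have h2 : e * (2 * Real.cosh (u / 2) ^ 2 - 1) - 1 ≠ 0 := hd.ne'
  have : (1 + (e ^ 2 - 1) / (e - 1) ^ 2
        * ((Real.cosh (u / 2) ^ 2 - 1) / Real.cosh (u / 2) ^ 2))
      = (e * (2 * Real.cosh (u / 2) ^ 2 - 1) - 1) / ((e - 1) * Real.cosh (u / 2) ^ 2) := by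
    field_simp; ring
  rw [this, hsu]
  simp only [u]
  field_simp

theorem tendsto_hypAnomaly_atBot {e : ℝ} (he : 1 < e) :
    Tendsto (hypAnomaly e) atBot atBot := by
  rw [tendsto_atBot]
  intro b
  filter_upwards [eventually_le_atBot (e * Real.sinh b - b)] with l hl
  rw [← (strictMono_kepler he.le).le_iff_le]
  simpa [kepler_hypAnomaly he] using hl

theorem tendsto_tanh_atBot : Tendsto Real.tanh atBot (𝓝 (-1)) := by
  have h : Tendsto (fun u : ℝ => (Real.exp (2 * u) - 1) / (Real.exp (2 * u) + 1)) atBot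
      (𝓝 ((0 - 1) / (0 + 1))) := by
    have h0 : Tendsto (fun u : ℝ => Real.exp (2 * u)) atBot (𝓝 0) :=
      Real.tendsto_exp_atBot.comp (tendsto_id.const_mul_atBot (by norm_num))
    exact (h0.sub_const 1).div (h0.add_const 1) (by norm_num)
  norm_num at h
  refine h.congr fun u => ?_
  rw [Real.tanh_eq_sinh_div_cosh, Real.sinh_eq, Real.cosh_eq, Real.exp_neg,
    show 2 * u = u + u by ring, Real.exp_add]
  have := Real.exp_pos u
  field_simp

/-- Since tanh (u/2) → -1, the limit is 2π - 2 arctan ((e+1)/η). The arguments (e+1)/η and (e-1)/η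
are reciprocal because e² - 1 = η², and (e-1)/η is the tangent of half of arctan η. -/
theorem tendsto_trueAnomaly {η : ℝ} (hη : 0 < η) :
    Tendsto (trueAnomaly (Real.sqrt (1 + η ^ 2))) atBot (𝓝 (Real.pi + Real.arctan η)) := by
  set e := Real.sqrt (1 + η ^ 2) with hedef
  have he2 : e ^ 2 = 1 + η ^ 2 := Real.sq_sqrt (by positivity)
  have he0 : 0 ≤ e := Real.sqrt_nonneg _
  have he : 1 < e := by nlinarith
  have hk : Real.sqrt ((e + 1) / (e - 1)) = (e + 1) / η := by
    rw [Real.sqrt_eq_iff_mul_self_eq (div_nonneg (by linarith) (by linarith)) (by positivity)]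
    have : e - 1 ≠ 0 := by linarith
    field_simp
    nlinarith
  have hlim : Tendsto (fun l => Real.tanh (hypAnomaly e l / 2)) atBot (𝓝 (-1)) :=
    tendsto_tanh_atBot.comp ((tendsto_hypAnomaly_atBot he).atBot_div_const (by norm_num))
  have h2 : Tendsto (trueAnomaly e) atBot
      (𝓝 (2 * Real.pi + 2 * Real.arctan (Real.sqrt ((e + 1) / (e - 1)) * (-1)))) :=
    (((Real.continuous_arctan.tendsto _).comp (hlim.const_mul _)).const_mul 2).const_add _
  convert h2 using 2
  have hkpos : 0 < (e + 1) / η := by positivity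
  have h3 : Real.arctan ((e + 1) / η) = Real.pi / 2 - Real.arctan ((e - 1) / η) := by
    rw [← Real.arctan_inv_of_pos (by have : 0 < e - 1 := by linarith
                                     positivity)]
    congr 1
    have : e - 1 ≠ 0 := by linarith
    field_simp
    nlinarith
  have h4 : 2 * Real.arctan ((e - 1) / η) = Real.arctan η := by
    have h5 : (e - 1) / η < 1 := by
      rw [div_lt_one hη]; nlinarith
    rw [Real.two_mul_arctan _ h5]
    · congr 1
      have h6 : 1 - ((e - 1) / η) ^ 2 ≠ 0 := by
        have : 0 ≤ (e - 1) / η := div_nonneg (by linarith) hη.le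
        nlinarith
      rw [div_eq_iff h6]
      field_simp
      nlinarith
    · have : 0 ≤ (e - 1) / η := div_nonneg (by linarith) hη.le
      linarith
  rw [hk, mul_neg_one, Real.arctan_neg, h3]
  linarith

/-! ### Smoothness of the orbital functions and derivatives of the true anomaly -/

theorem incl_sq {x : Phase} (hx : x ∈ domain) : incl x ^ 2 = 1 - (x 5 / x 4) ^ 2 := by
  obtain ⟨-, h2, h3⟩ := hx
  rw [incl, sinInc, Real.sin_arccos, Real.sq_sqrt]
  have : |x 5 / x 4| ≤ 1 := by
    rw [abs_div, abs_of_pos h2]; exact (div_le_one h2).2 h3.le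
  have := (sq_le_one_iff_abs_le_one _).2 this
  linarith

theorem contDiffOn_coord (i : Fin 6) : ContDiffOn ℝ ∞ (fun x : Phase => x i) domain :=
  (contDiff_apply ℝ ℝ i).contDiffOn

theorem contDiffOn_eta : ContDiffOn ℝ ∞ eta domain :=
  ((contDiffOn_coord 4).div (contDiffOn_coord 3) fun _ hx => hx.1.ne).neg

theorem contDiffOn_ecc : ContDiffOn ℝ ∞ ecc domain :=
  (contDiffOn_const.add (contDiffOn_eta.pow 2)).sqrt fun x _ => by positivity

theorem contDiffOn_incl : ContDiffOn ℝ ∞ incl domain := by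
  have h : ContDiffOn ℝ ∞ (fun x : Phase => Real.sqrt (1 - (x 5 / x 4) ^ 2)) domain := by
    refine ContDiffOn.sqrt (contDiffOn_const.sub
      (((contDiffOn_coord 5).div (contDiffOn_coord 4) fun _ hx => hx.2.1.ne').pow 2)) ?_
    rintro x ⟨-, h2, h3⟩
    have : |x 5 / x 4| < 1 := by
      rw [abs_div, abs_of_pos h2]; exact (div_lt_one h2).2 h3
    have := (sq_lt_one_iff_abs_lt_one _).2 this
    linarith
  exact h.congr fun x _ => by rw [incl, sinInc, Real.sin_arccos]

theorem contDiffOn_semilatus (μ : ℝ) : ContDiffOn ℝ ∞ (semilatus μ) domain :=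
  ((contDiffOn_coord 4).pow 2).div_const μ

theorem semilatus_pos {μ : ℝ} (hμ : 0 < μ) {x : Phase} (hx : x ∈ domain) :
    0 < semilatus μ x := by
  have := hx.2.1
  rw [semilatus, parameter]; positivity

theorem contDiffOn_hypAnomaly :
    ContDiffOn ℝ ∞ (fun x : Phase => hypAnomaly (ecc x) (x 0)) domain := by
  intro x hx
  have h := (contDiffOn_ecc.contDiffAt (domain_mem_nhds hx)).prodMk
    ((contDiffOn_coord 0).contDiffAt (domain_mem_nhds hx))
  exact ((contDiffAt_hypAnomaly (one_lt_ecc hx)).comp x h).contDiffWithinAt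

theorem contDiff_tanh : ContDiff ℝ ∞ Real.tanh := by
  have : Real.tanh = fun x => Real.sinh x / Real.cosh x := by
    funext x; exact Real.tanh_eq_sinh_div_cosh x
  rw [this]
  exact Real.contDiff_sinh.div Real.contDiff_cosh fun x => (Real.cosh_pos x).ne'

theorem contDiffOn_anom : ContDiffOn ℝ ∞ anom domain := by
  have h1 : ∀ x ∈ domain, 0 < ecc x - 1 := fun x hx => sub_pos.2 (one_lt_ecc hx)
  have hk : ContDiffOn ℝ ∞ (fun x => Real.sqrt ((ecc x + 1) / (ecc x - 1))) domain := by
    refine ContDiffOn.sqrt ((contDiffOn_ecc.add contDiffOn_const).div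
      (contDiffOn_ecc.sub contDiffOn_const) fun x hx => (h1 x hx).ne') fun x hx => ?_
    have := h1 x hx
    have := ecc_pos x
    positivity
  have ht := contDiff_tanh.comp_contDiffOn (contDiffOn_hypAnomaly.div_const 2)
  exact contDiffOn_const.add (contDiffOn_const.mul
    (Real.contDiff_arctan.comp_contDiffOn (hk.mul ht)))

theorem sqrt_ecc_sq_sub_one {x : Phase} (hx : x ∈ domain) : Real.sqrt (ecc x ^ 2 - 1) = eta x := by
  rw [ecc_sq, add_sub_cancel_left, Real.sqrt_sq (eta_pos hx).le]

theorem cos_anom {x : Phase} (hx : x ∈ domain) :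
    Real.cos (anom x) = (ecc x - Real.cosh (hypAnomaly (ecc x) (x 0)))
      / (ecc x * Real.cosh (hypAnomaly (ecc x) (x 0)) - 1) :=
  cos_trueAnomaly (one_lt_ecc hx) _

theorem sin_anom {x : Phase} (hx : x ∈ domain) :
    Real.sin (anom x) = eta x * Real.sinh (hypAnomaly (ecc x) (x 0))
      / (ecc x * Real.cosh (hypAnomaly (ecc x) (x 0)) - 1) := by
  rw [anom, sin_trueAnomaly (one_lt_ecc hx), sqrt_ecc_sq_sub_one hx]

theorem one_add_ecc_mul_cos_anom_pos {x : Phase} (hx : x ∈ domain) :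
    0 < 1 + ecc x * Real.cos (anom x) := by
  have hd := one_lt_ecc_mul_cosh (one_lt_ecc hx) (hypAnomaly (ecc x) (x 0))
  have : 1 + ecc x * Real.cos (anom x)
      = eta x ^ 2 / (ecc x * Real.cosh (hypAnomaly (ecc x) (x 0)) - 1) := by
    rw [cos_anom hx, eq_div_iff hd.ne', add_mul, mul_assoc, div_mul_cancel₀ _ hd.ne']
    have := ecc_sq x
    linear_combination this
  rw [this]
  have := eta_pos hx
  positivity

/-- The gradient of `eta`. -/
def etaSlope (i : Fin 6) (x : Phase) : ℝ :=
  (![0, 0, 0, eta x ^ 2 / x 4, eta x / x 4, 0] : Fin 6 → ℝ) i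

theorem hasDerivAt_eta_update {x : Phase} (hx : x ∈ domain) (i : Fin 6) :
    HasDerivAt (fun t : ℝ => eta (Function.update x i t)) (etaSlope i x) (x i) := by
  have h3 : x 3 ≠ 0 := hx.1.ne
  have h4 : x 4 ≠ 0 := hx.2.1.ne'
  fin_cases i <;> simp only [etaSlope, eta, Fin.zero_eta, Fin.mk_one, Fin.reduceFinMk,
    Matrix.cons_val, ne_eq, Fin.reduceEq, not_false_eq_true, Function.update_of_ne,
    Function.update_self] <;> try exact hasDerivAt_const _ _
  · have h := ((hasDerivAt_const (x 3) (x 4)).div (hasDerivAt_id (x 3)) h3).neg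
    refine h.congr_deriv ?_
    simp only [id]
    field_simp
    ring
  · have h := ((hasDerivAt_id (x 4)).div (hasDerivAt_const (x 4) (x 3)) h3).neg
    refine h.congr_deriv ?_
    field_simp
    ring

theorem hasDerivAt_ecc_update {x : Phase} (hx : x ∈ domain) (i : Fin 6) :
    HasDerivAt (fun t : ℝ => ecc (Function.update x i t))
      (eta x * etaSlope i x / ecc x) (x i) := by
  have h := (((hasDerivAt_eta_update hx i).pow 2).const_add 1).sqrt
    (by rw [Pi.pow_apply]; positivity)
  refine h.congr_deriv ?_
  rw [Pi.pow_apply, Function.update_eq_self, ecc]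
  field_simp
  norm_num
  ring

/-- The derivative `f'` of the true anomaly along a curve, in terms of those of the eccentricity and
the mean anomaly. -/
theorem deriv_anomaly_curve {c σ d e η ch sh u' l' e' η' f' : ℝ} (hd : d ≠ 0) (hη : η ≠ 0)
    (hde : d = e * ch - 1) (he2 : e ^ 2 = 1 + η ^ 2) (hch : ch ^ 2 = sh ^ 2 + 1)
    (hc : c * d = e - ch) (hs : σ * d = η * sh)
    (hk : u' * d = l' - e' * sh) (hηe : η * η' = e * e')
    (hf : f' * d = c * (η' * sh + η * (ch * u')) - σ * (e' - sh * u')) :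
    f' = (1 + e * c) ^ 2 / η ^ 3 * l' - σ * (2 + e * c) / η ^ 2 * e' := by
  -- In `hf` the derivative of `d` is already eliminated. `hA`, `hB` and `hC` remove `ch` and `sh`
  -- from the coefficients of `l'` and `e'`.
  have hA : c * η * ch + σ * sh = η := by
    apply mul_right_cancel₀ hd
    linear_combination η * ch * hc + sh * hs - η * hch - η * hde
  have hB : c ^ 2 * d ^ 2 + η ^ 2 * (d + sh ^ 2) = (2 + e * c) * d ^ 2 := by
    have h1 : c ^ 2 * d ^ 2 = (e - ch) ^ 2 := by rw [← hc]; ring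
    have h2 : (2 + e * c) * d ^ 2 = 2 * d ^ 2 + e * d * (e - ch) := by rw [← hc]; ring
    rw [h1, h2, hde]
    linear_combination -(e * ch - 1 + sh ^ 2) * he2 - (e ^ 2 - 1) * hch
  -- Expresses `d` through the true anomaly, so that no hyperbolic function survives in the result.
  have hw : (1 + e * c) * d = η ^ 2 := by linear_combination e * hc + hde + he2
  have hC : e * d - η ^ 2 * ch = -(c * d) := by rw [hc, hde]; linear_combination ch * he2
  have key : f' * d ^ 2 * η ^ 2 = η ^ 3 * l' - σ * (2 + e * c) * d ^ 2 * e' := by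
    linear_combination d * η ^ 2 * hf + (c * η ^ 3 * ch + σ * η ^ 2 * sh) * hk
      + c * η * sh * d * hηe + η ^ 2 * l' * hA - σ * e' * hB + c * η * sh * e' * hC
      + c ^ 2 * d * e' * hs
  have hw' : 1 + e * c = η ^ 2 / d := by rw [eq_div_iff hd, hw]
  rw [hw']
  field_simp
  linear_combination key

/-- The gradient of the true anomaly, as a function of the true anomaly (in the place of the
first variable) and of the other Delaunay variables. -/
def anomSlope (i : Fin 6) (y : Phase) : ℝ :=
  (if i = 0 then (1 + ecc y * Real.cos (y 0)) ^ 2 / eta y ^ 3 else 0)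
    - Real.sin (y 0) * (2 + ecc y * Real.cos (y 0)) / eta y ^ 2
      * (eta y * etaSlope i y / ecc y)

theorem hasDerivAt_update_of_contDiffOn {F : Phase → ℝ} (hF : ContDiffOn ℝ ∞ F domain) {x : Phase}
    (hx : x ∈ domain) (i : Fin 6) :
    HasDerivAt (fun t : ℝ => F (Function.update x i t)) (pd i F x) (x i) := by
  have hd := differentiableAt_of_contDiffOn hF hx
  rw [pd_eq_fderiv i hd]
  have h1 : HasFDerivAt F (fderiv ℝ F x) (Function.update x i (x i)) := by
    rw [Function.update_eq_self]; exact hd.hasFDerivAt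
  exact h1.comp_hasDerivAt (x i) (hasDerivAt_update x i (x i))

theorem kepler_anom {x : Phase} (hx : x ∈ domain) :
    ecc x * Real.sinh (hypAnomaly (ecc x) (x 0)) - hypAnomaly (ecc x) (x 0) = x 0 :=
  kepler_hypAnomaly (one_lt_ecc hx) _

/-- Obtained by implicit differentiation of Kepler's equation and of the formulas for cos f and sin
f. The point is that the gradient depends on f and L, G only, so that Delaunay derivatives act on
functions given in the chart. -/
theorem pd_anom {x : Phase} (hx : x ∈ domain) (i : Fin 6) :
    pd i anom x = anomSlope i (Function.update x 0 (anom x)) := by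
  set e' := eta x * etaSlope i x / ecc x with he'
  set l' : ℝ := if i = 0 then 1 else 0 with hl'
  set u := hypAnomaly (ecc x) (x 0) with hu
  have hη := hasDerivAt_eta_update hx i
  have he := hasDerivAt_ecc_update hx i
  have hU := hasDerivAt_update_of_contDiffOn contDiffOn_hypAnomaly hx i
  have hF := hasDerivAt_update_of_contDiffOn contDiffOn_anom hx i
  set u' := pd i (fun x : Phase => hypAnomaly (ecc x) (x 0)) x with hu'
  have hd := one_lt_ecc_mul_cosh (one_lt_ecc hx) u
  have hev := eventually_update (domain_mem_nhds hx) i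
  have hl : HasDerivAt (fun t : ℝ => Function.update x i t 0) l' (x i) := by
    have := (hasDerivAt_pi.1 (hasDerivAt_update x i (x i))) 0
    simpa [Pi.single_apply, hl', eq_comm] using this
  have hk : u' * (ecc x * Real.cosh u - 1) = l' - e' * Real.sinh u := by
    have h1 := ((he.mul hU.sinh).sub hU).congr_of_eventuallyEq
      (f₁ := fun t : ℝ => Function.update x i t 0) (by
        filter_upwards [hev] with t ht
        exact (kepler_anom ht).symm)
    have h2 := h1.unique hl
    simp only [Function.update_eq_self] at h2
    linear_combination h2
  -- The relations for cos f and sin f are differentiated after multiplication by e cosh u - 1,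
  -- which avoids quotients. Combining them with weights -sin f and cos f isolates the derivative of
  -- f.
  have h1 : -Real.sin (anom x) * pd i anom x * (ecc x * Real.cosh u - 1)
      + Real.cos (anom x) * (e' * Real.cosh u + ecc x * (Real.sinh u * u'))
      = e' - Real.sinh u * u' := by
    have h1 := hF.cos.mul ((he.mul hU.cosh).sub_const 1)
    have h2 := (he.sub hU.cosh).congr_of_eventuallyEq
      (f₁ := fun t : ℝ => Real.cos (anom (Function.update x i t))
        * (ecc (Function.update x i t) * Real.cosh (hypAnomaly (ecc (Function.update x i t))
          (Function.update x i t 0)) - 1)) (by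
        filter_upwards [hev] with t ht
        have := one_lt_ecc_mul_cosh (one_lt_ecc ht)
          (hypAnomaly (ecc (Function.update x i t)) (Function.update x i t 0))
        rw [cos_anom ht, div_mul_cancel₀ _ this.ne']
        rfl)
    have h3 := h1.unique h2
    simp only [Pi.mul_apply, Function.update_eq_self] at h3
    linear_combination h3
  have h2 : Real.cos (anom x) * pd i anom x * (ecc x * Real.cosh u - 1)
      + Real.sin (anom x) * (e' * Real.cosh u + ecc x * (Real.sinh u * u'))
      = etaSlope i x * Real.sinh u + eta x * (Real.cosh u * u') := by
    have h1 := hF.sin.mul ((he.mul hU.cosh).sub_const 1)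
    have h2 := (hη.mul hU.sinh).congr_of_eventuallyEq
      (f₁ := fun t : ℝ => Real.sin (anom (Function.update x i t))
        * (ecc (Function.update x i t) * Real.cosh (hypAnomaly (ecc (Function.update x i t))
          (Function.update x i t 0)) - 1)) (by
        filter_upwards [hev] with t ht
        have := one_lt_ecc_mul_cosh (one_lt_ecc ht)
          (hypAnomaly (ecc (Function.update x i t)) (Function.update x i t 0))
        rw [sin_anom ht, div_mul_cancel₀ _ this.ne']
        rfl)
    have h3 := h1.unique h2
    simp only [Pi.mul_apply, Function.update_eq_self] at h3
    linear_combination h3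
  have hsc := Real.sin_sq_add_cos_sq (anom x)
  have h := deriv_anomaly_curve (c := Real.cos (anom x)) (σ := Real.sin (anom x))
    (f' := pd i anom x) (η' := etaSlope i x) (e' := e') (l' := l') (u' := u') hd.ne'
    (eta_pos hx).ne' rfl (ecc_sq x) (Real.cosh_sq u)
    (by rw [cos_anom hx, div_mul_cancel₀ _ hd.ne']) (by rw [sin_anom hx, div_mul_cancel₀ _ hd.ne'])
    hk (by rw [he']; field_simp [(ecc_pos x).ne'])
    (by linear_combination Real.cos (anom x) * h2 - Real.sin (anom x) * h1
          - pd i anom x * (ecc x * Real.cosh u - 1) * hsc)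
  rw [h]
  -- Definitional, as is every such equality below: these functions do not read slot 0.
  have q1 : ecc (Function.update x 0 (anom x)) = ecc x := rfl
  have q2 : eta (Function.update x 0 (anom x)) = eta x := rfl
  have q3 : etaSlope i (Function.update x 0 (anom x)) = etaSlope i x := rfl
  simp only [anomSlope, q1, q2, q3, Function.update_self, he', hl']
  split_ifs <;> ring

/-! ### Functions that are regular at infinity -/

/-- The true anomaly in the place of the first Delaunay variable. -/
def chart (x : Phase) : Phase := Function.update x 0 (anom x)

/-- The point of the chart at infinity along the incoming asymptote. -/
def asymptote (x : Phase) : Phase := Function.update x 0 (Real.pi + Real.arctan (eta x))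

theorem chart_mem {x : Phase} (hx : x ∈ domain) : chart x ∈ domain :=
  update_zero_mem_domain.2 hx

theorem asymptote_mem {x : Phase} (hx : x ∈ domain) : asymptote x ∈ domain :=
  update_zero_mem_domain.2 hx

theorem cos_asymptote (x : Phase) : Real.cos (asymptote x 0) = -1 / ecc x := by
  simp only [asymptote, Function.update_self]
  rw [add_comm, Real.cos_add_pi, Real.cos_arctan, ecc, neg_div]

theorem sin_asymptote (x : Phase) : Real.sin (asymptote x 0) = -eta x / ecc x := by
  simp only [asymptote, Function.update_self]
  rw [add_comm, Real.sin_add_pi, Real.sin_arctan, ecc, neg_div]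

/-- Smooth functions of the true anomaly and of the other Delaunay variables. -/
def IsRegular (F : Phase → ℝ) : Prop :=
  ∃ Φ : Phase → ℝ, ContDiffOn ℝ ∞ Φ domain ∧ ∀ x ∈ domain, F x = Φ (chart x)

/-- Regular functions that vanish on the incoming asymptote. -/
def IsNull (F : Phase → ℝ) : Prop :=
  ∃ Φ : Phase → ℝ, ContDiffOn ℝ ∞ Φ domain ∧ (∀ x ∈ domain, F x = Φ (chart x)) ∧
    ∀ x ∈ domain, Φ (asymptote x) = 0

theorem IsNull.isRegular {F : Phase → ℝ} (h : IsNull F) : IsRegular F :=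
  let ⟨Φ, h1, h2, _⟩ := h; ⟨Φ, h1, h2⟩

theorem contDiffOn_chart : ContDiffOn ℝ ∞ chart domain := by
  rw [contDiffOn_pi]
  intro i
  by_cases hi : i = 0
  · subst hi
    simpa [chart] using contDiffOn_anom
  · simpa [chart, hi] using contDiffOn_coord i

theorem contDiffOn_asymptoteAngle :
    ContDiffOn ℝ ∞ (fun x => Real.pi + Real.arctan (eta x)) domain :=
  contDiffOn_const.add (Real.contDiff_arctan.comp_contDiffOn contDiffOn_eta)

theorem contDiffOn_comp_chart {Φ : Phase → ℝ} (hΦ : ContDiffOn ℝ ∞ Φ domain) :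
    ContDiffOn ℝ ∞ (fun x => Φ (chart x)) domain :=
  hΦ.comp contDiffOn_chart fun _ hx => chart_mem hx

theorem IsRegular.contDiffOn {F : Phase → ℝ} (h : IsRegular F) : ContDiffOn ℝ ∞ F domain := by
  obtain ⟨Φ, h1, h2⟩ := h
  exact (contDiffOn_comp_chart h1).congr h2

theorem IsRegular.add {F F' : Phase → ℝ} (h : IsRegular F) (h' : IsRegular F') :
    IsRegular (fun x => F x + F' x) := by
  obtain ⟨Φ, h1, h2⟩ := h
  obtain ⟨Φ', h1', h2'⟩ := h'
  exact ⟨fun x => Φ x + Φ' x, h1.add h1', fun x hx => by simp only [h2 x hx, h2' x hx]⟩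

theorem IsNull.add {F F' : Phase → ℝ} (h : IsNull F) (h' : IsNull F') :
    IsNull (fun x => F x + F' x) := by
  obtain ⟨Φ, h1, h2, h3⟩ := h
  obtain ⟨Φ', h1', h2', h3'⟩ := h'
  exact ⟨fun x => Φ x + Φ' x, h1.add h1', fun x hx => by simp only [h2 x hx, h2' x hx],
    fun x hx => by simp [h3 x hx, h3' x hx]⟩

theorem IsNull.sub {F F' : Phase → ℝ} (h : IsNull F) (h' : IsNull F') :
    IsNull (fun x => F x - F' x) := by
  obtain ⟨Φ, h1, h2, h3⟩ := h
  obtain ⟨Φ', h1', h2', h3'⟩ := h'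
  exact ⟨fun x => Φ x - Φ' x, h1.sub h1', fun x hx => by simp only [h2 x hx, h2' x hx],
    fun x hx => by simp [h3 x hx, h3' x hx]⟩

theorem IsRegular.mul_isNull {F F' : Phase → ℝ} (h : IsRegular F) (h' : IsNull F') :
    IsNull (fun x => F x * F' x) := by
  obtain ⟨Φ, h1, h2⟩ := h
  obtain ⟨Φ', h1', h2', h3'⟩ := h'
  exact ⟨fun x => Φ x * Φ' x, h1.mul h1', fun x hx => by simp only [h2 x hx, h2' x hx],
    fun x hx => by simp [h3' x hx]⟩

theorem IsNull.congr {F F' : Phase → ℝ} (h : IsNull F) (h' : ∀ x ∈ domain, F' x = F x) :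
    IsNull F' := by
  obtain ⟨Φ, h1, h2, h3⟩ := h
  exact ⟨Φ, h1, fun x hx => by rw [h' x hx, h2 x hx], h3⟩

theorem contDiffOn_etaSlope (i : Fin 6) : ContDiffOn ℝ ∞ (etaSlope i) domain := by
  have h3 := (contDiffOn_eta.pow 2).div (contDiffOn_coord 4) fun x hx => hx.2.1.ne'
  have h4 := contDiffOn_eta.div (contDiffOn_coord 4) fun x hx => hx.2.1.ne'
  fin_cases i
  · exact contDiffOn_const
  · exact contDiffOn_const
  · exact contDiffOn_const
  · exact h3
  · exact h4
  · exact contDiffOn_const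

theorem contDiffOn_anomSlope (i : Fin 6) : ContDiffOn ℝ ∞ (anomSlope i) domain := by
  have hc : ContDiffOn ℝ ∞ (fun y : Phase => ecc y * Real.cos (y 0)) domain :=
    contDiffOn_ecc.mul (Real.contDiff_cos.comp_contDiffOn (contDiffOn_coord 0))
  have hs : ContDiffOn ℝ ∞ (fun y : Phase => Real.sin (y 0)) domain :=
    Real.contDiff_sin.comp_contDiffOn (contDiffOn_coord 0)
  have h1 : ContDiffOn ℝ ∞ (fun y : Phase =>
      if i = 0 then (1 + ecc y * Real.cos (y 0)) ^ 2 / eta y ^ 3 else 0) domain := by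
    split_ifs
    · exact ((contDiffOn_const.add hc).pow 2).div (contDiffOn_eta.pow 3)
        fun x hx => pow_ne_zero _ (eta_pos hx).ne'
    · exact contDiffOn_const
  exact h1.sub (((hs.mul (contDiffOn_const.add hc)).div (contDiffOn_eta.pow 2)
    fun x hx => pow_ne_zero _ (eta_pos hx).ne').mul
    ((contDiffOn_eta.mul (contDiffOn_etaSlope i)).div contDiffOn_ecc fun x _ => (ecc_pos x).ne'))

/-- Tangency: on f = π + arctan η the gradient of the true anomaly at fixed Delaunay variables
agrees with the gradient of the asymptotic angle. The ℓ-component is zero on both sides because 1 +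
e cos f = 0 there. -/
theorem anomSlope_asymptote {x : Phase} (hx : x ∈ domain) (i : Fin 6) :
    anomSlope i (asymptote x) = pd i (fun x => Real.pi + Real.arctan (eta x)) x := by
  have h := (((hasDerivAt_eta_update hx i).arctan).const_add Real.pi).deriv
  have h' : pd i (fun x => Real.pi + Real.arctan (eta x)) x
    = deriv (fun t => Real.pi + Real.arctan (eta (Function.update x i t))) (x i) := rfl
  have q1 : ecc (asymptote x) = ecc x := rfl
  have q2 : eta (asymptote x) = eta x := rfl
  have q3 : etaSlope i (asymptote x) = etaSlope i x := rfl
  have he := (ecc_pos x).ne'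
  have hη := (eta_pos hx).ne'
  rw [h', h, anomSlope, cos_asymptote, sin_asymptote, q1, q2, q3, Function.update_eq_self,
    ← ecc_sq, mul_div_cancel₀ _ he]
  have : (if i = 0 then ((1 : ℝ) + -1) ^ 2 / eta x ^ 3 else 0) = 0 := by split_ifs <;> simp
  rw [this]
  field_simp
  ring

theorem pd_comp_chart {Φ : Phase → ℝ} {x : Phase} (hx : x ∈ domain)
    (hΦ : DifferentiableAt ℝ Φ (chart x)) (i : Fin 6) :
    pd i (fun y => Φ (chart y)) x
      = (if i = 0 then 0 else pd i Φ (chart x)) + anomSlope i (chart x) * pd 0 Φ (chart x) := by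
  have h := pd_comp_update hΦ (differentiableAt_of_contDiffOn contDiffOn_anom hx) i
  rw [pd_anom hx] at h
  exact h

theorem contDiffOn_chartPd {Φ : Phase → ℝ} (hΦ : ContDiffOn ℝ ∞ Φ domain) (i : Fin 6) :
    ContDiffOn ℝ ∞ (fun y => (if i = 0 then 0 else pd i Φ y) + anomSlope i y * pd 0 Φ y)
      domain := by
  refine ContDiffOn.add ?_ ((contDiffOn_anomSlope i).mul (contDiffOn_pd hΦ 0))
  split_ifs
  · exact contDiffOn_const
  · exact contDiffOn_pd hΦ i

theorem IsRegular.pd {F : Phase → ℝ} (h : IsRegular F) (i : Fin 6) : IsRegular (pd i F) := by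
  obtain ⟨Φ, h1, h2⟩ := h
  refine ⟨_, contDiffOn_chartPd h1 i, fun x hx => ?_⟩
  rw [pd_congr_domain h2 hx]
  exact pd_comp_chart hx (differentiableAt_of_contDiffOn h1 (chart_mem hx)) i

/-- The factor (1 + e cos f)² in ∂f/∂ℓ vanishes on the asymptote, so a mean-anomaly derivative gains
nullity from mere regularity. -/
theorem IsRegular.pd_zero {F : Phase → ℝ} (h : IsRegular F) : IsNull (HypJ2.pd 0 F) := by
  obtain ⟨Φ, h1, h2⟩ := h
  refine ⟨_, contDiffOn_chartPd h1 0, fun x hx => ?_, fun x hx => ?_⟩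
  · rw [pd_congr_domain h2 hx]
    exact pd_comp_chart hx (differentiableAt_of_contDiffOn h1 (chart_mem hx)) 0
  · have : anomSlope 0 (asymptote x) = 0 := by
      have q1 : ecc (asymptote x) = ecc x := rfl
      have he := (ecc_pos x).ne'
      rw [anomSlope, cos_asymptote, q1, mul_div_cancel₀ _ he]
      simp [etaSlope]
    simp [this]

/-- By tangency, the derivative evaluated on the asymptote is the derivative of the restriction of Φ
to the asymptote, and that restriction is identically zero. -/
theorem IsNull.pd {F : Phase → ℝ} (h : IsNull F) (i : Fin 6) : IsNull (HypJ2.pd i F) := by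
  obtain ⟨Φ, h1, h2, h3⟩ := h
  refine ⟨_, contDiffOn_chartPd h1 i, fun x hx => ?_, fun x hx => ?_⟩
  · rw [pd_congr_domain h2 hx]
    exact pd_comp_chart hx (differentiableAt_of_contDiffOn h1 (chart_mem hx)) i
  · have hd := differentiableAt_of_contDiffOn h1 (asymptote_mem hx)
    have h4 := pd_comp_update (φ := fun x => Real.pi + Real.arctan (eta x)) hd
      (differentiableAt_of_contDiffOn contDiffOn_asymptoteAngle hx) i
    rw [anomSlope_asymptote hx]
    exact h4.symm.trans ((pd_congr_domain (F' := fun _ => 0) h3 hx i).trans (by simp [HypJ2.pd]))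

/-- Every product in the bracket contains a derivative of `B`, which is null; the cofactor only has
to be regular. -/
theorem IsRegular.poisson {A B : Phase → ℝ} (hA : IsRegular A) (hB : IsNull B) :
    IsNull (poisson A B) :=
  ((((hA.pd 0).mul_isNull (hB.pd 3)).sub ((hA.pd 3).mul_isNull (hB.pd 0))).add
    (((hA.pd 1).mul_isNull (hB.pd 4)).sub ((hA.pd 4).mul_isNull (hB.pd 1)))).add
    (((hA.pd 2).mul_isNull (hB.pd 5)).sub ((hA.pd 5).mul_isNull (hB.pd 2)))

theorem tendsto_chart {x : Phase} (hx : x ∈ domain) :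
    Tendsto (fun l : ℝ => chart (Function.update x 0 l)) atBot (𝓝 (asymptote x)) := by
  have h1 : ∀ l : ℝ, chart (Function.update x 0 l)
      = Function.update x 0 (trueAnomaly (Real.sqrt (1 + eta x ^ 2)) l) := by
    intro l
    simp only [chart, Function.update_idem, anom, Function.update_self]
    rfl
  simp only [h1]
  have hc : Continuous (fun t : ℝ => Function.update x 0 t) := by fun_prop
  exact (hc.tendsto _).comp (tendsto_trueAnomaly (eta_pos hx))

theorem tendsto_of_eq_comp_chart {F Φ : Phase → ℝ} (hΦ : ContDiffOn ℝ ∞ Φ domain)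
    (h : ∀ x ∈ domain, F x = Φ (chart x)) {x : Phase} (hx : x ∈ domain) :
    Tendsto (fun l : ℝ => F (Function.update x 0 l)) atBot (𝓝 (Φ (asymptote x))) := by
  have hc := (differentiableAt_of_contDiffOn hΦ (asymptote_mem hx)).continuousAt
  refine (hc.tendsto.comp (tendsto_chart hx)).congr fun l => ?_
  exact (h _ (update_zero_mem_domain.2 hx)).symm

theorem IsNull.vanishesAtInfinity {F : Phase → ℝ} (h : IsNull F) : VanishesAtInfinity F := by
  obtain ⟨Φ, h1, h2, h3⟩ := h
  intro x hx
  rw [← h3 x hx]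
  exact tendsto_of_eq_comp_chart h1 h2 hx

/-! ### The inclination polynomials -/

/-- The harmonics are an arbitrary function `X` of j, so that one expansion of the table serves both
the values at infinity, where `X` is a cosine or a sine, and the f-derivative, where a factor j
appears. -/
theorem sum_qTable_zero (s e : ℝ) (X : ℤ → ℝ) :
    ∑ j ∈ Finset.Icc (jLow 0) 5, ∑ i ∈ Finset.range 4,
      qTable s i j 0 * e ^ (2 * (i : ℤ) + 1 - j % 2) * X j
      = ((-12 * s ^ 2 * (13 * s ^ 2 - 4)) * e ^ 2 + (8 * (75 * s ^ 4 - 72 * s ^ 2 + 20)) * e ^ 4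
          + (-6 * (5 * s ^ 4 + 4 * s ^ 2 - 4)) * e ^ 6) * X (-1)
      + ((2 * (255 * s ^ 4 - 576 * s ^ 2 + 272)) * e ^ 3
          + (6 * (11 * s ^ 4 + 64 * s ^ 2 - 48)) * e ^ 5) * X 0
      + ((-12 * s ^ 2 * (13 * s ^ 2 - 4)) * e ^ 2 + (8 * (75 * s ^ 4 - 72 * s ^ 2 + 20)) * e ^ 4
          + (-6 * (5 * s ^ 4 + 4 * s ^ 2 - 4)) * e ^ 6) * X 1
      + ((-24 * s ^ 2 * (15 * s ^ 2 - 4)) * e + (12 * s ^ 2 * (45 * s ^ 2 - 16)) * e ^ 3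
          + (4 * (27 * s ^ 4 - 72 * s ^ 2 + 32)) * e ^ 5) * X 2
      + ((-112 * s ^ 4) + (4 * s ^ 2 * (7 * s ^ 2 + 8)) * e ^ 2
          + (s ^ 2 * (145 * s ^ 2 - 64)) * e ^ 4
          + (-25 * s ^ 4 - 16 * s ^ 2 + 16) * e ^ 6) * X 3
      + ((-72 * s ^ 4) * e + 90 * s ^ 4 * e ^ 3 + (-18 * s ^ 4) * e ^ 5) * X 4
      + ((-12 * s ^ 4) * e ^ 2 + 15 * s ^ 4 * e ^ 4 + (-3 * s ^ 4) * e ^ 6) * X 5 := by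
  have h : Finset.Icc (jLow 0) 5 = ({-1, 0, 1, 2, 3, 4, 5} : Finset ℤ) := by decide
  rw [h]
  rw [Finset.sum_insert (by decide), Finset.sum_insert (by decide), Finset.sum_insert (by decide),
    Finset.sum_insert (by decide), Finset.sum_insert (by decide), Finset.sum_insert (by decide),
    Finset.sum_singleton]
  simp only [Finset.sum_range_succ, Finset.sum_range_zero, zero_add]
  simp only [qTable]
  simp only [Matrix.cons_val, Pi.zero_apply, zero_mul, zero_add, add_zero]
  norm_num [zpow_ofNat]
  ring

theorem sum_pTable_zero (s e : ℝ) (X : ℤ → ℝ) :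
    ∑ j ∈ Finset.Icc (jLow 0) (jHigh 0), ∑ i ∈ Finset.range 3,
      pTable s i j 0 * e ^ (2 * (i : ℤ) + 1 - j % 2) * X j
      = ((12 * s ^ 2 * (13 * s ^ 2 - 4)) * e ^ 2
          + (-2 * (27 * s ^ 4 + 180 * s ^ 2 - 128)) * e ^ 4) * X (-1)
      + ((-12 * s ^ 2 * (13 * s ^ 2 - 4)) * e ^ 2
          + (2 * (27 * s ^ 4 + 180 * s ^ 2 - 128)) * e ^ 4) * X 1
      + ((-24 * s ^ 2 * (15 * s ^ 2 - 4)) * e + (72 * s ^ 2 * (5 * s ^ 2 - 2)) * e ^ 3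
          + (6 * (5 * s ^ 4 + 8 * s ^ 2 - 8)) * e ^ 5) * X 2
      + ((-112 * s ^ 4) + (4 * s ^ 2 * (8 - 7 * s ^ 2)) * e ^ 2
          + (3 * s ^ 2 * (39 * s ^ 2 - 16)) * e ^ 4) * X 3
      + ((-72 * s ^ 4) * e + 54 * s ^ 4 * e ^ 3) * X 4
      + ((-12 * s ^ 4) * e ^ 2 + 9 * s ^ 4 * e ^ 4) * X 5 := by
  have h : Finset.Icc (jLow 0) (jHigh 0) = ({-1, 0, 1, 2, 3, 4, 5, 6} : Finset ℤ) := by decide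
  rw [h]
  rw [Finset.sum_insert (by decide), Finset.sum_insert (by decide), Finset.sum_insert (by decide),
    Finset.sum_insert (by decide), Finset.sum_insert (by decide), Finset.sum_insert (by decide),
    Finset.sum_insert (by decide), Finset.sum_singleton]
  simp only [Finset.sum_range_succ, Finset.sum_range_zero, zero_add]
  simp only [pTable]
  simp only [Matrix.cons_val, Pi.zero_apply, zero_mul, zero_add, add_zero]
  norm_num [zpow_ofNat]
  ring

theorem sum_qTable_one (s e : ℝ) (X : ℤ → ℝ) :
    ∑ j ∈ Finset.Icc (jLow 1) 5, ∑ i ∈ Finset.range 4,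
      qTable s i j 1 * e ^ (2 * (i : ℤ) + 1 - j % 2) * X j
      = ((8 * (3 * s ^ 2 - 2)) * e ^ 2 + (-10 * (3 * s ^ 2 - 2)) * e ^ 4
          + (2 * (3 * s ^ 2 - 2)) * e ^ 6) * X (-3)
      + ((64 * (3 * s ^ 2 - 2)) * e + (-80 * (3 * s ^ 2 - 2)) * e ^ 3
          + (16 * (3 * s ^ 2 - 2)) * e ^ 5) * X (-2)
      + ((160 * (3 * s ^ 2 - 2)) + (-8 * (45 * s ^ 2 - 26)) * e ^ 2
          + (-2 * (153 * s ^ 2 - 134)) * e ^ 4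
          + (24 * (7 * s ^ 2 - 6)) * e ^ 6) * X (-1)
      + ((16 * (s ^ 2 + 6)) * e + (8 * (149 * s ^ 2 - 142)) * e ^ 3
          + (-4 * (329 * s ^ 2 - 278)) * e ^ 5) * X 0
      + ((96 * (2 * s ^ 2 - 1)) * e ^ 2 + (-6 * (127 * s ^ 2 - 90)) * e ^ 4
          + (12 * (25 * s ^ 2 - 22)) * e ^ 6) * X 1
      + ((-96 * (6 * s ^ 2 - 5)) * e ^ 3 + (24 * (9 * s ^ 2 - 10)) * e ^ 5) * X 2
      + ((-2 * (195 * s ^ 2 - 146)) * e ^ 4 + (8 * (15 * s ^ 2 - 14)) * e ^ 6) * X 3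
      + ((-36 * (3 * s ^ 2 - 2)) * e ^ 5) * X 4
      + ((-6 * (3 * s ^ 2 - 2)) * e ^ 6) * X 5 := by
  have h : Finset.Icc (jLow 1) 5 = ({-3, -2, -1, 0, 1, 2, 3, 4, 5} : Finset ℤ) := by decide
  rw [h]
  rw [Finset.sum_insert (by decide), Finset.sum_insert (by decide), Finset.sum_insert (by decide),
    Finset.sum_insert (by decide), Finset.sum_insert (by decide), Finset.sum_insert (by decide),
    Finset.sum_insert (by decide), Finset.sum_insert (by decide), Finset.sum_singleton]
  simp only [Finset.sum_range_succ, Finset.sum_range_zero, zero_add]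
  simp only [qTable]
  simp only [Matrix.cons_val, Pi.zero_apply, zero_mul, zero_add, add_zero]
  norm_num [zpow_ofNat]
  ring

theorem sum_pTable_one (s e : ℝ) (X : ℤ → ℝ) :
    ∑ j ∈ Finset.Icc (jLow 1) (jHigh 1), ∑ i ∈ Finset.range 3,
      pTable s i j 1 * e ^ (2 * (i : ℤ) + 1 - j % 2) * X j
      = ((-8 * (3 * s ^ 2 - 2)) * e ^ 2 + (6 * (3 * s ^ 2 - 2)) * e ^ 4) * X (-3)
      + ((-64 * (3 * s ^ 2 - 2)) * e + (48 * (3 * s ^ 2 - 2)) * e ^ 3) * X (-2)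
      + ((-160 * (3 * s ^ 2 - 2)) + (24 * (5 * s ^ 2 - 2)) * e ^ 2
          + (18 * (17 * s ^ 2 - 14)) * e ^ 4) * X (-1)
      + ((-16 * (s ^ 2 + 6)) * e + (-16 * (75 * s ^ 2 - 68)) * e ^ 3
          + (-6 * (17 * s ^ 2 - 18)) * e ^ 5) * X 0
      + ((-96 * (2 * s ^ 2 - 1)) * e ^ 2 + (-2 * (825 * s ^ 2 - 742)) * e ^ 4) * X 1
      + ((-32 * (15 * s ^ 2 - 13)) * e ^ 3 + (-24 * (s ^ 2 - 2)) * e ^ 5) * X 2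
      + ((2 * (55 * s ^ 2 - 34)) * e ^ 4) * X 3
      + ((6 * (13 * s ^ 2 - 10)) * e ^ 5) * X 4 := by
  have h : Finset.Icc (jLow 1) (jHigh 1) = ({-3, -2, -1, 0, 1, 2, 3, 4} : Finset ℤ) := by decide
  rw [h]
  rw [Finset.sum_insert (by decide), Finset.sum_insert (by decide), Finset.sum_insert (by decide),
    Finset.sum_insert (by decide), Finset.sum_insert (by decide), Finset.sum_insert (by decide),
    Finset.sum_insert (by decide), Finset.sum_singleton]
  simp only [Finset.sum_range_succ, Finset.sum_range_zero, zero_add]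
  simp only [pTable]
  simp only [Matrix.cons_val, Pi.zero_apply, zero_mul, zero_add, add_zero]
  norm_num [zpow_ofNat]
  ring

theorem sum_qTable_two (s e : ℝ) (X : ℤ → ℝ) :
    ∑ j ∈ Finset.Icc (jLow 2) 5, ∑ i ∈ Finset.range 4,
      qTable s i j 2 * e ^ (2 * (i : ℤ) + 1 - j % 2) * X j
      = ((-12) * e ^ 2 + 15 * e ^ 4 + (-3) * e ^ 6) * X (-1)
      + ((-48) * e + 42 * e ^ 3 + 6 * e ^ 5) * X 0
      + ((-48) + (-36) * e ^ 2 + 81 * e ^ 4 + 3 * e ^ 6) * X 1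
      + ((-120) * e + 60 * e ^ 3 + 60 * e ^ 5) * X 2
      + ((-120) * e ^ 2 + 105 * e ^ 4 + 15 * e ^ 6) * X 3
      + ((-54) * e ^ 3 + 54 * e ^ 5) * X 4
      + ((-9) * e ^ 4 + 9 * e ^ 6) * X 5 := by
  have h : Finset.Icc (jLow 2) 5 = ({-1, 0, 1, 2, 3, 4, 5} : Finset ℤ) := by decide
  rw [h]
  rw [Finset.sum_insert (by decide), Finset.sum_insert (by decide), Finset.sum_insert (by decide),
    Finset.sum_insert (by decide), Finset.sum_insert (by decide), Finset.sum_insert (by decide),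
    Finset.sum_singleton]
  simp only [Finset.sum_range_succ, Finset.sum_range_zero, zero_add]
  simp only [qTable]
  simp only [Matrix.cons_val, Pi.zero_apply, zero_mul, zero_add, add_zero]
  norm_num [zpow_ofNat]
  ring

theorem sum_pTable_two (s e : ℝ) (X : ℤ → ℝ) :
    ∑ j ∈ Finset.Icc (jLow 2) (jHigh 2), ∑ i ∈ Finset.range 3,
      pTable s i j 2 * e ^ (2 * (i : ℤ) + 1 - j % 2) * X j
      = (12 * e ^ 2 + (-9) * e ^ 4) * X (-1)
      + (48 * e + (-18) * e ^ 3 + (-9) * e ^ 5) * X 0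
      + (48 + 60 * e ^ 2 + (-45) * e ^ 4) * X 1
      + (120 * e + (-15) * e ^ 5) * X 2
      + (120 * e ^ 2 + (-15) * e ^ 4) * X 3
      + (66 * e ^ 3 + (-3) * e ^ 5) * X 4
      + (21 * e ^ 4) * X 5
      + (3 * e ^ 5) * X 6 := by
  have h : Finset.Icc (jLow 2) (jHigh 2) = ({-1, 0, 1, 2, 3, 4, 5, 6} : Finset ℤ) := by decide
  rw [h]
  rw [Finset.sum_insert (by decide), Finset.sum_insert (by decide), Finset.sum_insert (by decide),
    Finset.sum_insert (by decide), Finset.sum_insert (by decide), Finset.sum_insert (by decide),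
    Finset.sum_insert (by decide), Finset.sum_singleton]
  simp only [Finset.sum_range_succ, Finset.sum_range_zero, zero_add]
  simp only [pTable]
  simp only [Matrix.cons_val, Pi.zero_apply, zero_mul, zero_add, add_zero]
  norm_num [zpow_ofNat]
  ring

/-! ### Multiple angles and the value of the table sums at infinity -/

theorem cos_four_mul (f : ℝ) :
    Real.cos (4 * f) = 8 * Real.cos f ^ 4 - 8 * Real.cos f ^ 2 + 1 := by
  rw [show 4 * f = 2 * (2 * f) by ring, Real.cos_two_mul, Real.cos_two_mul]; ring

theorem sin_three_mul' (f : ℝ) :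
    Real.sin (3 * f) = Real.sin f * (4 * Real.cos f ^ 2 - 1) := by
  rw [Real.sin_three_mul]; linear_combination -4 * Real.sin f * Real.sin_sq_add_cos_sq f

theorem sin_four_mul (f : ℝ) :
    Real.sin (4 * f) = Real.sin f * (8 * Real.cos f ^ 3 - 4 * Real.cos f) := by
  rw [show 4 * f = 2 * (2 * f) by ring, Real.sin_two_mul, Real.cos_two_mul, Real.sin_two_mul]
  ring

theorem cos_five_mul (f : ℝ) :
    Real.cos (5 * f) = 16 * Real.cos f ^ 5 - 20 * Real.cos f ^ 3 + 5 * Real.cos f := by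
  rw [show 5 * f = 2 * f + 3 * f by ring, Real.cos_add, Real.cos_three_mul, sin_three_mul',
    Real.cos_two_mul, Real.sin_two_mul]
  linear_combination -2 * Real.cos f * (4 * Real.cos f ^ 2 - 1) * Real.sin_sq_add_cos_sq f

theorem sin_five_mul (f : ℝ) :
    Real.sin (5 * f) = Real.sin f * (16 * Real.cos f ^ 4 - 12 * Real.cos f ^ 2 + 1) := by
  rw [show 5 * f = 2 * f + 3 * f by ring, Real.sin_add, Real.cos_three_mul, sin_three_mul',
    Real.cos_two_mul, Real.sin_two_mul]
  ring

theorem cos_six_mul (f : ℝ) :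
    Real.cos (6 * f)
      = 32 * Real.cos f ^ 6 - 48 * Real.cos f ^ 4 + 18 * Real.cos f ^ 2 - 1 := by
  rw [show 6 * f = 2 * (3 * f) by ring, Real.cos_two_mul, Real.cos_three_mul]; ring

theorem sin_six_mul (f : ℝ) :
    Real.sin (6 * f)
      = Real.sin f * (32 * Real.cos f ^ 5 - 32 * Real.cos f ^ 3 + 6 * Real.cos f) := by
  rw [show 6 * f = 2 * (3 * f) by ring, Real.sin_two_mul, Real.cos_three_mul, sin_three_mul']
  ring

/-- The trigonometric sum of order `k` in the tables, with the phase `φ` in the place of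
`2 k g`. -/
def tableSum (k : Fin 3) (s e η f φ : ℝ) : ℝ :=
  (∑ j ∈ Finset.Icc (jLow k) 5, ∑ i ∈ Finset.range 4,
      qTable s i j k * e ^ (2 * (i : ℤ) + 1 - j % 2) * Real.cos (j * f + φ))
    + η * ∑ j ∈ Finset.Icc (jLow k) (jHigh k), ∑ i ∈ Finset.range 3,
      pTable s i j k * e ^ (2 * (i : ℤ) + 1 - j % 2) * Real.sin (j * f + φ)

/-- Each order k vanishes separately at the asymptote: the j = 0 entries of the tables are what
cancels the other harmonics at cos f = -1/e, sin f = -η/e. For k = 0 the phase 2kg is zero; for k =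
1, 2 the cancellation holds for every phase, that is, for every g. -/
theorem tableSum_zero_asymptote {s e η f φ : ℝ} (he : e ≠ 0) (heη : e ^ 2 = 1 + η ^ 2)
    (hc : Real.cos f = -1 / e) (hs : Real.sin f = -η / e) (hφ : φ = 0) :
    tableSum 0 s e η f φ = 0 := by
  rw [tableSum, sum_qTable_zero s e fun j => Real.cos (j * f + φ),
    sum_pTable_zero s e fun j => Real.sin (j * f + φ)]
  subst hφ
  simp only [Int.cast_neg, Int.cast_ofNat, Int.cast_one, Int.cast_zero, neg_mul, one_mul, zero_mul,
    add_zero, Real.cos_neg, Real.sin_neg, Real.cos_zero, Real.cos_two_mul,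
    Real.sin_two_mul, Real.cos_three_mul, sin_three_mul', cos_four_mul, sin_four_mul, cos_five_mul,
    sin_five_mul]
  rw [hc, hs]
  field_simp
  have h2 : η ^ 2 = e ^ 2 - 1 := by rw [heη]; ring
  rw [h2]
  ring

theorem tableSum_one_asymptote {s e η f φ : ℝ} (he : e ≠ 0) (heη : e ^ 2 = 1 + η ^ 2)
    (hc : Real.cos f = -1 / e) (hs : Real.sin f = -η / e) :
    tableSum 1 s e η f φ = 0 := by
  rw [tableSum, sum_qTable_one s e fun j => Real.cos (j * f + φ),
    sum_pTable_one s e fun j => Real.sin (j * f + φ)]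
  simp only [Int.cast_neg, Int.cast_ofNat, Int.cast_one, Int.cast_zero, neg_mul, one_mul, zero_mul,
    zero_add, Real.cos_add, Real.sin_add, Real.cos_neg, Real.sin_neg, Real.cos_two_mul,
    Real.sin_two_mul, Real.cos_three_mul, sin_three_mul', cos_four_mul, sin_four_mul, cos_five_mul,
    sin_five_mul]
  rw [hc, hs]
  have h2 : η ^ 2 = e ^ 2 - 1 := by rw [heη]; ring
  field_simp
  ring_nf
  simp only [h2]
  ring

theorem tableSum_two_asymptote {s e η f φ : ℝ} (he : e ≠ 0)
    (hc : Real.cos f = -1 / e) (hs : Real.sin f = -η / e) :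
    tableSum 2 s e η f φ = 0 := by
  rw [tableSum, sum_qTable_two s e fun j => Real.cos (j * f + φ),
    sum_pTable_two s e fun j => Real.sin (j * f + φ)]
  simp only [Int.cast_neg, Int.cast_ofNat, Int.cast_one, Int.cast_zero, neg_mul, one_mul, zero_mul,
    zero_add, Real.cos_add, Real.sin_add, Real.cos_neg, Real.sin_neg, Real.cos_two_mul,
    Real.sin_two_mul, Real.cos_three_mul, sin_three_mul', cos_four_mul, sin_four_mul, cos_five_mul,
    sin_five_mul, cos_six_mul, sin_six_mul]
  rw [hc, hs]
  field_simp
  ring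

/-! ### The generating functions and the polar variables at infinity -/

theorem contDiff_qTable (i : ℕ) (j : ℤ) (k : Fin 3) : ContDiff ℝ ∞ fun s => qTable s i j k := by
  unfold qTable
  split <;> fin_cases k <;> simp <;> fun_prop

theorem contDiff_pTable (i : ℕ) (j : ℤ) (k : Fin 3) : ContDiff ℝ ∞ fun s => pTable s i j k := by
  unfold pTable
  split <;> fin_cases k <;> simp <;> fun_prop

/-- The remainder `j % 2` is 0 or 1 also for negative `j`, so the integer exponent is never
negative. -/
theorem contDiffOn_ecc_zpow (i : ℕ) (j : ℤ) :
    ContDiffOn ℝ ∞ (fun y => ecc y ^ (2 * (i : ℤ) + 1 - j % 2)) domain := by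
  obtain ⟨n, hn⟩ := Int.eq_ofNat_of_zero_le (a := 2 * (i : ℤ) + 1 - j % 2) (by omega)
  rw [hn]
  simp only [zpow_natCast]
  exact contDiffOn_ecc.pow n

/-- The table sums as functions on the chart. -/
def tableSumChart (y : Phase) : ℝ :=
  ∑ k : Fin 3, incl y ^ (2 * (k : ℕ))
    * tableSum k (incl y) (ecc y) (eta y) (y 0) (2 * (k : ℕ) * y 1)

theorem contDiffOn_tableSumChart : ContDiffOn ℝ ∞ tableSumChart domain := by
  have harg : ∀ (j : ℤ) (k : Fin 3),
      ContDiffOn ℝ ∞ (fun y : Phase => j * y 0 + 2 * (k : ℕ) * y 1) domain := fun j k =>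
    (contDiffOn_const.mul (contDiffOn_coord 0)).add (contDiffOn_const.mul (contDiffOn_coord 1))
  refine ContDiffOn.sum fun k _ => (contDiffOn_incl.pow _).mul (ContDiffOn.add ?_
    (contDiffOn_eta.mul ?_))
  · exact ContDiffOn.sum fun j _ => ContDiffOn.sum fun i _ =>
      (((contDiff_qTable i j k).comp_contDiffOn contDiffOn_incl).mul (contDiffOn_ecc_zpow i j)).mul
        (Real.contDiff_cos.comp_contDiffOn (harg j k))
  · exact ContDiffOn.sum fun j _ => ContDiffOn.sum fun i _ =>
      (((contDiff_pTable i j k).comp_contDiffOn contDiffOn_incl).mul (contDiffOn_ecc_zpow i j)).mul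
        (Real.contDiff_sin.comp_contDiffOn (harg j k))

theorem contDiffOn_amplitude {μ : ℝ} (hμ : 0 < μ) (α : ℝ) :
    ContDiffOn ℝ ∞ (amplitude μ α) domain :=
  (contDiffOn_coord 4).mul (contDiffOn_const.div ((contDiffOn_semilatus μ).pow 4)
    fun _ hx => pow_ne_zero _ (semilatus_pos hμ hx).ne')

theorem contDiffOn_trig_g (n : ℝ) : ContDiffOn ℝ ∞ (fun y : Phase => Real.cos (n * y 1)) domain ∧
    ContDiffOn ℝ ∞ (fun y : Phase => Real.sin (n * y 1)) domain :=
  ⟨Real.contDiff_cos.comp_contDiffOn (contDiffOn_const.mul (contDiffOn_coord 1)),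
    Real.contDiff_sin.comp_contDiffOn (contDiffOn_const.mul (contDiffOn_coord 1))⟩

theorem contDiffOn_psiCoeff : ContDiffOn ℝ ∞ psiCoeff domain := by
  have he := contDiffOn_ecc
  have hη := contDiffOn_eta
  have hs := contDiffOn_incl
  obtain ⟨hc2, hs2⟩ := contDiffOn_trig_g 2
  have h5 := (contDiffOn_const (c := (5 : ℝ))).mul (hs.pow 2)
  refine (contDiffOn_const.div (contDiffOn_const.mul (he.pow 2))
    fun x _ => mul_ne_zero (by norm_num) (pow_ne_zero _ (ecc_pos x).ne')).mul ?_
  refine ContDiffOn.sub (ContDiffOn.sub (ContDiffOn.mul (ContDiffOn.mul (ContDiffOn.add ?_ ?_)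
    (hs.pow 2)) hc2) (ContDiffOn.mul (ContDiffOn.mul (ContDiffOn.mul ?_ ?_) (hs.pow 2)) hs2)) ?_
  · exact (contDiffOn_const.mul (he.pow 4)).mul
      ((contDiffOn_const.mul (hs.pow 2)).sub contDiffOn_const)
  · exact (contDiffOn_const.mul ((contDiffOn_const.mul (he.pow 2)).sub contDiffOn_const)).mul
      (h5.sub contDiffOn_const)
  · exact contDiffOn_const.mul (hη.pow 3)
  · exact h5.sub contDiffOn_const
  · exact (he.pow 4).mul (((contDiffOn_const.mul (hs.pow 4)).add
      (contDiffOn_const.mul (hs.pow 2))).sub contDiffOn_const)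

/-- The second-order generating function on the chart. -/
def genTwoChart (μ α : ℝ) (y : Phase) : ℝ :=
  amplitude μ α y * psiCoeff y * (Real.pi + Real.arctan (eta y) - y 0)
    + amplitude μ α y / (256 * ecc y ^ 3 * eta y) * tableSumChart y

theorem genTwo_eq (μ α : ℝ) (x : Phase) : genTwo μ α x = genTwoChart μ α (chart x) := by
  have h1 : genTwoChart μ α (chart x)
    = amplitude μ α x * psiCoeff x * (Real.pi + Real.arctan (eta x) - anom x)
      + amplitude μ α x / (256 * ecc x ^ 3 * eta x) * tableSumChart (chart x) := rfl
  have h2 : tableSumChart (chart x) = ∑ k : Fin 3, incl x ^ (2 * (k : ℕ))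
        * ((∑ j ∈ Finset.Icc (jLow k) 5, cosTerm k j x)
            + eta x * ∑ j ∈ Finset.Icc (jLow k) (jHigh k), sinTerm k j x) := rfl
  rw [h1, h2, genTwo, psi]
  ring

theorem contDiffOn_genTwoChart {μ : ℝ} (hμ : 0 < μ) (α : ℝ) :
    ContDiffOn ℝ ∞ (genTwoChart μ α) domain := by
  have hA := contDiffOn_amplitude hμ α
  refine ((hA.mul contDiffOn_psiCoeff).mul
    (contDiffOn_asymptoteAngle.sub (contDiffOn_coord 0))).add
    ((hA.div ((contDiffOn_const.mul (contDiffOn_ecc.pow 3)).mul contDiffOn_eta)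
      fun x hx => ?_).mul contDiffOn_tableSumChart)
  have := ecc_pos x
  have := eta_pos hx
  positivity

/-- This is what the integration constants are for: ψ is the angular distance to the asymptote, and
the trigonometric part vanishes there order by order. -/
theorem isNull_genTwo {μ : ℝ} (hμ : 0 < μ) (α : ℝ) : IsNull (genTwo μ α) := by
  refine ⟨_, contDiffOn_genTwoChart hμ α, fun x _ => genTwo_eq μ α x, fun x hx => ?_⟩
  have h1 : tableSumChart (asymptote x) = 0 := by
    have hc := cos_asymptote x
    have hs := sin_asymptote x
    have he : ecc x ≠ 0 := (ecc_pos x).ne'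
    have q1 : ecc (asymptote x) = ecc x := rfl
    have q2 : eta (asymptote x) = eta x := rfl
    rw [tableSumChart, Fin.sum_univ_three, q1, q2,
      tableSum_zero_asymptote he (ecc_sq x) hc hs (by simp),
      tableSum_one_asymptote he (ecc_sq x) hc hs, tableSum_two_asymptote he hc hs]
    ring
  have h2 : Real.pi + Real.arctan (eta (asymptote x)) - asymptote x 0 = 0 := by
    have q2 : eta (asymptote x) = eta x := rfl
    rw [q2]; simp [asymptote]
  rw [genTwoChart, h1, h2]
  ring

/-- The first-order generating function, up to the factor `G α² / p²`, as a function of `e`, `η`,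
`sin² I`, `f` and `g`. -/
def genOneCore (e η S f g : ℝ) : ℝ :=
  -(1 / 8) * (S * (3 * e * Real.sin (f + 2 * g) + 3 * Real.sin (2 * f + 2 * g)
        + e * Real.sin (3 * f + 2 * g)) - (6 * S - 4) * e * Real.sin f)
    + 1 / 4 * ((3 * S - 2) * η - S / e ^ 2 * (η ^ 3 * Real.cos (2 * g)
        + 1 / 2 * (3 * e ^ 2 - 2) * Real.sin (2 * g)))

/-- The first-order generating function on the chart. -/
def genOneChart (μ α : ℝ) (y : Phase) : ℝ :=
  y 4 * (α ^ 2 / semilatus μ y ^ 2)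
    * genOneCore (ecc y) (eta y) (incl y ^ 2) (y 0) (y 1)

theorem genOne_eq (μ α : ℝ) (x : Phase) : genOne μ α x = genOneChart μ α (chart x) := by
  have h1 : genOneChart μ α (chart x) = x 4 * (α ^ 2 / semilatus μ x ^ 2)
    * genOneCore (ecc x) (eta x) (incl x ^ 2) (anom x) (x 1) := rfl
  rw [h1, genOne, constC, genOneCore]
  ring

theorem contDiffOn_genOneChart {μ : ℝ} (hμ : 0 < μ) (α : ℝ) :
    ContDiffOn ℝ ∞ (genOneChart μ α) domain := by
  have he := contDiffOn_ecc
  have hη := contDiffOn_eta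
  have hS := contDiffOn_incl.pow 2
  obtain ⟨hc2, hs2⟩ := contDiffOn_trig_g 2
  have harg : ∀ a b : ℝ, ContDiffOn ℝ ∞ (fun y : Phase => Real.sin (a * y 0 + b * y 1)) domain :=
    fun a b => Real.contDiff_sin.comp_contDiffOn
      ((contDiffOn_const.mul (contDiffOn_coord 0)).add (contDiffOn_const.mul (contDiffOn_coord 1)))
  have h1 : ContDiffOn ℝ ∞ (fun y : Phase => Real.sin (y 0 + 2 * y 1)) domain := by
    simpa using harg 1 2
  have h2 := harg 2 2
  have h3 := harg 3 2
  have h0 : ContDiffOn ℝ ∞ (fun y : Phase => Real.sin (y 0)) domain := by simpa using harg 1 0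
  refine ((contDiffOn_coord 4).mul (contDiffOn_const.div ((contDiffOn_semilatus μ).pow 2)
    fun _ hx => pow_ne_zero _ (semilatus_pos hμ hx).ne')).mul ?_
  refine (contDiffOn_const.mul ((hS.mul ((((contDiffOn_const.mul he).mul h1).add
    (contDiffOn_const.mul h2)).add (he.mul h3))).sub
    ((((contDiffOn_const.mul hS).sub contDiffOn_const).mul he).mul h0))).add
    (contDiffOn_const.mul ((((contDiffOn_const.mul hS).sub contDiffOn_const).mul hη).sub
      ((hS.div (he.pow 2) fun x _ => pow_ne_zero _ (ecc_pos x).ne').mul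
        (((hη.pow 3).mul hc2).add ((contDiffOn_const.mul
          ((contDiffOn_const.mul (he.pow 2)).sub contDiffOn_const)).mul hs2)))))

/-- The constant 𝒞₀ is minus the value of the periodic terms at the asymptote. -/
theorem genOneCore_asymptote {e η S f g : ℝ} (he : e ≠ 0) (heη : e ^ 2 = 1 + η ^ 2)
    (hc : Real.cos f = -1 / e) (hs : Real.sin f = -η / e) : genOneCore e η S f g = 0 := by
  rw [genOneCore, Real.sin_add, Real.sin_add, Real.sin_add, Real.cos_three_mul, sin_three_mul',
    Real.cos_two_mul f, Real.sin_two_mul f, hc, hs]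
  have h2 : η ^ 3 = η * (e ^ 2 - 1) := by rw [heη]; ring
  rw [h2]
  field_simp
  ring

theorem isNull_genOne {μ : ℝ} (hμ : 0 < μ) (α : ℝ) : IsNull (genOne μ α) := by
  refine ⟨_, contDiffOn_genOneChart hμ α, fun x _ => genOne_eq μ α x, fun x hx => ?_⟩
  rw [genOneChart, genOneCore_asymptote (e := ecc (asymptote x)) (η := eta (asymptote x))
    (ecc_pos _).ne' (ecc_sq _) (cos_asymptote x) (sin_asymptote x), mul_zero]

/-! ### Regularity of the polar variables other than the radius -/

theorem isRegular_coord {i : Fin 6} (hi : i ≠ 0) : IsRegular fun x => x i :=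
  ⟨fun x => x i, contDiffOn_coord i, fun x _ => by simp [chart, hi]⟩

theorem isRegular_anom : IsRegular anom :=
  ⟨fun x => x 0, contDiffOn_coord 0, fun x _ => by simp [chart]⟩

/-- The radius p/(1 + e cos f) is excluded because it has a pole on the asymptote. -/
theorem isRegular_polar {μ : ℝ} (hμ : 0 < μ) {i : Fin 6} (hi : i ≠ 0) :
    IsRegular (polar μ i) := by
  fin_cases i
  · exact absurd rfl hi
  · exact isRegular_anom.add (isRegular_coord (i := 1) (by decide))
  · exact isRegular_coord (i := 2) (by decide)
  · exact ⟨fun y => y 4 / semilatus μ y * (ecc y * Real.sin (y 0)),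
      ((contDiffOn_coord 4).div (contDiffOn_semilatus μ) fun _ hx => (semilatus_pos hμ hx).ne').mul
      (contDiffOn_ecc.mul (Real.contDiff_sin.comp_contDiffOn (contDiffOn_coord 0))),
      fun x _ => rfl⟩
  · exact isRegular_coord (i := 4) (by decide)
  · exact isRegular_coord (i := 5) (by decide)

theorem contDiffOn_polar {μ : ℝ} (hμ : 0 < μ) (i : Fin 6) :
    ContDiffOn ℝ ∞ (polar μ i) domain := by
  by_cases hi : i = 0
  · subst hi
    exact (contDiffOn_semilatus μ).div (contDiffOn_const.add (contDiffOn_ecc.mul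
      (Real.contDiff_cos.comp_contDiffOn contDiffOn_anom)))
      fun x hx => (one_add_ecc_mul_cos_anom_pos hx).ne'
  · exact (isRegular_polar hμ hi).contDiffOn

/-! ### The radius at infinity -/

theorem hasDerivAt_anom_update {x : Phase} (hx : x ∈ domain) (i : Fin 6) :
    HasDerivAt (fun t : ℝ => anom (Function.update x i t)) (anomSlope i (chart x)) (x i) := by
  rw [chart, ← pd_anom hx]
  exact hasDerivAt_update_of_contDiffOn contDiffOn_anom hx i

theorem hasDerivAt_semilatus_update (μ : ℝ) (x : Phase) (i : Fin 6) :
    HasDerivAt (fun t : ℝ => semilatus μ (Function.update x i t))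
      (if i = 4 then 2 * x 4 / μ else 0) (x i) := by
  have h := (((hasDerivAt_pi.1 (hasDerivAt_update x i (x i))) 4).pow 2).div_const μ
  refine h.congr_deriv ?_
  by_cases hi : i = 4
  · subst hi; simp
  · simp [hi, Ne.symm hi]

theorem pd_radius (μ : ℝ) {x : Phase} (hx : x ∈ domain) (i : Fin 6) :
    pd i (polar μ 0) x
      = (if i = 4 then 2 * x 4 / μ else 0) / (1 + ecc x * Real.cos (anom x))
        - semilatus μ x * (eta x * etaSlope i x / ecc x * Real.cos (anom x)
            - ecc x * (Real.sin (anom x) * anomSlope i (chart x)))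
          / (1 + ecc x * Real.cos (anom x)) ^ 2 := by
  have hw := one_add_ecc_mul_cos_anom_pos hx
  have h := ((hasDerivAt_semilatus_update μ x i).div
    (((hasDerivAt_ecc_update hx i).mul (hasDerivAt_anom_update hx i).cos).const_add 1)
    (by simpa using hw.ne')).deriv
  refine (Eq.trans ?_ h).trans ?_
  · rfl
  · simp only [Pi.mul_apply, Function.update_eq_self]
    field_simp
    ring

/-- The squared denominator of the quotient rule is cancelled by the factor (1 + e cos f)² of ∂f/∂ℓ,
which leaves a regular function. -/
theorem pd_radius_zero (μ : ℝ) {x : Phase} (hx : x ∈ domain) :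
    pd 0 (polar μ 0) x = semilatus μ x * ecc x * Real.sin (anom x) / eta x ^ 3 := by
  have hw := one_add_ecc_mul_cos_anom_pos hx
  have hη := eta_pos hx
  have he := ecc_pos x
  have q1 : ecc (chart x) = ecc x := rfl
  have q2 : eta (chart x) = eta x := rfl
  have q3 : chart x 0 = anom x := by simp [chart]
  rw [pd_radius μ hx]
  simp only [anomSlope, etaSlope, q1, q2, q3, if_true, Matrix.cons_val, Fin.reduceEq, if_false]
  field_simp
  ring

/-- Unlike the derivatives in ℓ and G, the L-derivative keeps a pole on the asymptote, so it is
stated with the denominator cleared. -/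
theorem pd_radius_three {μ : ℝ} {x : Phase} (hx : x ∈ domain) :
    pd 3 (polar μ 0) x * (1 + ecc x * Real.cos (anom x)) ^ 2
      = -(semilatus μ x * eta x ^ 3 / (ecc x * x 4)
        * (Real.cos (anom x) + ecc x * Real.sin (anom x) ^ 2
          * (2 + ecc x * Real.cos (anom x)) / eta x ^ 2)) := by
  have hw := one_add_ecc_mul_cos_anom_pos hx
  have hη := eta_pos hx
  have he := ecc_pos x
  have hG := hx.2.1
  have q1 : ecc (chart x) = ecc x := rfl
  have q2 : eta (chart x) = eta x := rfl
  have q3 : chart x 0 = anom x := by simp [chart]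
  have q4 : chart x 4 = x 4 := by simp [chart]
  rw [pd_radius μ hx]
  simp only [anomSlope, etaSlope, q1, q2, q3, q4, Matrix.cons_val, Fin.reduceEq, if_false]
  field_simp
  ring

/-- The contributions of p, of e and of f combine, by sin² + cos² = 1 and e² = 1 + η², so as to
cancel the denominator entirely. -/
theorem pd_radius_four {μ : ℝ} (hμ : 0 < μ) {x : Phase} (hx : x ∈ domain) :
    pd 4 (polar μ 0) x = semilatus μ x * Real.cos (anom x) / (ecc x * x 4) := by
  have hw := one_add_ecc_mul_cos_anom_pos hx
  have hη := eta_pos hx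
  have he := ecc_pos x
  have hG := hx.2.1
  have q1 : ecc (chart x) = ecc x := rfl
  have q2 : eta (chart x) = eta x := rfl
  have q3 : chart x 0 = anom x := by simp [chart]
  have q4 : chart x 4 = x 4 := by simp [chart]
  have hsc := Real.sin_sq (anom x)
  have h2 := ecc_sq x
  rw [pd_radius μ hx]
  simp only [anomSlope, etaSlope, q1, q2, q3, q4, Matrix.cons_val, Fin.reduceEq, if_false, if_true,
    semilatus, parameter]
  field_simp
  linear_combination Real.cos (anom x) * h2 - ecc x * (2 + ecc x * Real.cos (anom x)) * hsc

theorem pd_radius_of_ne (μ : ℝ) {x : Phase} (hx : x ∈ domain) :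
    pd 1 (polar μ 0) x = 0 ∧ pd 2 (polar μ 0) x = 0 ∧ pd 5 (polar μ 0) x = 0 := by
  refine ⟨?_, ?_, ?_⟩ <;> rw [pd_radius μ hx] <;> simp [anomSlope, etaSlope]

theorem contDiffOn_trig_f : ContDiffOn ℝ ∞ (fun y : Phase => Real.cos (y 0)) domain ∧
    ContDiffOn ℝ ∞ (fun y : Phase => Real.sin (y 0)) domain :=
  ⟨Real.contDiff_cos.comp_contDiffOn (contDiffOn_coord 0),
    Real.contDiff_sin.comp_contDiffOn (contDiffOn_coord 0)⟩

theorem isRegular_pd_radius_zero (μ : ℝ) : IsRegular (pd 0 (polar μ 0)) :=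
  ⟨fun y => semilatus μ y * ecc y * Real.sin (y 0) / eta y ^ 3,
    (((contDiffOn_semilatus μ).mul contDiffOn_ecc).mul contDiffOn_trig_f.2).div
      (contDiffOn_eta.pow 3) fun _ hx => pow_ne_zero _ (eta_pos hx).ne',
    fun _ hx => pd_radius_zero μ hx⟩

theorem isRegular_pd_radius_four {μ : ℝ} (hμ : 0 < μ) : IsRegular (pd 4 (polar μ 0)) :=
  ⟨fun y => semilatus μ y * Real.cos (y 0) / (ecc y * y 4),
    ((contDiffOn_semilatus μ).mul contDiffOn_trig_f.1).div
      (contDiffOn_ecc.mul (contDiffOn_coord 4))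
      fun x hx => mul_ne_zero (ecc_pos x).ne' hx.2.1.ne',
    fun _ hx => pd_radius_four hμ hx⟩

/-- The factor (1 + e cos f)² of ∂B/∂ℓ clears the denominator of ∂r/∂L. The remaining numerator cos
f + e sin² f (2 + e cos f)/η² is zero at cos f = -1/e, sin f = -η/e, so regularity of `B` is enough.
-/
theorem isNull_pd_radius_three_mul (μ : ℝ) {B : Phase → ℝ} (hB : IsRegular B) :
    IsNull fun x => pd 3 (polar μ 0) x * pd 0 B x := by
  obtain ⟨Ψ, h1, h2⟩ := hB
  have hreg : IsRegular fun x => pd 0 Ψ (chart x) := ⟨_, contDiffOn_pd h1 0, fun _ _ => rfl⟩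
  have hnull : IsNull fun x => -(semilatus μ x / (ecc x * x 4)
        * (Real.cos (anom x) + ecc x * Real.sin (anom x) ^ 2
          * (2 + ecc x * Real.cos (anom x)) / eta x ^ 2)) := by
    refine ⟨fun y => -(semilatus μ y / (ecc y * y 4)
        * (Real.cos (y 0) + ecc y * Real.sin (y 0) ^ 2
          * (2 + ecc y * Real.cos (y 0)) / eta y ^ 2)), ?_, fun _ _ => rfl, fun x hx => ?_⟩
    · refine ContDiffOn.neg (ContDiffOn.mul ((contDiffOn_semilatus μ).div
        (contDiffOn_ecc.mul (contDiffOn_coord 4))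
        fun x hx => mul_ne_zero (ecc_pos x).ne' hx.2.1.ne') (contDiffOn_trig_f.1.add
        (((contDiffOn_ecc.mul (contDiffOn_trig_f.2.pow 2)).mul (contDiffOn_const.add
          (contDiffOn_ecc.mul contDiffOn_trig_f.1))).div (contDiffOn_eta.pow 2)
          fun _ hx => pow_ne_zero _ (eta_pos hx).ne')))
    · have q1 : ecc (asymptote x) = ecc x := rfl
      have q2 : eta (asymptote x) = eta x := rfl
      have he := ecc_pos x
      have hη := eta_pos hx
      beta_reduce
      rw [q1, q2, cos_asymptote, sin_asymptote]
      have : -1 / ecc x + ecc x * (-eta x / ecc x) ^ 2 * (2 + ecc x * (-1 / ecc x)) / eta x ^ 2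
          = 0 := by
        field_simp
        ring
      rw [this]
      ring
  refine (hreg.mul_isNull hnull).congr fun x hx => ?_
  have hη := eta_pos hx
  have h3 := pd_radius_three (μ := μ) hx
  have q1 : ecc (chart x) = ecc x := rfl
  have q2 : eta (chart x) = eta x := rfl
  have q3 : chart x 0 = anom x := by simp [chart]
  have h4 : pd 0 B x = (1 + ecc x * Real.cos (anom x)) ^ 2 / eta x ^ 3 * pd 0 Ψ (chart x) := by
    rw [pd_congr_domain h2 hx, pd_comp_chart hx (differentiableAt_of_contDiffOn h1 (chart_mem hx))]
    simp [anomSlope, etaSlope, q1, q2, q3]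
  have he := ecc_pos x
  have hG := hx.2.1
  rw [h4, ← mul_assoc, ← mul_div_assoc, h3]
  field_simp

/-- The radius depends on ℓ, L and G only, which leaves three products in the bracket. -/
theorem isNull_poisson_radius {μ : ℝ} (hμ : 0 < μ) {B : Phase → ℝ} (hB : IsNull B) :
    IsNull (poisson (polar μ 0) B) := by
  refine ((((isRegular_pd_radius_zero μ).mul_isNull (hB.pd 3)).sub
    (isNull_pd_radius_three_mul μ hB.isRegular)).sub
    ((isRegular_pd_radius_four hμ).mul_isNull (hB.pd 1))).congr fun x hx => ?_
  obtain ⟨h1, h2, h5⟩ := pd_radius_of_ne μ hx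
  rw [poisson, h1, h2, h5]
  ring

/-- The corrections to the polar variables vanish at infinity as soon as the generating functions
do. -/
theorem isNull_corrTwo {μ : ℝ} (hμ : 0 < μ) (α : ℝ) {V : Phase → ℝ} (hV : IsNull V) (i : Fin 6) :
    IsNull (corrTwo μ α V i) := by
  have h1 := isNull_genOne hμ α
  have key : ∀ {B : Phase → ℝ}, IsNull B → IsNull (poisson (polar μ i) B) := fun hB => by
    by_cases hi : i = 0
    · subst hi; exact isNull_poisson_radius hμ hB
    · exact (isRegular_polar hμ hi).poisson hB
  -- After one bracket even the correction to the radius is null, hence regular, and the second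
  -- bracket with U₁ needs no special treatment.
  exact (((key h1).isRegular.poisson h1).add (key hV)).congr fun x _ =>
    lieTriangle_constSeq_two _ _ _ x

/-! ### Derivatives of the generating functions on the chart -/

/-- These five functions are the partial derivatives of `genOneCore` with e, η, S = s², f, g treated
as independent variables; the relation e² = 1 + η² is imposed only afterwards. -/
def genOneCoreDe (e η S f g : ℝ) : ℝ :=
  -(1 / 8) * (S * (3 * Real.sin (f + 2 * g) + Real.sin (3 * f + 2 * g))
      - (6 * S - 4) * Real.sin f)
    + 1 / 4 * (2 * S / e ^ 3 * (η ^ 3 * Real.cos (2 * g)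
        + 1 / 2 * (3 * e ^ 2 - 2) * Real.sin (2 * g)) - 3 * S / e * Real.sin (2 * g))

def genOneCoreDη (e η S g : ℝ) : ℝ :=
  1 / 4 * ((3 * S - 2) - 3 * S / e ^ 2 * (η ^ 2 * Real.cos (2 * g)))

def genOneCoreDS (e η f g : ℝ) : ℝ :=
  -(1 / 8) * ((3 * e * Real.sin (f + 2 * g) + 3 * Real.sin (2 * f + 2 * g)
        + e * Real.sin (3 * f + 2 * g)) - 6 * e * Real.sin f)
    + 1 / 4 * (3 * η - 1 / e ^ 2 * (η ^ 3 * Real.cos (2 * g)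
        + 1 / 2 * (3 * e ^ 2 - 2) * Real.sin (2 * g)))

def genOneCoreDf (e S f g : ℝ) : ℝ :=
  -(1 / 8) * (S * (3 * e * Real.cos (f + 2 * g) + 6 * Real.cos (2 * f + 2 * g)
        + 3 * e * Real.cos (3 * f + 2 * g)) - (6 * S - 4) * e * Real.cos f)

def genOneCoreDg (e η S f g : ℝ) : ℝ :=
  -(1 / 8) * (S * (6 * e * Real.cos (f + 2 * g) + 6 * Real.cos (2 * f + 2 * g)
        + 2 * e * Real.cos (3 * f + 2 * g)))
    + 1 / 4 * (S / e ^ 2 * (2 * η ^ 3 * Real.sin (2 * g) - (3 * e ^ 2 - 2) * Real.cos (2 * g)))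

theorem hasDerivAt_genOneCore {e η S f g : ℝ → ℝ} {e' η' S' f' g' t : ℝ} (he : HasDerivAt e e' t)
    (hη : HasDerivAt η η' t) (hS : HasDerivAt S S' t) (hf : HasDerivAt f f' t)
    (hg : HasDerivAt g g' t) (h0 : e t ≠ 0) :
    HasDerivAt (fun t => genOneCore (e t) (η t) (S t) (f t) (g t))
      (e' * genOneCoreDe (e t) (η t) (S t) (f t) (g t)
        + η' * genOneCoreDη (e t) (η t) (S t) (g t)
        + S' * genOneCoreDS (e t) (η t) (f t) (g t)
        + f' * genOneCoreDf (e t) (S t) (f t) (g t)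
        + g' * genOneCoreDg (e t) (η t) (S t) (f t) (g t)) t := by
  have h1 := (hf.fun_add (hg.const_mul 2)).sin
  have h2 := ((hf.const_mul 2).fun_add (hg.const_mul 2)).sin
  have h3 := ((hf.const_mul 3).fun_add (hg.const_mul 2)).sin
  have h4 := hf.sin
  have hc := (hg.const_mul 2).cos
  have hs := (hg.const_mul 2).sin
  have h := ((((hS.fun_mul ((((he.const_mul 3).fun_mul h1).fun_add (h2.const_mul 3)).fun_add
    (he.fun_mul h3))).fun_sub ((((hS.const_mul 6).sub_const 4).fun_mul he).fun_mul h4)).const_mul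
    (-(1 / 8))).fun_add (((((hS.const_mul 3).sub_const 2).fun_mul hη).fun_sub
    ((hS.fun_div (he.fun_pow 2) (pow_ne_zero 2 h0)).fun_mul (((hη.fun_pow 3).fun_mul hc).fun_add
      (((((he.fun_pow 2).const_mul 3).sub_const 2).const_mul (1 / 2)).fun_mul hs)))).const_mul
    (1 / 4)))
  refine h.congr_deriv ?_
  simp only [genOneCoreDe, genOneCoreDη, genOneCoreDS, genOneCoreDf, genOneCoreDg]
  norm_num
  field_simp
  ring

/-- The derivative of a table sum with respect to the true anomaly. -/
def tableSumDf (k : Fin 3) (s e η f φ : ℝ) : ℝ :=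
  (∑ j ∈ Finset.Icc (jLow k) 5, ∑ i ∈ Finset.range 4,
      qTable s i j k * e ^ (2 * (i : ℤ) + 1 - j % 2) * (-(j * Real.sin (j * f + φ))))
    + η * ∑ j ∈ Finset.Icc (jLow k) (jHigh k), ∑ i ∈ Finset.range 3,
      pTable s i j k * e ^ (2 * (i : ℤ) + 1 - j % 2) * (j * Real.cos (j * f + φ))

theorem hasDerivAt_tableSum (k : Fin 3) (s e η f φ : ℝ) :
    HasDerivAt (fun f => tableSum k s e η f φ) (tableSumDf k s e η f φ) f := by
  have harg : ∀ j : ℤ, HasDerivAt (fun f : ℝ => j * f + φ) (j : ℝ) f := fun j => by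
    simpa using ((hasDerivAt_id f).const_mul (j : ℝ)).add_const φ
  refine HasDerivAt.fun_add (HasDerivAt.fun_sum fun j _ => HasDerivAt.fun_sum fun i _ => ?_)
    (HasDerivAt.const_mul _ (HasDerivAt.fun_sum fun j _ => HasDerivAt.fun_sum fun i _ => ?_))
  · refine ((harg j).cos.const_mul _).congr_deriv ?_
    ring
  · refine ((harg j).sin.const_mul _).congr_deriv ?_
    ring

/-! ### The second-order averaging identity -/

theorem tableSumDf_zero (s e η f : ℝ) :
    tableSumDf 0 s e η f 0
      = (∑ j ∈ Finset.Icc (jLow 0) 5, ∑ i ∈ Finset.range 4,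
          qTable s i j 0 * e ^ (2 * (i : ℤ) + 1 - j % 2) * (-(j * Real.sin (j * f))))
        + η * ∑ j ∈ Finset.Icc (jLow 0) (jHigh 0), ∑ i ∈ Finset.range 3,
          pTable s i j 0 * e ^ (2 * (i : ℤ) + 1 - j % 2) * (j * Real.cos (j * f)) := by
  simp only [tableSumDf, add_zero]

/-- With θ = 2f + 2g the phases are 2g = θ - 2f and 4g = 2θ - 4f. Absorbing the multiple of f into
the harmonic index leaves only multiples of f up to the fifth, with θ or 2θ. -/
theorem tableSumDf_shift (k : Fin 3) (m : ℤ) (s e η f θ : ℝ) :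
    tableSumDf k s e η f (θ - m * f)
      = (∑ j ∈ Finset.Icc (jLow k) 5, ∑ i ∈ Finset.range 4,
          qTable s i j k * e ^ (2 * (i : ℤ) + 1 - j % 2)
            * (-(j * Real.sin ((j - m : ℤ) * f + θ))))
        + η * ∑ j ∈ Finset.Icc (jLow k) (jHigh k), ∑ i ∈ Finset.range 3,
          pTable s i j k * e ^ (2 * (i : ℤ) + 1 - j % 2)
            * (j * Real.cos ((j - m : ℤ) * f + θ)) := by
  have h : ∀ j : ℤ, (j : ℝ) * f + (θ - m * f) = ((j - m : ℤ) : ℝ) * f + θ := fun j => by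
    push_cast; ring
  simp only [tableSumDf, h]

/-- The expression `{M₁₀ + M₀₁, U₁}` in dimensionless form, with `θ = 2f + 2g`. -/
theorem averaging_identity {s e η f θ W b b₀ a af C D E u uS uf ug : ℝ} (heη : e ^ 2 = 1 + η ^ 2)
    (hW : W = 1 + e * Real.cos f)
    (hb₀ : b₀ = 2 - 3 * s ^ 2) (hb : b = b₀ + 3 * s ^ 2 * Real.cos θ) (ha : a = W * b + b₀)
    (haf : af = -e * Real.sin f * b - 6 * s ^ 2 * W * Real.sin θ)
    (hC : C = Real.cos (θ - 2 * f)) (hD : D = Real.sin (θ - 2 * f))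
    (hE : E = -e ^ 3 * η * (s ^ 2 * (3 * Real.sin (θ - f) + Real.sin (f + θ))
          - (6 * s ^ 2 - 4) * Real.sin f)
        + 2 * (e ^ 4 * (3 * s ^ 2 - 2) - s ^ 2 * (η ^ 2 * (e ^ 2 + 2) * C + 2 * η * D)))
    (hu : u = -e ^ 2 * (s ^ 2 * (3 * e * Real.sin (θ - f) + 3 * Real.sin θ + e * Real.sin (f + θ))
          - (6 * s ^ 2 - 4) * e * Real.sin f)
        + 2 * ((3 * s ^ 2 - 2) * η * e ^ 2) - s ^ 2 * (2 * η ^ 3 * C + (3 * e ^ 2 - 2) * D))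
    (huS : uS = -e ^ 2 * ((3 * e * Real.sin (θ - f) + 3 * Real.sin θ + e * Real.sin (f + θ))
          - 6 * e * Real.sin f) + 6 * η * e ^ 2 - (2 * η ^ 3 * C + (3 * e ^ 2 - 2) * D))
    (huf : uf = -(s ^ 2 * (3 * e * Real.cos (θ - f) + 6 * Real.cos θ + 3 * e * Real.cos (f + θ))
          - (6 * s ^ 2 - 4) * e * Real.cos f))
    (hug : ug = -e ^ 2 * s ^ 2 * (6 * e * Real.cos (θ - f) + 6 * Real.cos θ
          + 2 * e * Real.cos (f + θ)) + 2 * s ^ 2 * (2 * η ^ 3 * D - (3 * e ^ 2 - 2) * C)) :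
    8 * ((-Real.sin f * W * (3 * W * b + 2 * b₀)
          - 6 * s ^ 2 * W * Real.sin θ * (e + 2 * Real.cos f + e * Real.cos f ^ 2)) * E
        + e ^ 2 * η * W * (-Real.cos f * (3 * W * b + 2 * b₀)
            + 6 * s ^ 2 * Real.sin θ * Real.sin f * (2 + e * Real.cos f)) * uf
        - 6 * s ^ 2 * W * Real.sin θ * e * η * (-3 * u + 2 * (1 - s ^ 2) * uS)
        - η * (-6 * e * a + η ^ 2 * Real.cos f * b - Real.sin f * (2 + e * Real.cos f) * af
            + 2 * a * (2 * e - Real.cos f - e * Real.cos f ^ 2)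
            + 2 * e * (1 - s ^ 2) * (W * (-3 + 3 * Real.cos θ) - 3)) * ug)
      = -(tableSumDf 0 s e η f 0 + s ^ 2 * tableSumDf 1 s e η f (θ - (2 : ℤ) * f)
          + s ^ 4 * tableSumDf 2 s e η f (2 * θ - (4 : ℤ) * f))
        + 12 * e * η * ((2 * e ^ 4 * (15 * s ^ 2 - 14)
              + 8 * (3 * e ^ 2 - 2) * (5 * s ^ 2 - 4)) * s ^ 2 * C
            - 16 * η ^ 3 * (5 * s ^ 2 - 4) * s ^ 2 * D
            - e ^ 4 * (5 * s ^ 4 + 8 * s ^ 2 - 8))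
        + 16 * e ^ 3 * η * (21 * s ^ 4 - 42 * s ^ 2 + 20) := by
  -- Legend: `b` and `b₀` are the inclination factors of M₁₀ and M₀₁, `W ^ 2 * a` is `hamSumCore`,
  -- and `af` is the f-derivative of `a`. `C` and `D` are the cosine and sine of 2g. `u`, `uS`, `ug`
  -- are 8e² times the core of U₁ and its derivatives in S and g, `uf` is 8 times its f-derivative,
  -- and `E` is its derivative along 8e³η ∂/∂e + 8e⁴ ∂/∂η, which is how e and η vary together.
  rw [tableSumDf_zero, tableSumDf_shift, tableSumDf_shift,
    sum_qTable_zero s e fun j => -(j * Real.sin (j * f)),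
    sum_pTable_zero s e fun j => j * Real.cos (j * f),
    sum_qTable_one s e fun j => -(j * Real.sin ((j - 2 : ℤ) * f + θ)),
    sum_pTable_one s e fun j => j * Real.cos ((j - 2 : ℤ) * f + θ),
    sum_qTable_two s e fun j => -(j * Real.sin ((j - 4 : ℤ) * f + 2 * θ)),
    sum_pTable_two s e fun j => j * Real.cos ((j - 4 : ℤ) * f + 2 * θ)]
  rw [Real.cos_sub, Real.sin_two_mul, Real.cos_two_mul] at hC
  rw [Real.sin_sub, Real.sin_two_mul, Real.cos_two_mul] at hD
  rw [Real.sin_sub, Real.sin_add] at hE hu huS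
  rw [Real.cos_sub, Real.cos_add] at huf hug
  norm_num [Real.cos_add, Real.sin_add, Real.cos_two_mul, Real.sin_two_mul, Real.cos_three_mul,
    sin_three_mul', cos_four_mul, sin_four_mul, cos_five_mul, sin_five_mul]
  -- The rest is a polynomial identity modulo these three relations. The coefficients at the end are
  -- the cofactors of an explicit division by them.
  have h1 := Real.sin_sq f
  have h2 := Real.sin_sq θ
  have h3 : η ^ 2 = e ^ 2 - 1 := by rw [heη]; ring
  clear heη
  generalize Real.sin f = σ at *
  generalize Real.cos f = c at *
  generalize Real.sin θ = Y at *
  generalize Real.cos θ = X at *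
  subst hW hb₀ hb ha haf hC hD hE hu huS huf hug
  linear_combination (48 * e ^ 5 * η * s ^ 4 * c ^ 2 * X ^ 2
      - 480 * e ^ 5 * η * s ^ 4 * c ^ 2 * X + 192 * e ^
      5 * η * s ^ 4 * c ^ 2 * Y ^ 2 + 432 * e ^ 5 * η * s ^ 4 * c ^ 2 + 96 * e ^ 5 * η * s
      ^ 4 * c * σ * X * Y - 96 * e ^ 5 * η * s ^ 4 * c * σ * Y + 320 * e ^ 5 * η * s ^ 2 *
      c ^ 2 * X - 576 * e ^ 5 * η * s ^ 2 * c ^ 2 + 64 * e ^ 5 * η * s ^ 2 * c * σ * Y +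
      192 * e ^ 5 * η * c ^ 2 + 288 * e ^ 4 * η ^ 2 * s ^ 4 * c ^ 3 * X * Y - 288 * e ^ 4
      * η ^ 2 * s ^ 4 * c ^ 3 * Y + 192 * e ^ 4 * η ^ 2 * s ^ 2 * c ^ 3 * Y + 288 * e ^ 4
      * η * s ^ 4 * c ^ 3 * X ^ 2 - 288 * e ^ 4 * η * s ^ 4 * c ^ 3 * X + 576 * e ^ 4 * η
      * s ^ 4 * c ^ 3 * Y ^ 2 + 288 * e ^ 4 * η * s ^ 4 * c ^ 2 * σ * X * Y - 288 * e ^ 4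
      * η * s ^ 4 * c ^ 2 * σ * Y + 96 * e ^ 4 * η * s ^ 4 * c * X ^ 2 - 864 * e ^ 4 * η *
      s ^ 4 * c * X + 576 * e ^ 4 * η * s ^ 4 * c * Y ^ 2 + 1152 * e ^ 4 * η * s ^ 4 * c +
      192 * e ^ 4 * η * s ^ 4 * σ * X * Y - 192 * e ^ 4 * η * s ^ 4 * σ * Y + 192 * e ^ 4
      * η * s ^ 2 * c ^ 3 * X + 192 * e ^ 4 * η * s ^ 2 * c ^ 2 * σ * Y + 576 * e ^ 4 * η
      * s ^ 2 * c * X - 1536 * e ^ 4 * η * s ^ 2 * c + 128 * e ^ 4 * η * s ^ 2 * σ * Y +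
      512 * e ^ 4 * η * c + 576 * e ^ 3 * η ^ 2 * s ^ 4 * c ^ 2 * X * Y - 768 * e ^ 3 * η
      ^ 2 * s ^ 4 * c ^ 2 * Y + 512 * e ^ 3 * η ^ 2 * s ^ 2 * c ^ 2 * Y + 576 * e ^ 3 * η
      * s ^ 4 * c ^ 2 * X ^ 2 - 576 * e ^ 3 * η * s ^ 4 * c ^ 2 * X + 1728 * e ^ 3 * η * s
      ^ 4 * c ^ 2 * Y ^ 2 + 576 * e ^ 3 * η * s ^ 4 * c * σ * X * Y - 576 * e ^ 3 * η * s
      ^ 4 * c * σ * Y - 144 * e ^ 3 * η * s ^ 4 * X ^ 2 - 192 * e ^ 3 * η * s ^ 4 * X +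
      384 * e ^ 3 * η * s ^ 4 * Y ^ 2 + 720 * e ^ 3 * η * s ^ 4 + 384 * e ^ 3 * η * s ^ 2
      * c ^ 2 * X + 384 * e ^ 3 * η * s ^ 2 * c * σ * Y + 128 * e ^ 3 * η * s ^ 2 * X -
      960 * e ^ 3 * η * s ^ 2 + 320 * e ^ 3 * η + 192 * e ^ 2 * η ^ 4 * s ^ 4 * c ^ 3 * X
      * Y + 192 * e ^ 2 * η ^ 4 * s ^ 4 * c ^ 3 * Y + 192 * e ^ 2 * η ^ 4 * s ^ 4 * c ^ 2
      * σ * X ^ 2 - 192 * e ^ 2 * η ^ 4 * s ^ 4 * c ^ 2 * σ * X + 96 * e ^ 2 * η ^ 4 * s ^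
      4 * c * X * Y - 96 * e ^ 2 * η ^ 4 * s ^ 4 * c * Y - 128 * e ^ 2 * η ^ 4 * s ^ 2 * c
      ^ 3 * Y + 128 * e ^ 2 * η ^ 4 * s ^ 2 * c ^ 2 * σ * X + 64 * e ^ 2 * η ^ 4 * s ^ 2 *
      c * Y + 576 * e ^ 2 * η ^ 2 * s ^ 4 * c ^ 3 * X * Y - 576 * e ^ 2 * η ^ 2 * s ^ 4 *
      c ^ 3 * Y + 288 * e ^ 2 * η ^ 2 * s ^ 4 * c * X * Y - 480 * e ^ 2 * η ^ 2 * s ^ 4 *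
      c * Y + 384 * e ^ 2 * η ^ 2 * s ^ 2 * c ^ 3 * Y + 320 * e ^ 2 * η ^ 2 * s ^ 2 * c *
      Y - 768 * e ^ 2 * η * s ^ 4 * c ^ 3 * X ^ 2 + 768 * e ^ 2 * η * s ^ 4 * c ^ 3 * X -
      384 * e ^ 2 * η * s ^ 4 * c ^ 3 * Y ^ 2 - 192 * e ^ 2 * η * s ^ 4 * c ^ 2 * σ * X *
      Y + 192 * e ^ 2 * η * s ^ 4 * c ^ 2 * σ * Y + 96 * e ^ 2 * η * s ^ 4 * c * X ^ 2 -
      96 * e ^ 2 * η * s ^ 4 * c * X + 1152 * e ^ 2 * η * s ^ 4 * c * Y ^ 2 - 512 * e ^ 2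
      * η * s ^ 2 * c ^ 3 * X - 128 * e ^ 2 * η * s ^ 2 * c ^ 2 * σ * Y + 64 * e ^ 2 * η *
      s ^ 2 * c * X + 768 * e * η ^ 4 * s ^ 4 * c ^ 2 * X * Y + 384 * e * η ^ 4 * s ^ 4 *
      c ^ 2 * Y + 384 * e * η ^ 4 * s ^ 4 * c * σ * X ^ 2 - 384 * e * η ^ 4 * s ^ 4 * c *
      σ * X + 192 * e * η ^ 4 * s ^ 4 * X * Y - 192 * e * η ^ 4 * s ^ 4 * Y - 256 * e * η
      ^ 4 * s ^ 2 * c ^ 2 * Y + 256 * e * η ^ 4 * s ^ 2 * c * σ * X + 128 * e * η ^ 4 * s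
      ^ 2 * Y + 1152 * e * η ^ 2 * s ^ 4 * c ^ 2 * X * Y - 1536 * e * η ^ 2 * s ^ 4 * c ^
      2 * Y + 1024 * e * η ^ 2 * s ^ 2 * c ^ 2 * Y - 1536 * e * η * s ^ 4 * c ^ 2 * X ^ 2
      + 1920 * e * η * s ^ 4 * c ^ 2 * X - 1152 * e * η * s ^ 4 * c ^ 2 * Y ^ 2 - 384 * e
      * η * s ^ 4 * c * σ * X * Y + 384 * e * η * s ^ 4 * c * σ * Y + 192 * e * η * s ^ 4
      * X ^ 2 - 192 * e * η * s ^ 4 * X - 1280 * e * η * s ^ 2 * c ^ 2 * X - 256 * e * η *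
      s ^ 2 * c * σ * Y + 128 * e * η * s ^ 2 * X + 768 * η ^ 4 * s ^ 4 * c * X * Y + 576
      * η ^ 2 * s ^ 4 * c * X * Y - 960 * η ^ 2 * s ^ 4 * c * Y + 640 * η ^ 2 * s ^ 2 * c
      * Y - 576 * η * s ^ 4 * c * X ^ 2 + 960 * η * s ^ 4 * c * X - 768 * η * s ^ 4 * c *
      Y ^ 2 - 640 * η * s ^ 2 * c * X) * h1
    + (-576 * e ^ 5 * η * s ^ 4 * c ^ 2 + 384 * e ^ 5 * η * s ^ 2 * c ^ 2 + 192 * e ^ 4 * η ^ 2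
      * s ^ 4 * c ^ 4 * σ + 192 * e ^ 4 * η ^ 2 * s ^ 4 * c ^ 2 * σ - 576 * e ^ 4 * η * s
      ^ 4 * c ^ 5 - 864 * e ^ 4 * η * s ^ 4 * c ^ 3 - 192 * e ^ 4 * η * s ^ 4 * c + 576 *
      e ^ 4 * η * s ^ 2 * c ^ 3 + 384 * e ^ 4 * η * s ^ 2 * c + 576 * e ^ 3 * η ^ 2 * s ^
      4 * c ^ 3 * σ + 192 * e ^ 3 * η ^ 2 * s ^ 4 * c * σ - 1728 * e ^ 3 * η * s ^ 4 * c ^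
      4 + 288 * e ^ 3 * η * s ^ 4 * c ^ 2 + 384 * e ^ 3 * η * s ^ 4 + 576 * e ^ 3 * η * s
      ^ 2 * c ^ 2 - 384 * e ^ 2 * η ^ 4 * s ^ 4 * c ^ 4 * σ - 768 * e ^ 2 * η ^ 4 * s ^ 4
      * c ^ 2 * σ + 384 * e ^ 2 * η ^ 4 * s ^ 2 * c ^ 2 * σ + 384 * e ^ 2 * η ^ 2 * s ^ 4
      * c ^ 4 * σ + 768 * e ^ 2 * η ^ 2 * s ^ 4 * c ^ 2 * σ + 768 * e ^ 2 * η * s ^ 4 * c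
      ^ 5 - 384 * e ^ 2 * η * s ^ 4 * c ^ 3 + 480 * e ^ 2 * η * s ^ 4 * c - 384 * e ^ 2 *
      η * s ^ 2 * c ^ 3 + 192 * e ^ 2 * η * s ^ 2 * c - 1152 * e * η ^ 4 * s ^ 4 * c ^ 3 *
      σ - 384 * e * η ^ 4 * s ^ 4 * c * σ + 384 * e * η ^ 4 * s ^ 2 * c * σ + 1152 * e * η
      ^ 2 * s ^ 4 * c ^ 3 * σ + 384 * e * η ^ 2 * s ^ 4 * c * σ + 2304 * e * η * s ^ 4 * c
      ^ 4 - 384 * e * η * s ^ 4 * c ^ 2 - 672 * e * η * s ^ 4 - 384 * e * η * s ^ 2 * c ^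
      2 + 192 * e * η * s ^ 2 - 768 * η ^ 4 * s ^ 4 * c ^ 2 * σ + 384 * η ^ 4 * s ^ 4 * σ
      + 768 * η ^ 2 * s ^ 4 * c ^ 2 * σ + 1536 * η * s ^ 4 * c ^ 3 - 1152 * η * s ^ 4 * c) * h2
    + (96 * e ^ 4 * s ^ 4 * c ^ 5 * X * Y - 288 * e ^ 4 * s ^ 4 * c ^ 5 * Y - 96 * e ^ 4 * s ^ 4
      * c ^ 4 * σ * X ^ 2 + 288 * e ^ 4 * s ^ 4 * c ^ 4 * σ * X - 192 * e ^ 4 * s ^ 4 * c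
      ^ 4 * σ - 96 * e ^ 4 * s ^ 4 * c ^ 3 * X * Y - 384 * e ^ 4 * s ^ 4 * c ^ 3 * Y + 48
      * e ^ 4 * s ^ 4 * c ^ 2 * σ * X ^ 2 + 528 * e ^ 4 * s ^ 4 * c ^ 2 * σ * X - 576 * e
      ^ 4 * s ^ 4 * c ^ 2 * σ + 192 * e ^ 4 * s ^ 4 * c * X * Y + 1632 * e ^ 4 * s ^ 4 * c
      * Y + 192 * e ^ 4 * s ^ 2 * c ^ 5 * Y - 192 * e ^ 4 * s ^ 2 * c ^ 4 * σ * X + 384 *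
      e ^ 4 * s ^ 2 * c ^ 3 * Y - 480 * e ^ 4 * s ^ 2 * c ^ 2 * σ * X + 384 * e ^ 4 * s ^
      2 * c ^ 2 * σ - 1344 * e ^ 4 * s ^ 2 * c * Y + 192 * e ^ 3 * η * s ^ 4 * c ^ 2 * X ^
      2 - 192 * e ^ 3 * η * s ^ 4 * c ^ 2 * X + 96 * e ^ 3 * η * s ^ 4 * c * σ * X * Y -
      96 * e ^ 3 * η * s ^ 4 * c * σ * Y + 128 * e ^ 3 * η * s ^ 2 * c ^ 2 * X + 64 * e ^
      3 * η * s ^ 2 * c * σ * Y - 768 * e ^ 3 * s ^ 4 * c ^ 4 * Y + 768 * e ^ 3 * s ^ 4 *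
      c ^ 3 * σ * X - 576 * e ^ 3 * s ^ 4 * c ^ 3 * σ + 480 * e ^ 3 * s ^ 4 * c ^ 2 * X *
      Y + 768 * e ^ 3 * s ^ 4 * c ^ 2 * Y - 480 * e ^ 3 * s ^ 4 * c * σ * X ^ 2 - 384 * e
      ^ 3 * s ^ 4 * c * σ * X - 192 * e ^ 3 * s ^ 4 * c * σ + 192 * e ^ 3 * s ^ 4 * X * Y
      + 1056 * e ^ 3 * s ^ 4 * Y + 512 * e ^ 3 * s ^ 2 * c ^ 4 * Y - 512 * e ^ 3 * s ^ 2 *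
      c ^ 3 * σ * X - 512 * e ^ 3 * s ^ 2 * c ^ 2 * Y + 256 * e ^ 3 * s ^ 2 * c * σ * X +
      384 * e ^ 3 * s ^ 2 * c * σ - 896 * e ^ 3 * s ^ 2 * Y + 192 * e ^ 2 * η ^ 2 * s ^ 4
      * c ^ 5 * X * Y - 576 * e ^ 2 * η ^ 2 * s ^ 4 * c ^ 5 * Y - 192 * e ^ 2 * η ^ 2 * s
      ^ 4 * c ^ 4 * σ * X ^ 2 + 576 * e ^ 2 * η ^ 2 * s ^ 4 * c ^ 4 * σ * X - 384 * e ^ 2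
      * η ^ 2 * s ^ 4 * c ^ 4 * σ - 480 * e ^ 2 * η ^ 2 * s ^ 4 * c ^ 3 * X * Y - 96 * e ^
      2 * η ^ 2 * s ^ 4 * c ^ 3 * Y + 384 * e ^ 2 * η ^ 2 * s ^ 4 * c ^ 2 * σ * X ^ 2 +
      384 * e ^ 2 * η ^ 2 * s ^ 4 * c ^ 2 * σ * X - 768 * e ^ 2 * η ^ 2 * s ^ 4 * c ^ 2 *
      σ + 288 * e ^ 2 * η ^ 2 * s ^ 4 * c * X * Y + 192 * e ^ 2 * η ^ 2 * s ^ 4 * c * Y +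
      384 * e ^ 2 * η ^ 2 * s ^ 2 * c ^ 5 * Y - 384 * e ^ 2 * η ^ 2 * s ^ 2 * c ^ 4 * σ *
      X + 192 * e ^ 2 * η ^ 2 * s ^ 2 * c ^ 3 * Y - 384 * e ^ 2 * η ^ 2 * s ^ 2 * c ^ 2 *
      σ * X + 384 * e ^ 2 * η ^ 2 * s ^ 2 * c ^ 2 * σ - 192 * e ^ 2 * η ^ 2 * s ^ 2 * c *
      Y + 288 * e ^ 2 * η * s ^ 4 * c ^ 3 * X ^ 2 - 288 * e ^ 2 * η * s ^ 4 * c ^ 3 * X +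
      288 * e ^ 2 * η * s ^ 4 * c ^ 2 * σ * X * Y - 288 * e ^ 2 * η * s ^ 4 * c ^ 2 * σ *
      Y + 192 * e ^ 2 * η * s ^ 2 * c ^ 3 * X + 192 * e ^ 2 * η * s ^ 2 * c ^ 2 * σ * Y -
      384 * e ^ 2 * s ^ 4 * c ^ 5 * X * Y + 1152 * e ^ 2 * s ^ 4 * c ^ 5 * Y + 384 * e ^ 2
      * s ^ 4 * c ^ 4 * σ * X ^ 2 - 1152 * e ^ 2 * s ^ 4 * c ^ 4 * σ * X + 768 * e ^ 2 * s
      ^ 4 * c ^ 4 * σ + 1152 * e ^ 2 * s ^ 4 * c ^ 3 * X * Y - 960 * e ^ 2 * s ^ 4 * c ^ 3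
      * Y - 960 * e ^ 2 * s ^ 4 * c ^ 2 * σ * X ^ 2 + 384 * e ^ 2 * s ^ 4 * c ^ 2 * σ * X
      + 768 * e ^ 2 * s ^ 4 * c ^ 2 * σ + 96 * e ^ 2 * s ^ 4 * c * X * Y - 192 * e ^ 2 * s
      ^ 4 * c * Y - 528 * e ^ 2 * s ^ 4 * σ * X ^ 2 + 240 * e ^ 2 * s ^ 4 * σ * X + 384 *
      e ^ 2 * s ^ 4 * σ - 768 * e ^ 2 * s ^ 2 * c ^ 5 * Y + 768 * e ^ 2 * s ^ 2 * c ^ 4 *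
      σ * X + 512 * e ^ 2 * s ^ 2 * c ^ 3 * Y - 128 * e ^ 2 * s ^ 2 * c ^ 2 * σ * X - 384
      * e ^ 2 * s ^ 2 * c ^ 2 * σ + 192 * e ^ 2 * s ^ 2 * c * Y - 160 * e ^ 2 * s ^ 2 * σ
      * X - 1536 * e * η ^ 2 * s ^ 4 * c ^ 4 * Y + 1536 * e * η ^ 2 * s ^ 4 * c ^ 3 * σ *
      X - 1152 * e * η ^ 2 * s ^ 4 * c ^ 3 * σ + 1536 * e * η ^ 2 * s ^ 4 * c ^ 2 * Y -
      768 * e * η ^ 2 * s ^ 4 * c * σ * X - 384 * e * η ^ 2 * s ^ 4 * c * σ + 288 * e * η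
      ^ 2 * s ^ 4 * X * Y - 384 * e * η ^ 2 * s ^ 4 * Y + 1024 * e * η ^ 2 * s ^ 2 * c ^ 4
      * Y - 1024 * e * η ^ 2 * s ^ 2 * c ^ 3 * σ * X - 1024 * e * η ^ 2 * s ^ 2 * c ^ 2 *
      Y + 512 * e * η ^ 2 * s ^ 2 * c * σ * X + 384 * e * η ^ 2 * s ^ 2 * c * σ + 256 * e
      * η ^ 2 * s ^ 2 * Y + 3072 * e * s ^ 4 * c ^ 4 * Y - 3072 * e * s ^ 4 * c ^ 3 * σ *
      X + 2304 * e * s ^ 4 * c ^ 3 * σ + 960 * e * s ^ 4 * c ^ 2 * X * Y - 3072 * e * s ^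
      4 * c ^ 2 * Y - 960 * e * s ^ 4 * c * σ * X ^ 2 + 1536 * e * s ^ 4 * c * σ * X + 768
      * e * s ^ 4 * c * σ - 480 * e * s ^ 4 * X * Y + 384 * e * s ^ 4 * Y - 2048 * e * s ^
      2 * c ^ 4 * Y + 2048 * e * s ^ 2 * c ^ 3 * σ * X + 2048 * e * s ^ 2 * c ^ 2 * Y -
      1024 * e * s ^ 2 * c * σ * X - 384 * e * s ^ 2 * c * σ - 256 * e * s ^ 2 * Y - 192 *
      η ^ 4 * s ^ 4 * c ^ 3 * X * Y + 192 * η ^ 4 * s ^ 4 * c ^ 3 * Y + 192 * η ^ 4 * s ^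
      4 * c ^ 2 * σ * X ^ 2 - 192 * η ^ 4 * s ^ 4 * c ^ 2 * σ * X + 96 * η ^ 4 * s ^ 4 * c
      * X * Y - 96 * η ^ 4 * s ^ 4 * c * Y - 128 * η ^ 4 * s ^ 2 * c ^ 3 * Y + 128 * η ^ 4
      * s ^ 2 * c ^ 2 * σ * X + 64 * η ^ 4 * s ^ 2 * c * Y - 192 * η ^ 2 * s ^ 4 * c ^ 3 *
      X * Y - 960 * η ^ 2 * s ^ 4 * c ^ 3 * Y + 192 * η ^ 2 * s ^ 4 * c ^ 2 * σ * X ^ 2 +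
      960 * η ^ 2 * s ^ 4 * c ^ 2 * σ * X - 768 * η ^ 2 * s ^ 4 * c ^ 2 * σ + 480 * η ^ 2
      * s ^ 4 * c * X * Y + 480 * η ^ 2 * s ^ 4 * c * Y - 384 * η ^ 2 * s ^ 4 * σ * X ^ 2
      + 384 * η ^ 2 * s ^ 4 * σ + 640 * η ^ 2 * s ^ 2 * c ^ 3 * Y - 640 * η ^ 2 * s ^ 2 *
      c ^ 2 * σ * X - 320 * η ^ 2 * s ^ 2 * c * Y - 192 * η * s ^ 4 * c ^ 3 * X ^ 2 + 192
      * η * s ^ 4 * c ^ 3 * X - 192 * η * s ^ 4 * c ^ 2 * σ * X * Y + 192 * η * s ^ 4 * c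
      ^ 2 * σ * Y + 96 * η * s ^ 4 * c * X ^ 2 - 96 * η * s ^ 4 * c * X - 128 * η * s ^ 2
      * c ^ 3 * X - 128 * η * s ^ 2 * c ^ 2 * σ * Y + 64 * η * s ^ 2 * c * X + 384 * s ^ 4
      * c ^ 3 * X * Y + 1920 * s ^ 4 * c ^ 3 * Y - 384 * s ^ 4 * c ^ 2 * σ * X ^ 2 - 1920
      * s ^ 4 * c ^ 2 * σ * X + 1536 * s ^ 4 * c ^ 2 * σ - 288 * s ^ 4 * c * X * Y - 1440
      * s ^ 4 * c * Y + 96 * s ^ 4 * σ * X ^ 2 + 480 * s ^ 4 * σ * X - 384 * s ^ 4 * σ -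
      1280 * s ^ 2 * c ^ 3 * Y + 1280 * s ^ 2 * c ^ 2 * σ * X + 960 * s ^ 2 * c * Y - 320
      * s ^ 2 * σ * X) * h3

/-! ### The transformed Hamiltonian -/

theorem hasDerivAt_coord_update (x : Phase) (i j : Fin 6) :
    HasDerivAt (fun t : ℝ => Function.update x i t j) (if i = j then 1 else 0) (x i) := by
  have := (hasDerivAt_pi.1 (hasDerivAt_update x i (x i))) j
  simpa [Pi.single_apply, eq_comm] using this

/-- The gradient of `incl ^ 2`. -/
def inclSqSlope (i : Fin 6) (x : Phase) : ℝ :=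
  (![0, 0, 0, 0, 2 * (1 - incl x ^ 2) / x 4, -(2 * x 5 / x 4 ^ 2)] : Fin 6 → ℝ) i

theorem hasDerivAt_inclSq_update {x : Phase} (hx : x ∈ domain) (i : Fin 6) :
    HasDerivAt (fun t : ℝ => incl (Function.update x i t) ^ 2) (inclSqSlope i x) (x i) := by
  have hG : x 4 ≠ 0 := hx.2.1.ne'
  have h := ((((hasDerivAt_coord_update x i 5).fun_div (hasDerivAt_coord_update x i 4)
    (by simpa using hG)).fun_pow 2).const_sub 1).congr_of_eventuallyEq
    (f₁ := fun t : ℝ => incl (Function.update x i t) ^ 2) (by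
      filter_upwards [eventually_update (domain_mem_nhds hx) i] with t ht
      exact incl_sq ht)
  refine h.congr_deriv ?_
  simp only [Function.update_eq_self, inclSqSlope, incl_sq hx]
  fin_cases i <;> simp
  · field_simp
  · field_simp

/-- As p = G²/μ, the amplitudes Gα²/p² and G²α²/p⁴ are proportional to G⁻³ and G⁻⁶, whence the
factors -3 here and -6 in `hasDerivAt_secondAmplitude_update`. -/
theorem hasDerivAt_firstAmplitude_update {μ : ℝ} (hμ : 0 < μ) (α : ℝ) {x : Phase}
    (hx : x ∈ domain) (i : Fin 6) :
    HasDerivAt (fun t : ℝ => Function.update x i t 4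
        * (α ^ 2 / semilatus μ (Function.update x i t) ^ 2))
      (if i = 4 then -(3 * (α ^ 2 / semilatus μ x ^ 2)) else 0) (x i) := by
  have hp := semilatus_pos hμ hx
  have hG : x 4 ≠ 0 := hx.2.1.ne'
  have h := (hasDerivAt_coord_update x i 4).fun_mul ((hasDerivAt_const (x i) (α ^ 2)).fun_div
    ((hasDerivAt_semilatus_update μ x i).fun_pow 2) (by simpa using hp.ne'))
  refine h.congr_deriv ?_
  simp only [Function.update_eq_self]
  split_ifs
  · simp only [semilatus, parameter]
    field_simp
    norm_num
    field_simp
    ring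
  · simp

theorem hasDerivAt_secondAmplitude_update {μ : ℝ} (hμ : 0 < μ) (α : ℝ) {x : Phase}
    (hx : x ∈ domain) (i : Fin 6) :
    HasDerivAt (fun t : ℝ => Function.update x i t 4 ^ 2
        * (α ^ 2 / semilatus μ (Function.update x i t) ^ 4))
      (if i = 4 then -(6 * x 4 * (α ^ 2 / semilatus μ x ^ 4)) else 0) (x i) := by
  have hp := semilatus_pos hμ hx
  have hG : x 4 ≠ 0 := hx.2.1.ne'
  have h := ((hasDerivAt_coord_update x i 4).fun_pow 2).fun_mul
    ((hasDerivAt_const (x i) (α ^ 2)).fun_div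
    ((hasDerivAt_semilatus_update μ x i).fun_pow 4) (by simpa using hp.ne'))
  refine h.congr_deriv ?_
  simp only [Function.update_eq_self]
  split_ifs
  · simp only [semilatus, parameter]
    field_simp
    norm_num
    field_simp
    ring
  · simp

theorem pd_genOne {μ : ℝ} (hμ : 0 < μ) (α : ℝ) {x : Phase} (hx : x ∈ domain) (i : Fin 6) :
    pd i (genOne μ α) x
      = (if i = 4 then -(3 * (α ^ 2 / semilatus μ x ^ 2)) else 0)
          * genOneCore (ecc x) (eta x) (incl x ^ 2) (anom x) (x 1)
        + x 4 * (α ^ 2 / semilatus μ x ^ 2)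
          * (eta x * etaSlope i x / ecc x
                * genOneCoreDe (ecc x) (eta x) (incl x ^ 2) (anom x) (x 1)
              + etaSlope i x * genOneCoreDη (ecc x) (eta x) (incl x ^ 2) (x 1)
              + inclSqSlope i x * genOneCoreDS (ecc x) (eta x) (anom x) (x 1)
              + anomSlope i (chart x) * genOneCoreDf (ecc x) (incl x ^ 2) (anom x) (x 1)
              + (if i = 1 then 1 else 0)
                * genOneCoreDg (ecc x) (eta x) (incl x ^ 2) (anom x) (x 1)) := by
  have h := (hasDerivAt_firstAmplitude_update hμ α hx i).fun_mul
    (hasDerivAt_genOneCore (hasDerivAt_ecc_update hx i) (hasDerivAt_eta_update hx i)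
      (hasDerivAt_inclSq_update hx i) (hasDerivAt_anom_update hx i)
      (hasDerivAt_coord_update x i 1) (by simpa using (ecc_pos x).ne'))
  have h1 : (fun t : ℝ => genOne μ α (Function.update x i t)) = fun t : ℝ =>
      Function.update x i t 4 * (α ^ 2 / semilatus μ (Function.update x i t) ^ 2)
        * genOneCore (ecc (Function.update x i t)) (eta (Function.update x i t))
          (incl (Function.update x i t) ^ 2) (anom (Function.update x i t))
          (Function.update x i t 1) := by
    funext t; exact genOne_eq μ α _
  rw [pd, h1, h.deriv]
  simp only [Function.update_eq_self]

/-! ### The bracket {M₁₀ + M₀₁, U₁} -/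

/-- The sum of the first-order terms of the main problem and of the quasi-Keplerian Hamiltonian,
up to the factor `-G² α² / (4 p⁴)`. -/
def hamSumCore (e S f g : ℝ) : ℝ :=
  (1 + e * Real.cos f) ^ 2 * ((1 + e * Real.cos f)
      * (2 - 3 * S + 3 * S * Real.cos (2 * f + 2 * g)) + (2 - 3 * S))

def hamSumCoreDe (e S f g : ℝ) : ℝ :=
  (1 + e * Real.cos f) * Real.cos f * (3 * (1 + e * Real.cos f)
      * (2 - 3 * S + 3 * S * Real.cos (2 * f + 2 * g)) + 2 * (2 - 3 * S))

def hamSumCoreDS (e f g : ℝ) : ℝ :=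
  (1 + e * Real.cos f) ^ 2 * ((1 + e * Real.cos f)
      * (-3 + 3 * Real.cos (2 * f + 2 * g)) - 3)

def hamSumCoreDg (e S f g : ℝ) : ℝ :=
  -(6 * S * (1 + e * Real.cos f) ^ 3 * Real.sin (2 * f + 2 * g))

def hamSumCoreDf (e S f g : ℝ) : ℝ :=
  -(e * Real.sin f * (1 + e * Real.cos f) * (3 * (1 + e * Real.cos f)
      * (2 - 3 * S + 3 * S * Real.cos (2 * f + 2 * g)) + 2 * (2 - 3 * S)))
    + hamSumCoreDg e S f g

theorem hasDerivAt_hamSumCore {e S f g : ℝ → ℝ} {e' S' f' g' t : ℝ} (he : HasDerivAt e e' t)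
    (hS : HasDerivAt S S' t) (hf : HasDerivAt f f' t) (hg : HasDerivAt g g' t) :
    HasDerivAt (fun t => hamSumCore (e t) (S t) (f t) (g t))
      (e' * hamSumCoreDe (e t) (S t) (f t) (g t) + S' * hamSumCoreDS (e t) (f t) (g t)
        + f' * hamSumCoreDf (e t) (S t) (f t) (g t)
        + g' * hamSumCoreDg (e t) (S t) (f t) (g t)) t := by
  have hW := (he.fun_mul hf.cos).const_add 1
  have hb := (hS.const_mul 3).const_sub 2
  have hc := ((hf.const_mul 2).fun_add (hg.const_mul 2)).cos
  have h := (hW.fun_pow 2).fun_mul ((hW.fun_mul (hb.fun_add ((hS.const_mul 3).fun_mul hc))).fun_add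
    hb)
  refine h.congr_deriv ?_
  simp only [hamSumCoreDe, hamSumCoreDS, hamSumCoreDf, hamSumCoreDg]
  norm_num
  ring

/-- The sum of the first-order terms of the main problem and of the quasi-Keplerian
Hamiltonian. -/
def hamSum (μ α : ℝ) (x : Phase) : ℝ := mainCoeff μ α 1 x + quasiOne μ α x

theorem mainCoeff_one_eq {μ : ℝ} (hμ : 0 < μ) (α : ℝ) {x : Phase} (hx : x ∈ domain) :
    mainCoeff μ α 1 x = -(1 / 4) * (x 4 ^ 2 * (α ^ 2 / semilatus μ x ^ 4))
      * ((1 + ecc x * Real.cos (anom x)) ^ 3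
        * (2 - 3 * incl x ^ 2 + 3 * incl x ^ 2 * Real.cos (2 * anom x + 2 * x 1))) := by
  have hG : x 4 ≠ 0 := hx.2.1.ne'
  have hW := one_add_ecc_mul_cos_anom_pos hx
  have h1 : mainCoeff μ α 1 x = -(1 / 4)
    * (μ / (semilatus μ x / (1 + ecc x * Real.cos (anom x))))
    * (α ^ 2 / (semilatus μ x / (1 + ecc x * Real.cos (anom x))) ^ 2)
    * (2 - 3 * incl x ^ 2 + 3 * incl x ^ 2 * Real.cos (2 * (anom x + x 1))) := rfl
  rw [h1, mul_add 2 (anom x)]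
  simp only [semilatus, parameter]
  field_simp

theorem quasiOne_eq {μ : ℝ} (hμ : 0 < μ) (α : ℝ) {x : Phase} (hx : x ∈ domain) :
    quasiOne μ α x = -(1 / 4) * (x 4 ^ 2 * (α ^ 2 / semilatus μ x ^ 4))
      * ((1 + ecc x * Real.cos (anom x)) ^ 2 * (2 - 3 * incl x ^ 2)) := by
  have hG : x 4 ≠ 0 := hx.2.1.ne'
  have hW := one_add_ecc_mul_cos_anom_pos hx
  have h1 : quasiOne μ α x = -(1 / 2)
    * (x 4 ^ 2 / (semilatus μ x / (1 + ecc x * Real.cos (anom x))) ^ 2) * (1 / 2)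
    * (α ^ 2 / semilatus μ x ^ 2) * (2 - 3 * incl x ^ 2) := rfl
  rw [h1]
  simp only [semilatus, parameter]
  field_simp
  ring

theorem hamSum_eq {μ : ℝ} (hμ : 0 < μ) (α : ℝ) {x : Phase} (hx : x ∈ domain) :
    hamSum μ α x = -(1 / 4) * (x 4 ^ 2 * (α ^ 2 / semilatus μ x ^ 4))
      * hamSumCore (ecc x) (incl x ^ 2) (anom x) (x 1) := by
  rw [hamSum, mainCoeff_one_eq hμ α hx, quasiOne_eq hμ α hx, hamSumCore]
  ring

theorem pd_hamSum {μ : ℝ} (hμ : 0 < μ) (α : ℝ) {x : Phase} (hx : x ∈ domain) (i : Fin 6) :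
    pd i (hamSum μ α) x
      = -(1 / 4) * (if i = 4 then -(6 * x 4 * (α ^ 2 / semilatus μ x ^ 4)) else 0)
          * hamSumCore (ecc x) (incl x ^ 2) (anom x) (x 1)
        + -(1 / 4) * (x 4 ^ 2 * (α ^ 2 / semilatus μ x ^ 4))
          * (eta x * etaSlope i x / ecc x
                * hamSumCoreDe (ecc x) (incl x ^ 2) (anom x) (x 1)
              + inclSqSlope i x * hamSumCoreDS (ecc x) (anom x) (x 1)
              + anomSlope i (chart x) * hamSumCoreDf (ecc x) (incl x ^ 2) (anom x) (x 1)
              + (if i = 1 then 1 else 0)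
                * hamSumCoreDg (ecc x) (incl x ^ 2) (anom x) (x 1)) := by
  have h := (((hasDerivAt_secondAmplitude_update hμ α hx i).const_mul (-(1 / 4))).fun_mul
    (hasDerivAt_hamSumCore (hasDerivAt_ecc_update hx i)
      (hasDerivAt_inclSq_update hx i) (hasDerivAt_anom_update hx i)
      (hasDerivAt_coord_update x i 1))).congr_of_eventuallyEq
      (f₁ := fun t : ℝ => hamSum μ α (Function.update x i t)) (by
        filter_upwards [eventually_update (domain_mem_nhds hx) i] with t ht
        exact hamSum_eq hμ α ht)
  rw [pd, h.deriv]
  simp only [Function.update_eq_self]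

/-- The Poisson bracket of `hamSum` and `genOne` in terms of the partial derivatives of their
dimensionless cores. -/
theorem bracket_algebra {G η e W c σ S Y b b₀ Z a u ue uη uS uf ug AS A Ae Ag Af : ℝ} (he : e ≠ 0)
    (hη : η ≠ 0) (hG : G ≠ 0) (heη : e ^ 2 = 1 + η ^ 2) (hcs : σ ^ 2 = 1 - c ^ 2)
    (hW : W = 1 + e * c) (ha : a = W * b + b₀)
    (hA : A = W ^ 2 * a) (hAe : Ae = W * c * (3 * W * b + 2 * b₀))
    (hAS : AS = W ^ 2 * Z) (hAg : Ag = -(6 * S * W ^ 3 * Y))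
    (hAf : Af = -(e * σ * W * (3 * W * b + 2 * b₀)) + Ag) :
    64 * e ^ 3 * η * G *
      (W ^ 2 / η ^ 3 * Af * (η * (η ^ 2 / G) / e * ue + η ^ 2 / G * uη
            + -(σ * (2 + e * c) / η ^ 2 * (η * (η ^ 2 / G) / e)) * uf)
        - (η * (η ^ 2 / G) / e * Ae + -(σ * (2 + e * c) / η ^ 2 * (η * (η ^ 2 / G) / e)) * Af)
          * (W ^ 2 / η ^ 3 * uf)
        + (Ag * (-(3 / G) * u + (η * (η / G) / e * ue + η / G * uη + 2 * (1 - S) / G * uS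
            + -(σ * (2 + e * c) / η ^ 2 * (η * (η / G) / e)) * uf))
          - (-(6 / G) * A + (η * (η / G) / e * Ae + 2 * (1 - S) / G * AS
            + -(σ * (2 + e * c) / η ^ 2 * (η * (η / G) / e)) * Af)) * ug))
      = W ^ 2 * (8 * ((-σ * W * (3 * W * b + 2 * b₀)
            - 6 * S * W * Y * (e + 2 * c + e * c ^ 2)) * (8 * e ^ 3 * η * ue + 8 * e ^ 4 * uη)
          + e ^ 2 * η * W * (-c * (3 * W * b + 2 * b₀) + 6 * S * Y * σ * (2 + e * c)) * (8 * uf)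
          - 6 * S * W * Y * e * η * (-3 * (8 * e ^ 2 * u) + 2 * (1 - S) * (8 * e ^ 2 * uS))
          - η * (-6 * e * a + η ^ 2 * c * b - σ * (2 + e * c) * (-e * σ * b - 6 * S * W * Y)
              + 2 * a * (2 * e - c - e * c ^ 2) + 2 * e * (1 - S) * Z) * (8 * e ^ 2 * ug))) := by
  -- These are the only uses of the two quadratic relations. `r1` merges the direct and the anomaly
  -- contributions of the pair (ℓ, L); `r2` shows that the corresponding contribution of (g, G) is
  -- divisible by W.
  have r1 : W ^ 2 + η ^ 2 = e * (e + 2 * c + e * c ^ 2) := by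
    rw [hW]; linear_combination -heη
  have r2 : η ^ 2 * c + e * σ ^ 2 * (2 + e * c) = W * (2 * e - c - e * c ^ 2) := by
    rw [hW]; linear_combination e * (2 + e * c) * hcs - c * heη
  clear hcs heη
  subst hAf hAS hAe hA ha hAg
  clear hW
  linear_combination (norm := (field_simp; ring))
    (-(6 * S * W ^ 3 * Y) * (64 * e ^ 2 * η * ue + 64 * e ^ 3 * uη)) * r1
      - 64 * e ^ 2 * η * ug * (W * (3 * W * b + 2 * b₀) - W ^ 2 * b) * r2

/-- The energy integral: in Delaunay variables the Kepler Hamiltonian depends on L alone, so that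
its brackets reduce to mean-anomaly derivatives. -/
theorem keplerHam_eq {μ : ℝ} (hμ : 0 < μ) (α : ℝ) {x : Phase} (hx : x ∈ domain) :
    mainCoeff μ α 0 x = μ ^ 2 / (2 * x 3 ^ 2) := by
  have hG : x 4 ≠ 0 := hx.2.1.ne'
  have hL : x 3 ≠ 0 := hx.1.ne
  have hW := one_add_ecc_mul_cos_anom_pos hx
  have h1 : mainCoeff μ α 0 x = 1 / 2
    * ((x 4 / semilatus μ x * (ecc x * Real.sin (anom x))) ^ 2
      + x 4 ^ 2 / (semilatus μ x / (1 + ecc x * Real.cos (anom x))) ^ 2)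
    - μ / (semilatus μ x / (1 + ecc x * Real.cos (anom x))) := rfl
  have h2 : ecc x ^ 2 = 1 + x 4 ^ 2 / x 3 ^ 2 := by
    rw [ecc_sq, eta]; ring
  have h3 : 1 / 2 * ((x 4 / semilatus μ x * (ecc x * Real.sin (anom x))) ^ 2
      + x 4 ^ 2 / (semilatus μ x / (1 + ecc x * Real.cos (anom x))) ^ 2)
    - μ / (semilatus μ x / (1 + ecc x * Real.cos (anom x)))
    = μ ^ 2 / (2 * x 4 ^ 2)
      * (ecc x ^ 2 * (Real.sin (anom x) ^ 2 + Real.cos (anom x) ^ 2) - 1) := by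
    simp only [semilatus, parameter]
    field_simp
    ring
  rw [h1, h3, Real.sin_sq_add_cos_sq, h2]
  field_simp
  ring

/-- The Lie derivative along the Kepler flow. -/
theorem poisson_keplerHam {μ : ℝ} (hμ : 0 < μ) (α : ℝ) (B : Phase → ℝ) {x : Phase}
    (hx : x ∈ domain) :
    poisson (mainCoeff μ α 0) B x = μ ^ 2 / x 3 ^ 3 * pd 0 B x := by
  have hL : x 3 ≠ 0 := hx.1.ne
  rw [poisson_congr_domain (fun x hx => keplerHam_eq hμ α hx) (fun _ _ => rfl) hx]
  have h : ∀ i : Fin 6, pd i (fun x : Phase => μ ^ 2 / (2 * x 3 ^ 2)) x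
      = if i = 3 then -(μ ^ 2 / x 3 ^ 3) else 0 := by
    intro i
    have h := ((hasDerivAt_const (x i) (μ ^ 2)).fun_div
      (((hasDerivAt_coord_update x i 3).fun_pow 2).const_mul 2) (by simpa using hL)).deriv
    rw [pd, h]
    simp only [Function.update_eq_self]
    split_ifs
    · norm_num
      field_simp
    · simp
  simp only [poisson, h]
  simp

theorem pd_zero_genOne {μ : ℝ} (hμ : 0 < μ) (α : ℝ) {x : Phase} (hx : x ∈ domain) :
    pd 0 (genOne μ α) x = x 4 * (α ^ 2 / semilatus μ x ^ 2)
      * ((1 + ecc x * Real.cos (anom x)) ^ 2 / eta x ^ 3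
        * genOneCoreDf (ecc x) (incl x ^ 2) (anom x) (x 1)) := by
  have q1 : ecc (chart x) = ecc x := rfl
  have q2 : eta (chart x) = eta x := rfl
  have q3 : chart x 0 = anom x := by simp [chart]
  rw [pd_genOne hμ α hx]
  simp [etaSlope, inclSqSlope, anomSlope, q1, q2, q3]

theorem lieTriangle_zero_one (F : ℕ → Phase → ℝ) (U V : Phase → ℝ) (x : Phase) :
    lieTriangle F (genSeq U V) 0 1 x = F 1 x + poisson (F 0) U x := by
  simp [lieTriangle, genSeq]

theorem lieTriangle_zero_two (F : ℕ → Phase → ℝ) (U V : Phase → ℝ) (x : Phase) :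
    lieTriangle F (genSeq U V) 0 2 x = F 2 x + (poisson (F 1) U x + poisson (F 0) V x)
      + poisson (lieTriangle F (genSeq U V) 0 1) U x := by
  rw [lieTriangle]
  simp [genSeq, lieTriangle, Finset.sum_range_succ]

/-- The derivative of U₁ along the Kepler flow cancels the excess of M₁₀ over M₀₁. The harmonics f +
2g and 3f + 2g combine by cos(2θ - f) + cos(2θ + f) = 2 cos f cos 2θ, where θ = f + g is the
argument of latitude. -/
theorem lieTriangle_main_one {μ : ℝ} (hμ : 0 < μ) (α : ℝ) (V : Phase → ℝ) {x : Phase}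
    (hx : x ∈ domain) :
    lieTriangle (mainCoeff μ α) (genSeq (genOne μ α) V) 0 1 x = quasiOne μ α x := by
  have hG : x 4 ≠ 0 := hx.2.1.ne'
  have hL : x 3 ≠ 0 := hx.1.ne
  have hμ' := hμ.ne'
  have hη : eta x ≠ 0 := (eta_pos hx).ne'
  have h3 : x 3 = -(x 4 / eta x) := by rw [eta]; field_simp
  rw [lieTriangle_zero_one, poisson_keplerHam hμ α _ hx, pd_zero_genOne hμ α hx,
    mainCoeff_one_eq hμ α hx, quasiOne_eq hμ α hx, h3, genOneCoreDf]
  have t1 : Real.cos (anom x + 2 * x 1) + Real.cos (3 * anom x + 2 * x 1)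
      = 2 * Real.cos (anom x) * Real.cos (2 * (anom x + x 1)) := by
    rw [show anom x + 2 * x 1 = 2 * (anom x + x 1) - anom x by ring,
      show 3 * anom x + 2 * x 1 = 2 * (anom x + x 1) + anom x by ring,
      Real.cos_sub (2 * (anom x + x 1)) (anom x), Real.cos_add (2 * (anom x + x 1)) (anom x)]
    ring
  simp only [semilatus, parameter]
  field_simp
  linear_combination (12 * α ^ 2 * incl x ^ 2 * ecc x * (1 + ecc x * Real.cos (anom x)) ^ 2) * t1

theorem contDiffOn_mainCoeff_one {μ : ℝ} (hμ : 0 < μ) (α : ℝ) :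
    ContDiffOn ℝ ∞ (mainCoeff μ α 1) domain := by
  have hW := contDiffOn_const (c := (1 : ℝ)).add (contDiffOn_ecc.mul
    (Real.contDiff_cos.comp_contDiffOn contDiffOn_anom))
  have hS := contDiffOn_incl.pow 2
  have hc := Real.contDiff_cos.comp_contDiffOn ((contDiffOn_const (c := (2 : ℝ)).mul
    contDiffOn_anom).add (contDiffOn_const (c := (2 : ℝ)).mul (contDiffOn_coord 1)))
  refine ContDiffOn.congr ?_ fun x hx => mainCoeff_one_eq hμ α hx
  exact (contDiffOn_const.mul (((contDiffOn_coord 4).pow 2).mul (contDiffOn_const.div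
    ((contDiffOn_semilatus μ).pow 4) fun _ hx => pow_ne_zero _ (semilatus_pos hμ hx).ne'))).mul
    ((hW.pow 3).mul ((contDiffOn_const.sub (contDiffOn_const.mul hS)).add
      ((contDiffOn_const.mul hS).mul hc)))

theorem contDiffOn_quasiOne {μ : ℝ} (hμ : 0 < μ) (α : ℝ) :
    ContDiffOn ℝ ∞ (quasiOne μ α) domain := by
  have hW := contDiffOn_const (c := (1 : ℝ)).add (contDiffOn_ecc.mul
    (Real.contDiff_cos.comp_contDiffOn contDiffOn_anom))
  have hS := contDiffOn_incl.pow 2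
  refine ContDiffOn.congr ?_ fun x hx => quasiOne_eq hμ α hx
  exact (contDiffOn_const.mul (((contDiffOn_coord 4).pow 2).mul (contDiffOn_const.div
    ((contDiffOn_semilatus μ).pow 4) fun _ hx => pow_ne_zero _ (semilatus_pos hμ hx).ne'))).mul
    ((hW.pow 2).mul (contDiffOn_const.sub (contDiffOn_const.mul hS)))

/-- The two brackets with U₁ in the triangle, of M₁₀ and of M₀₁, add up to one, and M₂₀ = 0. The
generating function `V` enters only through ∂V/∂ℓ, so no regularity of `V` is needed. -/
theorem transformedTwo_eq {μ : ℝ} (hμ : 0 < μ) (α : ℝ) (V : Phase → ℝ) {x : Phase}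
    (hx : x ∈ domain) :
    transformedTwo μ α V x
      = poisson (hamSum μ α) (genOne μ α) x + μ ^ 2 / x 3 ^ 3 * pd 0 V x := by
  have h1 : poisson (lieTriangle (mainCoeff μ α) (genSeq (genOne μ α) V) 0 1) (genOne μ α) x
      = poisson (quasiOne μ α) (genOne μ α) x :=
    poisson_congr_domain (fun y hy => lieTriangle_main_one hμ α V hy) (fun _ _ => rfl) hx
  have h2 : poisson (hamSum μ α) (genOne μ α) x
      = poisson (mainCoeff μ α 1) (genOne μ α) x + poisson (quasiOne μ α) (genOne μ α) x :=
    poisson_add_left _ (differentiableAt_of_contDiffOn (contDiffOn_mainCoeff_one hμ α) hx)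
      (differentiableAt_of_contDiffOn (contDiffOn_quasiOne hμ α) hx)
  have h3 : mainCoeff μ α 2 x = 0 := rfl
  rw [transformedTwo, lieTriangle_zero_two, h1, h2, h3, poisson_keplerHam hμ α V hx]
  ring

/-- The bracket is displayed as an f-derivative plus a remainder: the table sums come from the
periodic part of U₂, `psiCoeff` from the part linear in f, and the last term is what must survive in
M₀₂. -/
theorem poisson_hamSum {μ : ℝ} (hμ : 0 < μ) (α : ℝ) {x : Phase} (hx : x ∈ domain) :
    poisson (hamSum μ α) (genOne μ α) x
      = (x 4 * α ^ 4 / semilatus μ x ^ 6) * x 4 * (1 + ecc x * Real.cos (anom x)) ^ 2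
          / (256 * ecc x ^ 3 * eta x)
        * (tableSumDf 0 (incl x) (ecc x) (eta x) (anom x) 0
          + incl x ^ 2 * tableSumDf 1 (incl x) (ecc x) (eta x) (anom x) (2 * x 1)
          + incl x ^ 4 * tableSumDf 2 (incl x) (ecc x) (eta x) (anom x) (4 * x 1)
          - 256 * ecc x ^ 3 * eta x * psiCoeff x
          - 16 * ecc x ^ 3 * eta x * (21 * incl x ^ 4 - 42 * incl x ^ 2 + 20)) := by
  have hp := (semilatus_pos hμ hx).ne'
  have hG : x 4 ≠ 0 := hx.2.1.ne'
  have hη : eta x ≠ 0 := (eta_pos hx).ne'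
  have he : ecc x ≠ 0 := (ecc_pos x).ne'
  have q1 : ecc (chart x) = ecc x := rfl
  have q2 : eta (chart x) = eta x := rfl
  have q3 : chart x 0 = anom x := by simp [chart]
  have q4 : chart x 4 = x 4 := by simp [chart]
  have hav := averaging_identity (s := incl x) (e := ecc x) (η := eta x) (f := anom x)
    (θ := 2 * anom x + 2 * x 1)
    (E := 8 * ecc x ^ 3 * eta x * genOneCoreDe (ecc x) (eta x) (incl x ^ 2) (anom x) (x 1)
      + 8 * ecc x ^ 4 * genOneCoreDη (ecc x) (eta x) (incl x ^ 2) (x 1))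
    (u := 8 * ecc x ^ 2 * genOneCore (ecc x) (eta x) (incl x ^ 2) (anom x) (x 1))
    (uS := 8 * ecc x ^ 2 * genOneCoreDS (ecc x) (eta x) (anom x) (x 1))
    (uf := 8 * genOneCoreDf (ecc x) (incl x ^ 2) (anom x) (x 1))
    (ug := 8 * ecc x ^ 2 * genOneCoreDg (ecc x) (eta x) (incl x ^ 2) (anom x) (x 1))
    (ecc_sq x) rfl rfl rfl rfl rfl rfl rfl
    (by
      rw [show 2 * anom x + 2 * x 1 - anom x = anom x + 2 * x 1 by ring,
        show anom x + (2 * anom x + 2 * x 1) = 3 * anom x + 2 * x 1 by ring,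
        show 2 * anom x + 2 * x 1 - 2 * anom x = 2 * x 1 by ring, genOneCoreDe, genOneCoreDη]
      have h3 : eta x ^ 3 = eta x * (ecc x ^ 2 - 1) := by rw [ecc_sq]; ring
      have h2 : eta x ^ 2 = ecc x ^ 2 - 1 := by rw [ecc_sq]; ring
      rw [h3, h2]
      field_simp
      linear_combination (16 * incl x ^ 2 * Real.cos (2 * x 1) * (ecc x ^ 2 - 1)) * h2)
    (by
      rw [show 2 * anom x + 2 * x 1 - anom x = anom x + 2 * x 1 by ring,
        show anom x + (2 * anom x + 2 * x 1) = 3 * anom x + 2 * x 1 by ring,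
        show 2 * anom x + 2 * x 1 - 2 * anom x = 2 * x 1 by ring, genOneCore]
      field_simp
      ring)
    (by
      rw [show 2 * anom x + 2 * x 1 - anom x = anom x + 2 * x 1 by ring,
        show anom x + (2 * anom x + 2 * x 1) = 3 * anom x + 2 * x 1 by ring,
        show 2 * anom x + 2 * x 1 - 2 * anom x = 2 * x 1 by ring, genOneCoreDS]
      field_simp
      ring)
    (by
      rw [show 2 * anom x + 2 * x 1 - anom x = anom x + 2 * x 1 by ring,
        show anom x + (2 * anom x + 2 * x 1) = 3 * anom x + 2 * x 1 by ring, genOneCoreDf]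
      ring)
    (by
      rw [show 2 * anom x + 2 * x 1 - anom x = anom x + 2 * x 1 by ring,
        show anom x + (2 * anom x + 2 * x 1) = 3 * anom x + 2 * x 1 by ring,
        show 2 * anom x + 2 * x 1 - 2 * anom x = 2 * x 1 by ring, genOneCoreDg]
      field_simp
      ring)
  rw [show 2 * anom x + 2 * x 1 - ((2 : ℤ) : ℝ) * anom x = 2 * x 1 by push_cast; ring,
    show 2 * (2 * anom x + 2 * x 1) - ((4 : ℤ) : ℝ) * anom x = 4 * x 1 by push_cast; ring,
    show 2 * anom x + 2 * x 1 - 2 * anom x = 2 * x 1 by ring] at hav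
  have hbr := bracket_algebra (G := x 4) (η := eta x) (e := ecc x)
    (W := 1 + ecc x * Real.cos (anom x)) (c := Real.cos (anom x)) (σ := Real.sin (anom x))
    (S := incl x ^ 2) (Y := Real.sin (2 * anom x + 2 * x 1))
    (u := genOneCore (ecc x) (eta x) (incl x ^ 2) (anom x) (x 1))
    (ue := genOneCoreDe (ecc x) (eta x) (incl x ^ 2) (anom x) (x 1))
    (uη := genOneCoreDη (ecc x) (eta x) (incl x ^ 2) (x 1))
    (uS := genOneCoreDS (ecc x) (eta x) (anom x) (x 1))
    (uf := genOneCoreDf (ecc x) (incl x ^ 2) (anom x) (x 1))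
    (ug := genOneCoreDg (ecc x) (eta x) (incl x ^ 2) (anom x) (x 1))
    he hη hG (ecc_sq x) (Real.sin_sq _) rfl rfl
    (A := hamSumCore (ecc x) (incl x ^ 2) (anom x) (x 1)) rfl
    (Ae := hamSumCoreDe (ecc x) (incl x ^ 2) (anom x) (x 1)) rfl
    (AS := hamSumCoreDS (ecc x) (anom x) (x 1)) rfl
    (Ag := hamSumCoreDg (ecc x) (incl x ^ 2) (anom x) (x 1)) rfl
    (Af := hamSumCoreDf (ecc x) (incl x ^ 2) (anom x) (x 1)) rfl
  rw [hav] at hbr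
  have hψ : 12 * ecc x * eta x * ((2 * ecc x ^ 4 * (15 * incl x ^ 2 - 14)
              + 8 * (3 * ecc x ^ 2 - 2) * (5 * incl x ^ 2 - 4)) * incl x ^ 2 * Real.cos (2 * x 1)
            - 16 * eta x ^ 3 * (5 * incl x ^ 2 - 4) * incl x ^ 2 * Real.sin (2 * x 1)
            - ecc x ^ 4 * (5 * incl x ^ 4 + 8 * incl x ^ 2 - 8))
      = 256 * ecc x ^ 3 * eta x * psiCoeff x := by
    rw [psiCoeff]
    field_simp
    ring
  rw [hψ] at hbr
  rw [poisson]
  simp only [pd_hamSum hμ α hx, pd_genOne hμ α hx]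
  simp only [anomSlope, etaSlope, inclSqSlope, q1, q2, q3, q4, if_true, Matrix.cons_val,
    Fin.reduceEq, if_false, mul_zero, zero_mul, zero_div, add_zero, zero_add, sub_zero, zero_sub,
    one_mul]
  generalize genOneCore (ecc x) (eta x) (incl x ^ 2) (anom x) (x 1) = u at *
  generalize genOneCoreDe (ecc x) (eta x) (incl x ^ 2) (anom x) (x 1) = ue at *
  generalize genOneCoreDη (ecc x) (eta x) (incl x ^ 2) (x 1) = uη at *
  generalize genOneCoreDS (ecc x) (eta x) (anom x) (x 1) = uS at *
  generalize genOneCoreDf (ecc x) (incl x ^ 2) (anom x) (x 1) = uf at *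
  generalize genOneCoreDg (ecc x) (eta x) (incl x ^ 2) (anom x) (x 1) = ug at *
  generalize hamSumCore (ecc x) (incl x ^ 2) (anom x) (x 1) = A at *
  generalize hamSumCoreDe (ecc x) (incl x ^ 2) (anom x) (x 1) = Ae at *
  generalize hamSumCoreDS (ecc x) (anom x) (x 1) = AS at *
  generalize hamSumCoreDf (ecc x) (incl x ^ 2) (anom x) (x 1) = Af at *
  generalize hamSumCoreDg (ecc x) (incl x ^ 2) (anom x) (x 1) = Ag at *
  generalize tableSumDf 0 (incl x) (ecc x) (eta x) (anom x) 0 = T0 at *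
  generalize tableSumDf 1 (incl x) (ecc x) (eta x) (anom x) (2 * x 1) = T1 at *
  generalize tableSumDf 2 (incl x) (ecc x) (eta x) (anom x) (4 * x 1) = T2 at *
  clear hav hψ q1 q2 q3 q4
  linear_combination (norm := (field_simp; ring))
    (-(x 4 ^ 2 * α ^ 4 / semilatus μ x ^ 6) / (256 * ecc x ^ 3 * eta x)) * hbr

/-! ### The mean-anomaly derivative of U₂ and the second-order Hamiltonian -/

theorem hasDerivAt_tableSumChart (y : Phase) :
    HasDerivAt (fun t : ℝ => tableSumChart (Function.update y 0 t))
      (tableSumDf 0 (incl y) (ecc y) (eta y) (y 0) 0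
        + incl y ^ 2 * tableSumDf 1 (incl y) (ecc y) (eta y) (y 0) (2 * y 1)
        + incl y ^ 4 * tableSumDf 2 (incl y) (ecc y) (eta y) (y 0) (4 * y 1)) (y 0) := by
  have h : (fun t : ℝ => tableSumChart (Function.update y 0 t)) = fun t : ℝ =>
      ∑ k : Fin 3, incl y ^ (2 * (k : ℕ))
        * tableSum k (incl y) (ecc y) (eta y) t (2 * (k : ℕ) * y 1) := by
    funext t
    have q1 : ecc (Function.update y 0 t) = ecc y := rfl
    have q2 : eta (Function.update y 0 t) = eta y := rfl
    have q3 : incl (Function.update y 0 t) = incl y := rfl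
    simp [tableSumChart, q1, q2, q3]
  rw [h]
  refine (HasDerivAt.fun_sum fun k _ => (hasDerivAt_tableSum k (incl y) (ecc y) (eta y) (y 0)
    (2 * (k : ℕ) * y 1)).const_mul (incl y ^ (2 * (k : ℕ)))).congr_deriv ?_
  rw [Fin.sum_univ_three]
  norm_num

theorem pd_zero_genTwo {μ : ℝ} (hμ : 0 < μ) (α : ℝ) {x : Phase} (hx : x ∈ domain) :
    pd 0 (genTwo μ α) x = (1 + ecc x * Real.cos (anom x)) ^ 2 / eta x ^ 3
      * (-(amplitude μ α x * psiCoeff x) + amplitude μ α x / (256 * ecc x ^ 3 * eta x)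
        * (tableSumDf 0 (incl x) (ecc x) (eta x) (anom x) 0
          + incl x ^ 2 * tableSumDf 1 (incl x) (ecc x) (eta x) (anom x) (2 * x 1)
          + incl x ^ 4 * tableSumDf 2 (incl x) (ecc x) (eta x) (anom x) (4 * x 1))) := by
  have q0 : chart x 0 = anom x := by simp [chart]
  have q1 : chart x 1 = x 1 := by simp [chart]
  have h1 : pd 0 (genTwo μ α) x = pd 0 (fun y => genTwoChart μ α (chart y)) x :=
    pd_congr_domain (fun y _ => genTwo_eq μ α y) hx 0
  have hd := differentiableAt_of_contDiffOn (contDiffOn_genTwoChart hμ α) (chart_mem hx)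
  have h2 : pd 0 (genTwoChart μ α) (chart x) = -(amplitude μ α x * psiCoeff x)
      + amplitude μ α x / (256 * ecc x ^ 3 * eta x)
        * (tableSumDf 0 (incl x) (ecc x) (eta x) (anom x) 0
          + incl x ^ 2 * tableSumDf 1 (incl x) (ecc x) (eta x) (anom x) (2 * x 1)
          + incl x ^ 4 * tableSumDf 2 (incl x) (ecc x) (eta x) (anom x) (4 * x 1)) := by
    have h3 := (((hasDerivAt_id (chart x 0)).const_sub (Real.pi + Real.arctan (eta x))).const_mul
      (amplitude μ α x * psiCoeff x)).fun_add ((hasDerivAt_tableSumChart (chart x)).const_mul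
      (amplitude μ α x / (256 * ecc x ^ 3 * eta x)))
    have h4 : (fun t : ℝ => genTwoChart μ α (Function.update (chart x) 0 t)) = fun t : ℝ =>
        amplitude μ α x * psiCoeff x * (Real.pi + Real.arctan (eta x) - id t)
        + amplitude μ α x / (256 * ecc x ^ 3 * eta x)
          * tableSumChart (Function.update (chart x) 0 t) := by
      funext t
      have q : genTwoChart μ α (Function.update (chart x) 0 t)
        = amplitude μ α x * psiCoeff x
          * (Real.pi + Real.arctan (eta x) - Function.update (chart x) 0 t 0)
        + amplitude μ α x / (256 * ecc x ^ 3 * eta x)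
          * tableSumChart (Function.update (chart x) 0 t) := rfl
      rw [q, Function.update_self]
      rfl
    rw [pd, h4, h3.deriv, q0, q1]
    have q2 : ecc (chart x) = ecc x := rfl
    have q3 : eta (chart x) = eta x := rfl
    have q4 : incl (chart x) = incl x := rfl
    rw [q2, q3, q4]
    ring
  rw [h1, pd_comp_chart hx hd, h2]
  have q2 : ecc (chart x) = ecc x := rfl
  have q3 : eta (chart x) = eta x := rfl
  simp [anomSlope, etaSlope, q0, q2, q3]

/-- With L = -G/η and p = G²/μ, the prefactor of ∂U₂/∂ℓ is minus that of the bracket. Table sums and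
`psiCoeff` cancel, and the quasi-Keplerian coefficient -16/256 = -1/16 is left. -/
theorem transformedTwo_genTwo {μ : ℝ} (hμ : 0 < μ) (α : ℝ) {x : Phase} (hx : x ∈ domain) :
    transformedTwo μ α (genTwo μ α) x = quasiTwo μ α x := by
  have hG : x 4 ≠ 0 := hx.2.1.ne'
  have hη : eta x ≠ 0 := (eta_pos hx).ne'
  have he : ecc x ≠ 0 := (ecc_pos x).ne'
  have hL : x 3 ≠ 0 := hx.1.ne
  have hW := one_add_ecc_mul_cos_anom_pos hx
  have h3 : x 3 = -(x 4 / eta x) := by rw [eta]; field_simp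
  have h1 : quasiTwo μ α x = -(x 4 ^ 2 / (semilatus μ x / (1 + ecc x * Real.cos (anom x))) ^ 2)
    * (α ^ 4 / semilatus μ x ^ 4) * (1 / 16)
    * (21 * incl x ^ 4 - 42 * incl x ^ 2 + 20) := rfl
  rw [transformedTwo_eq hμ α _ hx, poisson_hamSum hμ α hx, pd_zero_genTwo hμ α hx, h1, h3,
    amplitude]
  generalize tableSumDf 0 (incl x) (ecc x) (eta x) (anom x) 0 = T0
  generalize tableSumDf 1 (incl x) (ecc x) (eta x) (anom x) (2 * x 1) = T1
  generalize tableSumDf 2 (incl x) (ecc x) (eta x) (anom x) (4 * x 1) = T2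
  generalize psiCoeff x = Z
  simp only [semilatus, parameter]
  field_simp
  ring

/-! ### The integration constants -/

/-- The constant collects (π + arctan η)Ψ and the terms j = 0. Its g-dependent part is A₀. The rest
splits into its value A₂ at s = 1, that is H = 0, and a multiple A₁ of 1 - s² = (H/G)². -/
theorem genTwo_eq_anomalistic_add (μ α : ℝ) {x : Phase} (hx : x ∈ domain) :
    genTwo μ α x = genTwoAnomalistic μ α x
      + (partZero μ α x + partOne μ α x + partTwo μ α x) := by
  have hη : eta x ≠ 0 := (eta_pos hx).ne'
  have he : ecc x ≠ 0 := (ecc_pos x).ne'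
  have hc0 : cosTerm 0 0 x = 2 * (255 * incl x ^ 4 - 576 * incl x ^ 2 + 272) * ecc x ^ 3
      + 6 * (11 * incl x ^ 4 + 64 * incl x ^ 2 - 48) * ecc x ^ 5 := by
    simp [cosTerm, Finset.sum_range_succ, qTable]
  have hc1 : cosTerm 1 0 x = (16 * (incl x ^ 2 + 6) * ecc x
      + 8 * (149 * incl x ^ 2 - 142) * ecc x ^ 3
      - 4 * (329 * incl x ^ 2 - 278) * ecc x ^ 5) * Real.cos (2 * x 1) := by
    simp [cosTerm, Finset.sum_range_succ, qTable]
    norm_cast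
    ring
  have hc2 : cosTerm 2 0 x = 6 * ecc x * (ecc x ^ 2 + 8) * eta x ^ 2 * Real.cos (4 * x 1) := by
    have h2 : eta x ^ 2 = ecc x ^ 2 - 1 := by rw [ecc_sq]; ring
    rw [h2]
    simp [cosTerm, Finset.sum_range_succ, qTable]
    norm_num
    norm_cast
    ring
  have hs0 : sinTerm 0 0 x = 0 := by simp [sinTerm]
  have hs1 : sinTerm 1 0 x = (-16 * (incl x ^ 2 + 6) * ecc x
      - 16 * (75 * incl x ^ 2 - 68) * ecc x ^ 3
      - 6 * (17 * incl x ^ 2 - 18) * ecc x ^ 5) * Real.sin (2 * x 1) := by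
    simp [sinTerm, Finset.sum_range_succ, pTable]
    norm_cast
    ring
  have hs2 : sinTerm 2 0 x = (48 * ecc x - 18 * ecc x ^ 3 - 9 * ecc x ^ 5)
      * Real.sin (4 * x 1) := by
    simp [sinTerm, Finset.sum_range_succ, pTable]
    norm_num
    norm_cast
    ring
  have hm : ∀ k : Fin 3, (0 : ℤ) ∈ Finset.Icc (jLow k) 5
      ∧ (0 : ℤ) ∈ Finset.Icc (jLow k) (jHigh k) := by decide
  simp only [genTwo, genTwoAnomalistic, Finset.sum_erase_eq_sub (hm _).1,
    Finset.sum_erase_eq_sub (hm _).2, Fin.sum_univ_three]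
  rw [hc0, hc1, hc2, hs0, hs1, hs2, psi, partZero, partOne, partTwo]
  generalize ∑ j ∈ Finset.Icc (jLow 0) 5, cosTerm 0 j x = A0
  generalize ∑ j ∈ Finset.Icc (jLow 1) 5, cosTerm 1 j x = A1
  generalize ∑ j ∈ Finset.Icc (jLow 2) 5, cosTerm 2 j x = A2
  generalize ∑ j ∈ Finset.Icc (jLow 0) (jHigh 0), sinTerm 0 j x = B0
  generalize ∑ j ∈ Finset.Icc (jLow 1) (jHigh 1), sinTerm 1 j x = B1
  generalize ∑ j ∈ Finset.Icc (jLow 2) (jHigh 2), sinTerm 2 j x = B2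
  rw [psiCoeff]
  norm_num
  field_simp
  ring

/-! ### Functions that do not depend on some of the Delaunay variables -/

theorem convex_domain : Convex ℝ domain := by
  intro x hx y hy a b ha hb hab
  obtain ⟨hx3, hx4, hx5⟩ := hx
  obtain ⟨hy3, hy4, hy5⟩ := hy
  rw [abs_lt] at hx5 hy5
  change a * x 3 + b * y 3 < 0 ∧ 0 < a * x 4 + b * y 4
    ∧ |a * x 5 + b * y 5| < a * x 4 + b * y 4
  rw [abs_lt]
  -- The inequalities of the domain are strict, so one positive weight is needed; a zero weight is
  -- treated apart.
  obtain rfl | ha' := ha.eq_or_lt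
  · obtain rfl : b = 1 := by linarith
    simpa using ⟨hy3, hy4, hy5⟩
  · refine ⟨?_, ?_, ?_, ?_⟩ <;> nlinarith

/-- The mean value theorem on the segment from `x` to `y`, which stays in the convex domain: each
coordinate contributes zero, because of a zero increment or a zero partial derivative. -/
theorem eq_of_pd_eq_zero {W : Phase → ℝ} (hW : DifferentiableOn ℝ W domain) {x y : Phase}
    (hx : x ∈ domain) (hy : y ∈ domain) (h : ∀ i, x i = y i ∨ ∀ z ∈ domain, pd i W z = 0) :
    W x = W y := by
  obtain ⟨z, hz, h1⟩ := domain_mvt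
    (fun z hz => ((hW z hz).differentiableAt (domain_mem_nhds hz)).hasFDerivAt.hasFDerivWithinAt)
    convex_domain hx hy
  have hzD : z ∈ domain := convex_domain.segment_subset hx hy hz
  have hd := (hW z hzD).differentiableAt (domain_mem_nhds hzD)
  have h2 : fderiv ℝ W z (y - x) = 0 := by
    rw [← ContinuousLinearMap.coe_coe, LinearMap.pi_apply_eq_sum_univ]
    refine Finset.sum_eq_zero fun i _ => ?_
    obtain hi | hi := h i
    · simp [hi]
    · have h3 := hi z hzD
      rw [pd_eq_fderiv i hd] at h3
      have h4 : (fun j => if i = j then (1 : ℝ) else 0) = Pi.single i 1 := by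
        ext j
        simp [Pi.single_apply, eq_comm]
      rw [ContinuousLinearMap.coe_coe, h4, h3, smul_zero]
  linarith

theorem pd_eq_zero_of_eq {W K : Phase → ℝ} (h : ∀ x ∈ domain, W x = K x) {i : Fin 6}
    (hK : ∀ x t, K (Function.update x i t) = K x) {x : Phase} (hx : x ∈ domain) :
    pd i W x = 0 := by
  rw [pd_congr_domain h hx]
  simp [pd, hK]

/-- If W is free of ℓ then so are all its partial derivatives. In the limit of {ξ, W} only the
derivatives of ξ move, and continuity of the derivatives of W is not required. -/
theorem pd_update_zero {W : Phase → ℝ} (hW : DifferentiableOn ℝ W domain)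
    (h0 : ∀ x ∈ domain, pd 0 W x = 0) (i : Fin 6) {x : Phase} (hx : x ∈ domain) (l : ℝ) :
    pd i W (Function.update x 0 l) = pd i W x := by
  by_cases hi : i = 0
  · subst hi
    rw [h0 _ hx, h0 _ (update_zero_mem_domain.2 hx)]
  · have h1 : (fun t : ℝ => W (Function.update (Function.update x 0 l) i t)) =ᶠ[𝓝 (x i)]
        fun t : ℝ => W (Function.update x i t) := by
      filter_upwards [eventually_update (domain_mem_nhds hx) i] with t ht
      rw [Function.update_comm (Ne.symm hi)]
      refine eq_of_pd_eq_zero hW (update_zero_mem_domain.2 ht) ht fun j => ?_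
      by_cases hj : j = 0
      · subst hj; exact Or.inr h0
      · exact Or.inl (by simp [hj])
    rw [pd, Function.update_of_ne hi]
    exact h1.deriv_eq

/-! ### The change of the corrections under a change of the generating function -/

/-- The second-order generating function occurs linearly, in a single bracket with the polar
variable itself. -/
theorem corrTwo_eq_add {μ : ℝ} (hμ : 0 < μ) (α : ℝ) {V W : Phase → ℝ}
    (hW : DifferentiableOn ℝ W domain) (h : ∀ x ∈ domain, V x = genTwo μ α x + W x) (i : Fin 6)
    {x : Phase} (hx : x ∈ domain) :
    corrTwo μ α V i x = corrTwo μ α (genTwo μ α) i x + poisson (polar μ i) W x := by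
  have h1 : poisson (polar μ i) V x
      = poisson (polar μ i) (genTwo μ α) x + poisson (polar μ i) W x := by
    rw [poisson_congr_domain (A' := polar μ i) (fun _ _ => rfl) h hx]
    exact poisson_add_right _
      (differentiableAt_of_contDiffOn (isNull_genTwo hμ α).isRegular.contDiffOn hx)
      ((hW x hx).differentiableAt (domain_mem_nhds hx))
  rw [corrTwo, corrTwo, lieTriangle_constSeq_two, lieTriangle_constSeq_two, h1, add_assoc]

theorem vanishesAtInfinity_corrTwo_iff {μ : ℝ} (hμ : 0 < μ) (α : ℝ) {V W : Phase → ℝ}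
    (hW : DifferentiableOn ℝ W domain) (h : ∀ x ∈ domain, V x = genTwo μ α x + W x) (i : Fin 6) :
    VanishesAtInfinity (corrTwo μ α V i) ↔ VanishesAtInfinity (poisson (polar μ i) W) := by
  refine forall₂_congr fun x hx => ?_
  have h1 := (isNull_corrTwo hμ α (isNull_genTwo hμ α) i).vanishesAtInfinity x hx
  have h2 : ∀ l : ℝ, corrTwo μ α V i (Function.update x 0 l)
      = corrTwo μ α (genTwo μ α) i (Function.update x 0 l)
        + poisson (polar μ i) W (Function.update x 0 l) :=
    fun l => corrTwo_eq_add hμ α hW h i (update_zero_mem_domain.2 hx)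
  simp only [h2]
  refine ⟨fun h3 => ?_, fun h3 => by simpa using h1.add h3⟩
  simpa using h3.sub h1

/-- A bracket with a limit at infinity that is a non-zero multiple of a quantity free of the mean
anomaly vanishes at infinity only if this quantity does. -/
theorem vanishesAtInfinity_iff_of_tendsto {F c K : Phase → ℝ} (hc : ∀ x ∈ domain, c x ≠ 0)
    (h : ∀ x ∈ domain,
      Tendsto (fun l : ℝ => F (Function.update x 0 l)) atBot (𝓝 (c x * K x))) :
    VanishesAtInfinity F ↔ ∀ x ∈ domain, K x = 0 := by
  refine forall₂_congr fun x hx => ⟨fun h1 => ?_, fun h1 => ?_⟩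
  · exact (mul_eq_zero.1 (tendsto_nhds_unique (h x hx) h1)).resolve_left (hc x hx)
  · simpa [h1] using h x hx

theorem pd_coord (i j : Fin 6) (x : Phase) :
    pd i (fun x => x j) x = if i = j then 1 else 0 := by
  rw [pd]
  by_cases h : i = j
  · subst h; simp
  · simp [h, Ne.symm h]

/-! ### Limits at infinity of the brackets of the polar variables with a function free of ℓ -/

section

variable {μ : ℝ} {W : Phase → ℝ}

theorem vanishesAtInfinity_poisson_angularMomentum (μ : ℝ) (hW : DifferentiableOn ℝ W domain)
    (h0 : ∀ x ∈ domain, pd 0 W x = 0) :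
    VanishesAtInfinity (poisson (polar μ 4) W) ↔ ∀ x ∈ domain, pd 1 W x = 0 := by
  refine vanishesAtInfinity_iff_of_tendsto (c := fun _ => -1) (fun _ _ => by norm_num)
    fun x hx => ?_
  refine tendsto_const_nhds.congr fun l => ?_
  rw [← pd_update_zero hW h0 1 hx l, poisson, show polar μ 4 = fun x => x 4 from rfl]
  simp [pd_coord]

theorem vanishesAtInfinity_poisson_polarMomentum (μ : ℝ) (hW : DifferentiableOn ℝ W domain)
    (h0 : ∀ x ∈ domain, pd 0 W x = 0) :
    VanishesAtInfinity (poisson (polar μ 5) W) ↔ ∀ x ∈ domain, pd 2 W x = 0 := by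
  refine vanishesAtInfinity_iff_of_tendsto (c := fun _ => -1) (fun _ _ => by norm_num)
    fun x hx => ?_
  refine tendsto_const_nhds.congr fun l => ?_
  rw [← pd_update_zero hW h0 2 hx l, poisson, show polar μ 5 = fun x => x 5 from rfl]
  simp [pd_coord]

theorem vanishesAtInfinity_poisson_node (μ : ℝ) (hW : DifferentiableOn ℝ W domain)
    (h0 : ∀ x ∈ domain, pd 0 W x = 0) :
    VanishesAtInfinity (poisson (polar μ 2) W) ↔ ∀ x ∈ domain, pd 5 W x = 0 := by
  refine vanishesAtInfinity_iff_of_tendsto (c := fun _ => 1) (fun _ _ => by norm_num)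
    fun x hx => ?_
  refine tendsto_const_nhds.congr fun l => ?_
  rw [← pd_update_zero hW h0 5 hx l, poisson, show polar μ 2 = fun x => x 2 from rfl]
  simp [pd_coord]

/-- The bracket is ∂θ/∂ℓ ∂W/∂L + ∂W/∂G, and ∂θ/∂ℓ tends to zero: the dependence of W on L remains
invisible to θ. -/
theorem vanishesAtInfinity_poisson_latitude (hμ : 0 < μ) (hW : DifferentiableOn ℝ W domain)
    (h0 : ∀ x ∈ domain, pd 0 W x = 0) (h1 : ∀ x ∈ domain, pd 1 W x = 0)
    (h2 : ∀ x ∈ domain, pd 2 W x = 0) (h5 : ∀ x ∈ domain, pd 5 W x = 0) :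
    VanishesAtInfinity (poisson (polar μ 1) W) ↔ ∀ x ∈ domain, pd 4 W x = 0 := by
  refine vanishesAtInfinity_iff_of_tendsto (c := fun _ => 1) (fun _ _ => by norm_num)
    fun x hx => ?_
  have hn := (isRegular_polar hμ (i := 1) (by decide)).pd_zero.vanishesAtInfinity x hx
  have hl := (hn.mul_const (pd 3 W x)).add_const (pd 4 W x)
  rw [zero_mul, zero_add, ← one_mul (pd 4 W x)] at hl
  refine hl.congr fun l => ?_
  have hy : Function.update x 0 l ∈ domain := update_zero_mem_domain.2 hx
  have h3 : ∀ y, pd 1 (polar μ 1) y = 1 := fun y => by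
    have : (fun t : ℝ => polar μ 1 (Function.update y 1 t)) = fun t => anom y + t := by
      funext t; rfl
    rw [pd, this]
    simp
  rw [← pd_update_zero hW h0 3 hx l, ← pd_update_zero hW h0 4 hx l, poisson, h0 _ hy, h1 _ hy,
    h2 _ hy, h5 _ hy, h3]
  ring

/-- Only ∂r/∂ℓ ∂W/∂L is left, and ∂r/∂ℓ tends to -p/η² ≠ 0. The radius is therefore the variable
that detects the dependence of W on L. -/
theorem vanishesAtInfinity_poisson_radius (hμ : 0 < μ) (hW : DifferentiableOn ℝ W domain)
    (h0 : ∀ x ∈ domain, pd 0 W x = 0) (h1 : ∀ x ∈ domain, pd 1 W x = 0)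
    (h2 : ∀ x ∈ domain, pd 2 W x = 0) (h4 : ∀ x ∈ domain, pd 4 W x = 0)
    (h5 : ∀ x ∈ domain, pd 5 W x = 0) :
    VanishesAtInfinity (poisson (polar μ 0) W) ↔ ∀ x ∈ domain, pd 3 W x = 0 := by
  refine vanishesAtInfinity_iff_of_tendsto (c := fun x => -(semilatus μ x / eta x ^ 2))
    (fun x hx => neg_ne_zero.2 (div_ne_zero (semilatus_pos hμ hx).ne'
      (pow_ne_zero _ (eta_pos hx).ne'))) fun x hx => ?_
  have hl := (tendsto_of_eq_comp_chart
    (Φ := fun y => semilatus μ y * ecc y * Real.sin (y 0) / eta y ^ 3)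
    ((((contDiffOn_semilatus μ).mul contDiffOn_ecc).mul contDiffOn_trig_f.2).div
      (contDiffOn_eta.pow 3) fun _ hx => pow_ne_zero _ (eta_pos hx).ne')
    (fun _ hx => pd_radius_zero μ hx) hx).mul_const (pd 3 W x)
  have h3 : semilatus μ (asymptote x) * ecc (asymptote x) * Real.sin (asymptote x 0)
      / eta (asymptote x) ^ 3 = -(semilatus μ x / eta x ^ 2) := by
    have q1 : ecc (asymptote x) = ecc x := rfl
    have q2 : eta (asymptote x) = eta x := rfl
    have q3 : semilatus μ (asymptote x) = semilatus μ x := rfl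
    have he := (ecc_pos x).ne'
    have hη := (eta_pos hx).ne'
    rw [sin_asymptote, q1, q2, q3]
    field_simp
  rw [h3] at hl
  refine hl.congr fun l => ?_
  have hy : Function.update x 0 l ∈ domain := update_zero_mem_domain.2 hx
  rw [← pd_update_zero hW h0 3 hx l, poisson, h0 _ hy, h1 _ hy, h2 _ hy, h4 _ hy, h5 _ hy]
  ring

/-- The radial velocity at infinity is μ/L, free of G; the difference R - μ/L is null and has the
same G-derivative as R. -/
theorem isNull_pd_radialVelocity_four (hμ : 0 < μ) : IsNull (pd 4 (polar μ 3)) := by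
  have h1 : IsNull fun x => polar μ 3 x - μ / x 3 := by
    refine ⟨fun y => y 4 / semilatus μ y * (ecc y * Real.sin (y 0)) - μ / y 3, ?_,
      fun x _ => ?_, fun x hx => ?_⟩
    · exact (((contDiffOn_coord 4).div (contDiffOn_semilatus μ)
        fun _ hx => (semilatus_pos hμ hx).ne').mul (contDiffOn_ecc.mul contDiffOn_trig_f.2)).sub
        (contDiffOn_const.div (contDiffOn_coord 3) fun _ hx => hx.1.ne)
    · simp [polar, chart]
      rfl
    · have q1 : ecc (asymptote x) = ecc x := rfl
      have q3 : semilatus μ (asymptote x) = semilatus μ x := rfl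
      have q4 : asymptote x 4 = x 4 := rfl
      have q5 : asymptote x 3 = x 3 := rfl
      have he := (ecc_pos x).ne'
      have hL := hx.1.ne
      have hG := hx.2.1.ne'
      beta_reduce
      rw [sin_asymptote, q1, q3, q4, q5, mul_div_cancel₀ _ he, semilatus, parameter, eta]
      field_simp
      ring
  have h2 : ContDiffOn ℝ ∞ (fun x : Phase => μ / x 3) domain :=
    contDiffOn_const.div (contDiffOn_coord 3) fun _ hx => hx.1.ne
  refine (h1.pd 4).congr fun x hx => ?_
  have h3 := pd_add (differentiableAt_of_contDiffOn h1.isRegular.contDiffOn hx)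
    (differentiableAt_of_contDiffOn h2 hx) 4
  have h4 : pd 4 (fun x : Phase => μ / x 3) x = 0 := by simp [pd]
  rw [h4, add_zero] at h3
  simpa using h3

/-- Two products survive, with factors ∂R/∂ℓ and ∂R/∂G, and both factors vanish at infinity. Hence R
imposes no condition on W. -/
theorem vanishesAtInfinity_poisson_radialVelocity (hμ : 0 < μ)
    (hW : DifferentiableOn ℝ W domain) (h0 : ∀ x ∈ domain, pd 0 W x = 0) :
    VanishesAtInfinity (poisson (polar μ 3) W) := by
  intro x hx
  have hl := (((isRegular_polar hμ (i := 3) (by decide)).pd_zero.vanishesAtInfinity x hx).mul_const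
    (pd 3 W x)).sub (((isNull_pd_radialVelocity_four hμ).vanishesAtInfinity x hx).mul_const
    (pd 1 W x))
  rw [zero_mul, zero_mul, sub_zero] at hl
  refine hl.congr fun l => ?_
  have hy : Function.update x 0 l ∈ domain := update_zero_mem_domain.2 hx
  have h1 : pd 1 (polar μ 3) (Function.update x 0 l) = 0 :=
    pd_eq_zero_of_eq (fun _ _ => rfl) (fun _ _ => rfl) hy
  have h2 : pd 2 (polar μ 3) (Function.update x 0 l) = 0 :=
    pd_eq_zero_of_eq (fun _ _ => rfl) (fun _ _ => rfl) hy
  have h5 : pd 5 (polar μ 3) (Function.update x 0 l) = 0 :=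
    pd_eq_zero_of_eq (fun _ _ => rfl) (fun _ _ => rfl) hy
  rw [← pd_update_zero hW h0 3 hx l, ← pd_update_zero hW h0 1 hx l, poisson, h0 _ hy, h1, h2, h5]
  ring

theorem transformedTwo_eq_quasiTwo_iff (hμ : 0 < μ) (α : ℝ) {V : Phase → ℝ}
    (hW : DifferentiableOn ℝ W domain) (h : ∀ x ∈ domain, V x = genTwo μ α x + W x) :
    (∀ x ∈ domain, transformedTwo μ α V x = quasiTwo μ α x) ↔ ∀ x ∈ domain, pd 0 W x = 0 := by
  refine forall₂_congr fun x hx => ?_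
  have h1 : pd 0 V x = pd 0 (genTwo μ α) x + pd 0 W x := by
    rw [pd_congr_domain h hx]
    exact pd_add (differentiableAt_of_contDiffOn (isNull_genTwo hμ α).isRegular.contDiffOn hx)
      ((hW x hx).differentiableAt (domain_mem_nhds hx)) 0
  have h2 : transformedTwo μ α V x
      = transformedTwo μ α (genTwo μ α) x + μ ^ 2 / x 3 ^ 3 * pd 0 W x := by
    rw [transformedTwo_eq hμ α _ hx, transformedTwo_eq hμ α _ hx, h1]
    ring
  have h3 : μ ^ 2 / x 3 ^ 3 ≠ 0 := div_ne_zero (pow_ne_zero _ hμ.ne') (pow_ne_zero _ hx.1.ne)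
  rw [h2, transformedTwo_genTwo hμ α hx]
  simp [h3]

end

end HypJ2

end

/-! ### Assembly of the claims -/

theorem mainTheorem2 (μ α : ℝ) (hμ : 0 < μ) (hα : 0 < α) :
    -- all the functions involved are smooth on the phase space
    (∀ i : Fin 6, ContDiffOn ℝ ∞ (HypJ2.polar μ i) HypJ2.domain) ∧
    ContDiffOn ℝ ∞ (HypJ2.genOne μ α) HypJ2.domain ∧
    ContDiffOn ℝ ∞ (HypJ2.genTwo μ α) HypJ2.domain ∧
    -- the Lie transformation yields the quasi-Keplerian Hamiltonian
    (∀ x ∈ HypJ2.domain,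
      HypJ2.lieTriangle (HypJ2.mainCoeff μ α)
        (HypJ2.genSeq (HypJ2.genOne μ α) (HypJ2.genTwo μ α)) 0 1 x = HypJ2.quasiOne μ α x) ∧
    (∀ x ∈ HypJ2.domain,
      HypJ2.transformedTwo μ α (HypJ2.genTwo μ α) x = HypJ2.quasiTwo μ α x) ∧
    -- the second-order corrections to all the polar variables vanish at infinity
    (∀ i : Fin 6, HypJ2.VanishesAtInfinity (HypJ2.corrTwo μ α (HypJ2.genTwo μ α) i)) ∧
    -- `U₂` is the integral in the true anomaly plus the integration constant
    (∀ x ∈ HypJ2.domain,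
      HypJ2.genTwo μ α x = HypJ2.genTwoAnomalistic μ α x
        + (HypJ2.partZero μ α x + HypJ2.partOne μ α x + HypJ2.partTwo μ α x)) ∧
    -- the integration constants are determined by the boundary conditions
    (∀ V : HypJ2.Phase → ℝ, DifferentiableOn ℝ V HypJ2.domain →
      ((∀ x ∈ HypJ2.domain, HypJ2.transformedTwo μ α V x = HypJ2.quasiTwo μ α x) ↔
        ∃ Q₀ : ℝ → ℝ → ℝ → ℝ → ℝ → ℝ, ∀ x ∈ HypJ2.domain,
          V x = HypJ2.genTwoAnomalistic μ α x + Q₀ (x 1) (x 2) (x 3) (x 4) (x 5)) ∧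
      ((∀ x ∈ HypJ2.domain, HypJ2.transformedTwo μ α V x = HypJ2.quasiTwo μ α x) →
        HypJ2.VanishesAtInfinity (HypJ2.corrTwo μ α V 3) ∧
        ((HypJ2.VanishesAtInfinity (HypJ2.corrTwo μ α V 4) ∧
            HypJ2.VanishesAtInfinity (HypJ2.corrTwo μ α V 5)) ↔
          ∃ Q₁ : ℝ → ℝ → ℝ → ℝ, ∀ x ∈ HypJ2.domain,
            V x = HypJ2.genTwoAnomalistic μ α x
              + (HypJ2.partZero μ α x + Q₁ (x 3) (x 4) (x 5))) ∧
        ((HypJ2.VanishesAtInfinity (HypJ2.corrTwo μ α V 4) ∧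
            HypJ2.VanishesAtInfinity (HypJ2.corrTwo μ α V 5) ∧
            HypJ2.VanishesAtInfinity (HypJ2.corrTwo μ α V 2)) ↔
          ∃ Q₂ : ℝ → ℝ → ℝ, ∀ x ∈ HypJ2.domain,
            V x = HypJ2.genTwoAnomalistic μ α x
              + (HypJ2.partZero μ α x + HypJ2.partOne μ α x + Q₂ (x 3) (x 4))) ∧
        ((HypJ2.VanishesAtInfinity (HypJ2.corrTwo μ α V 4) ∧
            HypJ2.VanishesAtInfinity (HypJ2.corrTwo μ α V 5) ∧
            HypJ2.VanishesAtInfinity (HypJ2.corrTwo μ α V 2) ∧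
            HypJ2.VanishesAtInfinity (HypJ2.corrTwo μ α V 1)) ↔
          ∃ Q₃ : ℝ → ℝ, ∀ x ∈ HypJ2.domain,
            V x = HypJ2.genTwo μ α x + Q₃ (x 3)) ∧
        ((∀ i : Fin 6, HypJ2.VanishesAtInfinity (HypJ2.corrTwo μ α V i)) ↔
          ∃ q : ℝ, ∀ x ∈ HypJ2.domain, V x = HypJ2.genTwo μ α x + q))) := by
  open HypJ2 in
  have hsm : ContDiffOn ℝ ∞ (genTwo μ α) domain := (isNull_genTwo hμ α).isRegular.contDiffOn
  refine ⟨HypJ2.contDiffOn_polar hμ, (HypJ2.isNull_genOne hμ α).isRegular.contDiffOn, hsm,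
    fun x hx => HypJ2.lieTriangle_main_one hμ α _ hx,
    fun x hx => HypJ2.transformedTwo_genTwo hμ α hx,
    fun i => (HypJ2.isNull_corrTwo hμ α (HypJ2.isNull_genTwo hμ α) i).vanishesAtInfinity,
    fun x hx => HypJ2.genTwo_eq_anomalistic_add μ α hx, fun V hV => ?_⟩
  open HypJ2 in
  -- All equivalences are conditions on the difference W = V - U₂.
  obtain ⟨W, hW, h⟩ : ∃ W : Phase → ℝ, DifferentiableOn ℝ W domain ∧
      ∀ x ∈ domain, V x = genTwo μ α x + W x :=
    ⟨fun x => V x - genTwo μ α x, hV.sub (hsm.differentiableOn (by simp)), fun x _ => by ring⟩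
  have h' : ∀ x ∈ HypJ2.domain, V x = HypJ2.genTwoAnomalistic μ α x
      + (HypJ2.partZero μ α x + HypJ2.partOne μ α x + HypJ2.partTwo μ α x) + W x :=
    fun x hx => by rw [h x hx, HypJ2.genTwo_eq_anomalistic_add μ α hx]
  rw [HypJ2.transformedTwo_eq_quasiTwo_iff hμ α hW h]
  simp only [HypJ2.vanishesAtInfinity_corrTwo_iff hμ α hW h]
  open HypJ2 in
  have hind : ∀ {K : Phase → ℝ}, (∀ x ∈ domain, W x = K x) → ∀ i : Fin 6,
      (∀ x t, K (Function.update x i t) = K x) → ∀ x ∈ domain, pd i W x = 0 :=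
    fun hK i hi x hx => pd_eq_zero_of_eq hK hi hx
  refine ⟨⟨fun h0 => ?_, fun ⟨Q, hQ⟩ => ?_⟩, fun h0 => ?_⟩
  · refine ⟨fun g h L G H => HypJ2.partZero μ α ![0, g, h, L, G, H]
      + HypJ2.partOne μ α ![0, g, h, L, G, H] + HypJ2.partTwo μ α ![0, g, h, L, G, H]
      + W ![0, g, h, L, G, H], fun x hx => ?_⟩
    -- The witnesses are values at a base point in the variables on which W does not depend. `hx`
    -- also serves as membership of the new point, since the domain reads only slots 3, 4, 5.
    have h1 : W x = W ![0, x 1, x 2, x 3, x 4, x 5] :=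
      HypJ2.eq_of_pd_eq_zero hW hx hx fun i => by
        fin_cases i
        · exact Or.inr h0
        all_goals exact Or.inl rfl
    rw [h' x hx, h1, add_assoc]
    rfl
  · refine hind (K := fun x => Q (x 1) (x 2) (x 3) (x 4) (x 5) - (HypJ2.partZero μ α x
      + HypJ2.partOne μ α x + HypJ2.partTwo μ α x)) (fun x hx => ?_) 0 fun x t => rfl
    linarith [h' x hx, hQ x hx]
  rw [HypJ2.vanishesAtInfinity_poisson_angularMomentum μ hW h0,
    HypJ2.vanishesAtInfinity_poisson_polarMomentum μ hW h0,
    HypJ2.vanishesAtInfinity_poisson_node μ hW h0]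
  refine ⟨HypJ2.vanishesAtInfinity_poisson_radialVelocity hμ hW h0, ⟨fun ⟨h1, h2⟩ => ?_,
    fun ⟨Q, hQ⟩ => ?_⟩, ⟨fun ⟨h1, h2, h5⟩ => ?_, fun ⟨Q, hQ⟩ => ?_⟩,
    ⟨fun ⟨h1, h2, h5, h6⟩ => ?_, fun ⟨Q, hQ⟩ => ?_⟩, ⟨fun hall => ?_, fun ⟨q, hq⟩ => ?_⟩⟩
  · refine ⟨fun L G H => HypJ2.partOne μ α ![0, 0, 0, L, G, H]
      + HypJ2.partTwo μ α ![0, 0, 0, L, G, H] + W ![0, 0, 0, L, G, H], fun x hx => ?_⟩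
    have h3 : W x = W ![0, 0, 0, x 3, x 4, x 5] :=
      HypJ2.eq_of_pd_eq_zero hW hx hx fun i => by
        fin_cases i
        · exact Or.inr h0
        · exact Or.inr h1
        · exact Or.inr h2
        all_goals exact Or.inl rfl
    have e1 : HypJ2.partOne μ α ![0, 0, 0, x 3, x 4, x 5] = HypJ2.partOne μ α x := rfl
    have e2 : HypJ2.partTwo μ α ![0, 0, 0, x 3, x 4, x 5] = HypJ2.partTwo μ α x := rfl
    beta_reduce
    rw [h' x hx, h3, e1, e2]
    ring
  · have hK : ∀ x ∈ HypJ2.domain, W x = Q (x 3) (x 4) (x 5) - (HypJ2.partOne μ α x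
        + HypJ2.partTwo μ α x) := fun x hx => by linarith [h' x hx, hQ x hx]
    exact ⟨hind hK 1 fun x t => rfl, hind hK 2 fun x t => rfl⟩
  · refine ⟨fun L G => HypJ2.partTwo μ α ![0, 0, 0, L, G, 0] + W ![0, 0, 0, L, G, 0],
      fun x hx => ?_⟩
    -- H = 0 is admissible for every G > 0, so it can serve as base point for H.
    have h3 : W x = W ![0, 0, 0, x 3, x 4, 0] :=
      HypJ2.eq_of_pd_eq_zero hW hx ⟨hx.1, hx.2.1, by simpa using hx.2.1⟩ fun i => by
        fin_cases i
        · exact Or.inr h0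
        · exact Or.inr h1
        · exact Or.inr h2
        · exact Or.inl rfl
        · exact Or.inl rfl
        · exact Or.inr h5
    have e2 : HypJ2.partTwo μ α ![0, 0, 0, x 3, x 4, 0] = HypJ2.partTwo μ α x := rfl
    beta_reduce
    rw [h' x hx, h3, e2]
    ring
  · have hK : ∀ x ∈ HypJ2.domain, W x = Q (x 3) (x 4) - HypJ2.partTwo μ α x :=
      fun x hx => by linarith [h' x hx, hQ x hx]
    exact ⟨hind hK 1 fun x t => rfl, hind hK 2 fun x t => rfl, hind hK 5 fun x t => rfl⟩
  · have h4 := (HypJ2.vanishesAtInfinity_poisson_latitude hμ hW h0 h1 h2 h5).1 h6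
    -- G = 1, H = 0 is a base point that is admissible for every L < 0.
    refine ⟨fun L => W ![0, 0, 0, L, 1, 0], fun x hx => ?_⟩
    rw [h x hx, HypJ2.eq_of_pd_eq_zero hW hx (y := ![0, 0, 0, x 3, 1, 0])
      ⟨hx.1, by simp, by simp⟩ fun i => by
        fin_cases i
        · exact Or.inr h0
        · exact Or.inr h1
        · exact Or.inr h2
        · exact Or.inl rfl
        · exact Or.inr h4
        · exact Or.inr h5]
  · have hK : ∀ x ∈ HypJ2.domain, W x = Q (x 3) := fun x hx => by linarith [h x hx, hQ x hx]
    have h1 := hind hK 1 fun x t => rfl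
    have h2 := hind hK 2 fun x t => rfl
    have h5 := hind hK 5 fun x t => rfl
    exact ⟨h1, h2, h5, (HypJ2.vanishesAtInfinity_poisson_latitude hμ hW h0 h1 h2 h5).2
      (hind hK 4 fun x t => rfl)⟩
  · have h1 := (HypJ2.vanishesAtInfinity_poisson_angularMomentum μ hW h0).1 (hall 4)
    have h2 := (HypJ2.vanishesAtInfinity_poisson_polarMomentum μ hW h0).1 (hall 5)
    have h5 := (HypJ2.vanishesAtInfinity_poisson_node μ hW h0).1 (hall 2)
    have h4 := (HypJ2.vanishesAtInfinity_poisson_latitude hμ hW h0 h1 h2 h5).1 (hall 1)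
    have h3 := (HypJ2.vanishesAtInfinity_poisson_radius hμ hW h0 h1 h2 h4 h5).1 (hall 0)
    refine ⟨W ![0, 0, 0, -1, 1, 0], fun x hx => ?_⟩
    rw [h x hx, HypJ2.eq_of_pd_eq_zero hW hx (y := ![0, 0, 0, -1, 1, 0])
      ⟨by simp, by simp, by simp⟩ fun i => by
        fin_cases i
        · exact Or.inr h0
        · exact Or.inr h1
        · exact Or.inr h2
        · exact Or.inr h3
        · exact Or.inr h4
        · exact Or.inr h5]
  · have hK : ∀ x ∈ HypJ2.domain, W x = q := fun x hx => by linarith [h x hx, hq x hx]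
    intro i x hx
    refine tendsto_const_nhds.congr fun l => ?_
    have hp : ∀ j, HypJ2.pd j W (Function.update x 0 l) = 0 := fun j =>
      hind (K := fun _ => q) hK j (fun _ _ => rfl) _ (HypJ2.update_zero_mem_domain.2 hx)
    simp [HypJ2.poisson, hp]
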